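/- Let $k\ge 2$ and let $g(x)=a_0+a_1x+\dots+a_kx^k$ with $a_0,\dots,a_k\in\mathbb{Z}$ and $a_k\ge 1$. Put $\gamma=4^{1-k}$, and for real $\alpha,\beta$ let $\mathcal{B}(\alpha,\beta)=\{\lfloor n\alpha+\beta\rfloor : n=1,2,3,\dots\}$. For every $\varepsilon>0$ there is an effectively computable positive integer $l$, depending only on $g$ and $\varepsilon$ (there is an algorithm that computes such an $l$ from the coefficients of $g$ and any positive integer $N\ge 1/\varepsilon$), such that the following holds for every irrational $\alpha>1$ and every real $\beta$. Let $B=\max\{1,\beta\}$, and let $p_n$ ($n=0,1,2,\dots$) be the numerator of the $n$-th convergent of the regular continued fraction expansion of $\alpha/a_k$. There is a unique integer $m\ge 0$ with $$p_m\le \alpha^{\frac{1+\gamma}{\gamma}}B<p_{m+1},$$ there are primes $p$ with $g(p)\in\mathcal{B}(\alpha,\beta)$, and the least such prime $p$ satisfies $$p\le \alpha^{\frac{2k-1}{k\gamma}-\frac{(\gamma+1)\varepsilon}{\gamma}}\,B^{\frac{k-1}{k}-\frac{\varepsilon}{\gamma}}\,p_{m+l}^{\frac1k+\frac{\varepsilon}{\gamma}}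 .$$ -/

import Mathlib

open Polynomial

/-- The Beatty sequence `{⌊n α + β⌋ : n = 1, 2, 3, …}`. -/
def BeattySet (α β : ℝ) : Set ℤ :=
  {z | ∃ n : ℕ, 1 ≤ n ∧ z = ⌊(n : ℝ) * α + β⌋}

/-- `cfNum x n` is the numerator of the `n`-th convergent (`n = 0, 1, 2, …`) of the regular
continued fraction expansion of `x`, so that `cfNum x 0 = ⌊x⌋`. -/
noncomputable def cfNum (x : ℝ) (n : ℕ) : ℝ :=
  (GenContFract.of x).nums n

/-- The exponent `γ = 4 ^ (1 - k)` attached to the degree `k`. -/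
noncomputable def gam (k : ℕ) : ℝ := (4 : ℝ) ^ (1 - (k : ℝ))

/-! Write k = j + 1 and G = 4^j = 1/γ, and let ‖y‖ be the distance from y to the nearest integer.
The equation g(p) = ⌊nα + β⌋ says that n lies in a certain interval of length 1/α. So it suffices
that g(p) ≥ β and ‖f(p)‖ < 1/(2α), where f = g/α + const is the polynomial `phase`
(`mem_beattySet_of_nd_lt`). The leading coefficient of f is the inverse of v = α/a_k. Inverting the
convergents of v therefore approximates it by fractions whose denominators are the numerators p_n
(`exists_numerators`); this is why numerators govern the bound.

The analytic core is `sum_norm_vonMangoldt_le`: cancellation in ∑ Λ(n) e(h f(n)), n ≤ x, on average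
over h ≤ H. Vaughan's identity leaves linear and bilinear sums. Weyl differencing, in one variable
for the former and in both for the latter, reduces them to geometric sums whose frequencies are
integer multiples of one number θ. The divisor function bounds how often a multiple repeats, and the
multiples of θ are well spaced because of the approximation with denominator q (`sum_weyl_le`). Each
differencing costs a power 2^j, so the saving δ is limited by δ^G ≥ max(1/q, x^(-1/2), q/x^k).

Primes with ‖f(p)‖ small are detected by the nonnegative kernel |∑_{i<D} e(it)|^(2r). Taking r large
makes the kernel negligible at distance 1/(2α) although D exceeds α only by a small power of q
(`exists_prime_nd_lt`). Hence H = rD is barely larger than α, and one needs αδ to beat a small power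
of q (`exists_prime_of_approx`).

Finally put q = P = p_(m+l) and X^k = α^((2k-1)G) B^(k-1) P ζ^k, where ζ^N = P^G / (α^(G+1) B^G).
With this length the required saving exists (`exists_saving`). Constants, logarithms and divisor
bounds are absorbed by a small power of P once P exceeds α^(G+1) B by a factor depending only on g
and N. The numerators at least double every two steps, so a bounded shift l of the index reaches
this factor, and the factor is primitive recursive in the data. -/

namespace BeattyPrime

/-! ### Additive characters, distance to the nearest integer, geometric sums. -/

/-- The additive character `x ↦ exp (2 π i x)`. -/
noncomputable def e (x : ℝ) : ℂ := Complex.exp ((2 * Real.pi * x : ℝ) * Complex.I)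

/-- The distance to the nearest integer. -/
noncomputable def nd (x : ℝ) : ℝ := |x - round x|

/-- A smooth version of `min M (1 / (2 * nd x))`. -/
noncomputable def gk (M : ℕ) (x : ℝ) : ℝ := 2 * M / (1 + 2 * M * nd x)

lemma e_add (x y : ℝ) : e (x + y) = e x * e y := by
  unfold e
  rw [← Complex.exp_add]
  congr 1
  push_cast
  ring

lemma e_zero : e 0 = 1 := by simp [e]

lemma norm_e (x : ℝ) : ‖e x‖ = 1 := by
  unfold e
  exact Complex.norm_exp_ofReal_mul_I _

lemma e_neg (x : ℝ) : e (-x) = (e x)⁻¹ := by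
  refine eq_inv_of_mul_eq_one_left ?_
  rw [← e_add, neg_add_cancel, e_zero]

lemma conj_e (x : ℝ) : (starRingEnd ℂ) (e x) = e (-x) := by
  rw [e_neg, Complex.inv_eq_conj (norm_e x)]

lemma e_sub (x y : ℝ) : e (x - y) = e x * (starRingEnd ℂ) (e y) := by
  rw [conj_e, ← e_add, sub_eq_add_neg]

lemma e_nat_mul (n : ℕ) (x : ℝ) : e (n * x) = e x ^ n := by
  unfold e
  rw [← Complex.exp_nat_mul]
  congr 1
  push_cast
  ring

lemma nd_nonneg (x : ℝ) : 0 ≤ nd x := abs_nonneg _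

lemma nd_le (x : ℝ) (z : ℤ) : nd x ≤ |x - z| := round_le x z

lemma nd_neg (x : ℝ) : nd (-x) = nd x := by
  apply le_antisymm
  · refine (nd_le (-x) (-round x)).trans ?_
    rw [nd, ← abs_neg]
    push_cast
    ring_nf
    exact le_refl _
  · refine (nd_le x (-round (-x))).trans ?_
    rw [nd, ← abs_neg]
    push_cast
    ring_nf
    exact le_refl _

/-- Periodicity moves x into [-1/2, 1/2], where |e(x) - 1| = 2|sin πx| and Jordan's inequality |sin
y| ≥ (2/π)|y| applies. -/
lemma four_mul_nd_le_norm_e_sub_one (x : ℝ) : 4 * nd x ≤ ‖e x - 1‖ := by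
  have h1 : e x = e (x - round x) := by
    have h2 : e ((round x : ℤ) : ℝ) = 1 := by
      unfold e
      rw [Complex.exp_eq_one_iff]
      exact ⟨round x, by push_cast; ring⟩
    have h3 : x = (x - round x) + (round x : ℤ) := by ring
    conv_lhs => rw [h3, e_add, h2, mul_one]
  have h4 : ‖e (x - round x) - 1‖ = ‖2 * Real.sin (Real.pi * (x - round x))‖ := by
    unfold e
    rw [mul_comm, Complex.norm_exp_I_mul_ofReal_sub_one]
    congr 3
    ring
  rw [h1, h4, Real.norm_eq_abs, abs_mul, abs_two]
  have h5 := abs_sub_round x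
  have h6 : |Real.pi * (x - round x)| ≤ Real.pi / 2 := by
    rw [abs_mul, abs_of_pos Real.pi_pos]
    nlinarith [Real.pi_pos]
  have h7 := Real.mul_abs_le_abs_sin h6
  rw [abs_mul, abs_of_pos Real.pi_pos] at h7
  have h8 : 2 / Real.pi * (Real.pi * |x - round x|) = 2 * |x - round x| := by
    field_simp
  rw [h8] at h7
  unfold nd
  linarith

lemma sum_Ico_int_telescope (f : ℤ → ℂ) {a b : ℤ} (h : a ≤ b) :
    ∑ n ∈ Finset.Ico a b, (f (n + 1) - f n) = f b - f a := by
  induction b, h using Int.leInduction with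
  | base => simp
  | succ b hb ih =>
    rw [← Finset.insert_Ico_right_eq_Ico_add_one hb, Finset.sum_insert (by simp), ih]
    ring

lemma gk_nonneg (M : ℕ) (x : ℝ) : 0 ≤ gk M x := by
  have := nd_nonneg x
  unfold gk
  positivity

lemma gk_le (M : ℕ) (x : ℝ) : gk M x ≤ 2 * M := by
  have := nd_nonneg x
  unfold gk
  apply div_le_self (by positivity)
  have : 0 ≤ 2 * M * nd x := by positivity
  linarith

lemma gk_mul_nd_le (M : ℕ) (x : ℝ) : gk M x * nd x ≤ 1 := by
  have := nd_nonneg x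
  unfold gk
  rw [div_mul_eq_mul_div, div_le_one (by positivity)]
  linarith

lemma gk_neg (M : ℕ) (x : ℝ) : gk M (-x) = gk M x := by
  simp [gk, nd_neg]

/-- The trivial bound ‖S‖ ≤ M and the geometric bound 2‖S‖·`nd x` ≤ 1, the latter multiplied by M,
add up to ‖S‖(1 + 2M·`nd x`) ≤ 2M. The smooth `gk` thus replaces the usual minimum without a case
distinction. -/
lemma norm_sum_e_le (x c : ℝ) (a b : ℤ) (M : ℕ) (h : b - a ≤ M) :
    ‖∑ n ∈ Finset.Ico a b, e (x * n + c)‖ ≤ gk M x := by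
  rcases lt_or_ge b a with hab | hab
  · rw [Finset.Ico_eq_empty (by omega)]
    simpa using gk_nonneg M x
  set S := ∑ n ∈ Finset.Ico a b, e (x * n + c) with hS
  have h1 : ‖S‖ ≤ M := by
    refine (norm_sum_le _ _).trans ?_
    simp only [norm_e, Finset.sum_const, Int.card_Ico, nsmul_eq_mul, mul_one]
    exact_mod_cast (by omega : (b - a).toNat ≤ M)
  have h2 : S * (e x - 1) = e (x * b + c) - e (x * a + c) := by
    rw [← sum_Ico_int_telescope (fun n : ℤ => e (x * n + c)) hab, hS, Finset.sum_mul]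
    refine Finset.sum_congr rfl fun n _ => ?_
    have : x * ((n + 1 : ℤ) : ℝ) + c = (x * n + c) + x := by push_cast; ring
    simp only [this]
    rw [e_add (x * n + c) x]
    ring
  have h3 : ‖S‖ * ‖e x - 1‖ ≤ 2 := by
    rw [← norm_mul, h2]
    refine (norm_sub_le _ _).trans ?_
    rw [norm_e, norm_e]
    norm_num
  have h4 := four_mul_nd_le_norm_e_sub_one x
  have h5 : ‖S‖ * nd x * 2 ≤ 1 := by nlinarith [norm_nonneg S]
  have := nd_nonneg x
  unfold gk
  rw [le_div_iff₀ (by positivity)]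
  have hM : (0 : ℝ) ≤ M := Nat.cast_nonneg M
  nlinarith [norm_nonneg S]

/-! ### Spacing of the multiples of a number with a rational approximation. -/

/-- Let z be the integer nearest to θd. Since q does not divide d, the integer ad - zq is nonzero;
it differs from q(θd - z) by at most q · q⁻² · q/2 = 1/2. -/
lemma nd_mul_int_ge {θ : ℝ} {a : ℤ} {q : ℕ} (hq : 1 ≤ q) (hco : IsCoprime a (q : ℤ))
    (hθ : |θ - a / q| ≤ 1 / (q : ℝ) ^ 2) {d : ℤ} (hd : d ≠ 0) (hdq : 2 * |d| ≤ q) :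
    1 / (2 * (q : ℝ)) ≤ nd (θ * d) := by
  have hq0 : (0 : ℝ) < q := by exact_mod_cast hq
  set z := round (θ * d) with hz
  have h1 : (a * d - z * q : ℤ) ≠ 0 := by
    intro h
    have h2 : (q : ℤ) ∣ a * d := ⟨z, by linarith⟩
    have h3 : (q : ℤ) ∣ d := hco.symm.dvd_of_dvd_mul_left h2
    have h4 := Int.le_of_dvd (abs_pos.mpr hd) ((dvd_abs _ _).mpr h3)
    have : (0 : ℤ) < q := by exact_mod_cast hq
    omega
  have h2 : (1 : ℝ) ≤ |(a : ℝ) * d - z * q| := by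
    have := Int.one_le_abs h1
    exact_mod_cast this
  have h3 : |(d : ℝ)| ≤ q / 2 := by
    have : (2 : ℝ) * |(d : ℝ)| ≤ q := by exact_mod_cast hdq
    linarith
  have h4 : (a : ℝ) * d - z * q = q * (θ * d - z) - q * ((θ - a / q) * d) := by
    field_simp
    ring
  have h5 : |q * ((θ - a / q) * d)| ≤ 1 / 2 := by
    rw [abs_mul, abs_mul, abs_of_pos hq0]
    calc (q : ℝ) * (|θ - a / q| * |(d : ℝ)|) ≤ q * (1 / (q : ℝ) ^ 2 * (q / 2)) := by gcongr
      _ = 1 / 2 := by field_simp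
  have h6 : 1 ≤ q * |θ * d - z| + 1 / 2 := by
    calc (1 : ℝ) ≤ |q * (θ * d - z) - q * ((θ - a / q) * d)| := by rw [← h4]; exact h2
      _ ≤ |q * (θ * d - z)| + |q * ((θ - a / q) * d)| := abs_sub _ _
      _ ≤ q * |θ * d - z| + 1 / 2 := by
        rw [abs_mul (q : ℝ), abs_of_pos hq0]
        linarith
  unfold nd
  rw [← hz, div_le_iff₀ (by positivity)]
  linarith

/-- A sum over values of `θ v` for `v` in a short block. -/
lemma sum_gk_block_le {θ : ℝ} {a : ℤ} {q : ℕ} (hq : 1 ≤ q) (hco : IsCoprime a (q : ℤ))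
    (hθ : |θ - a / q| ≤ 1 / (q : ℝ) ^ 2) (M : ℕ) (s : Finset ℕ)
    (hs : ∀ u ∈ s, ∀ v ∈ s, 2 * |(u : ℤ) - v| ≤ q) :
    ∑ v ∈ s, gk M (θ * v) ≤ 4 * M + 8 * q * (1 + Real.log q) := by
  have hq0 : (0 : ℝ) < q := by exact_mod_cast hq
  -- Index of the cell of length 1/(2q) containing the fractional part of θv. Points of a short
  -- block are at least 1/(2q) apart modulo 1, so no cell is used twice and the sum is compared with
  -- a harmonic sum over cells.
  let b : ℕ → ℕ := fun v => ⌊2 * q * Int.fract (θ * (v : ℝ))⌋₊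
  have hb_lt : ∀ v, b v < 2 * q := by
    intro v
    have h1 := Int.fract_lt_one (θ * v)
    have h2 := Int.fract_nonneg (θ * v)
    rw [Nat.floor_lt (by positivity)]
    push_cast
    nlinarith
  have hb_le : ∀ v : ℕ, (b v : ℝ) ≤ 2 * q * Int.fract (θ * v) := by
    intro v
    have h2 := Int.fract_nonneg (θ * v)
    exact Nat.floor_le (by positivity)
  have hb_lt' : ∀ v : ℕ, 2 * q * Int.fract (θ * v) < b v + 1 := fun v => Nat.lt_floor_add_one _
  have hinj : Set.InjOn b s := by
    intro u hu v hv huv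
    by_contra hne
    have h1 := nd_mul_int_ge hq hco hθ (d := (u : ℤ) - v) (by omega) (hs u hu v hv)
    have h2 : nd (θ * ((u : ℤ) - v : ℤ)) < 1 / (2 * (q : ℝ)) := by
      refine (nd_le _ (⌊θ * u⌋ - ⌊θ * v⌋)).trans_lt ?_
      have h3 : θ * (((u : ℤ) - v : ℤ) : ℝ) - ((⌊θ * u⌋ - ⌊θ * v⌋ : ℤ) : ℝ)
          = Int.fract (θ * u) - Int.fract (θ * v) := by
        rw [← Int.self_sub_floor, ← Int.self_sub_floor]
        push_cast
        ring
      rw [h3, abs_lt, lt_div_iff₀ (by positivity), neg_lt, neg_sub, lt_div_iff₀ (by positivity)]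
      have := hb_le u
      have := hb_le v
      have := hb_lt' u
      have := hb_lt' v
      rw [huv] at *
      constructor <;> nlinarith
    linarith
  -- comparison function
  let G : ℕ → ℝ := fun i => if i = 0 then 2 * M else 2 * q / i
  have hG0 : ∀ i, 0 ≤ G i := by
    intro i
    simp only [G]
    split_ifs <;> positivity
  -- The nearest integer may lie on either side: the distance is at least b/(2q) from the left or
  -- (2q - 1 - b)/(2q) from the right. The sum of both bounds covers the two cases.
  have hbound : ∀ v : ℕ, gk M (θ * v) ≤ G (b v) + G (2 * q - 1 - b v) := by
    intro v
    have hlt := hb_lt v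
    have hle := hb_le v
    have hlt' := hb_lt' v
    have hg := gk_mul_nd_le M (θ * v)
    have hgn := gk_nonneg M (θ * v)
    have hgle := gk_le M (θ * v)
    by_cases h0 : b v = 0
    · have : G (b v) = 2 * M := by simp [G, h0]
      linarith [hG0 (2 * q - 1 - b v)]
    by_cases h1 : 2 * q - 1 - b v = 0
    · have : G (2 * q - 1 - b v) = 2 * M := by simp [G, h1]
      linarith [hG0 (b v)]
    have hb1 : (0 : ℝ) < b v := by exact_mod_cast Nat.pos_of_ne_zero h0
    have hc : ((2 * q - 1 - b v : ℕ) : ℝ) = 2 * q - 1 - b v := by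
      rw [Nat.cast_sub (by omega), Nat.cast_sub (by omega)]
      push_cast
      ring
    have hc1 : (0 : ℝ) < 2 * q - 1 - b v := by
      rw [← hc]
      exact_mod_cast Nat.pos_of_ne_zero h1
    have hnd : nd (θ * v) = min (Int.fract (θ * v)) (1 - Int.fract (θ * v)) :=
      abs_sub_round_eq_min _
    rcases min_choice (Int.fract (θ * v)) (1 - Int.fract (θ * v)) with h | h
    · rw [hnd, h] at hg
      have h3 : gk M (θ * v) ≤ G (b v) := by
        simp only [G, h0, if_false]
        rw [le_div_iff₀ hb1]
        nlinarith
      linarith [hG0 (2 * q - 1 - b v)]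
    · rw [hnd, h] at hg
      have h3 : gk M (θ * v) ≤ G (2 * q - 1 - b v) := by
        simp only [G, h1, if_false]
        rw [hc, le_div_iff₀ hc1]
        nlinarith
      linarith [hG0 (b v)]
  have hsum : ∑ i ∈ Finset.range (2 * q), G i ≤ 2 * M + 2 * q * (2 + Real.log q) := by
    obtain ⟨n, hn⟩ : ∃ n, 2 * q = n + 1 := ⟨2 * q - 1, by omega⟩
    have hharm : (harmonic n : ℝ) ≤ 2 + Real.log q := by
      have h1 : (harmonic n : ℝ) ≤ 1 + Real.log n := harmonic_le_one_add_log n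
      have h2 : Real.log n ≤ Real.log (2 * q) := by
        apply Real.log_le_log
        · exact_mod_cast (by omega : 0 < n)
        · exact_mod_cast (by omega : n ≤ 2 * q)
      rw [Real.log_mul (by norm_num) hq0.ne'] at h2
      have h3 := Real.log_two_lt_d9
      linarith
    rw [hn, Finset.sum_range_succ']
    have h4 : ∑ i ∈ Finset.range n, G (i + 1) = 2 * q * (harmonic n : ℝ) := by
      rw [harmonic, Rat.cast_sum, Finset.mul_sum]
      refine Finset.sum_congr rfl fun i _ => ?_
      simp only [G, Nat.succ_ne_zero, if_false]
      push_cast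
      rw [div_eq_mul_inv]
    have h5 : G 0 = 2 * M := by simp [G]
    rw [h4, h5]
    nlinarith
  have hfirst : ∑ v ∈ s, G (b v) ≤ ∑ i ∈ Finset.range (2 * q), G i := by
    rw [← Finset.sum_image (f := G) (g := b) hinj]
    refine Finset.sum_le_sum_of_subset_of_nonneg ?_ fun i _ _ => hG0 i
    intro i hi
    obtain ⟨v, _, rfl⟩ := Finset.mem_image.mp hi
    exact Finset.mem_range.mpr (hb_lt v)
  have hsecond : ∑ v ∈ s, G (2 * q - 1 - b v) ≤ ∑ i ∈ Finset.range (2 * q), G i := by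
    have hinj2 : Set.InjOn (fun v => 2 * q - 1 - b v) s := by
      intro u hu v hv huv
      apply hinj hu hv
      have := hb_lt u
      have := hb_lt v
      simp only at huv
      omega
    rw [← Finset.sum_image (f := G) (g := fun v => 2 * q - 1 - b v) hinj2]
    refine Finset.sum_le_sum_of_subset_of_nonneg ?_ fun i _ _ => hG0 i
    intro i hi
    obtain ⟨v, _, rfl⟩ := Finset.mem_image.mp hi
    exact Finset.mem_range.mpr (by omega)
  have hlog : 0 ≤ Real.log q := Real.log_nonneg (by exact_mod_cast hq)
  calc ∑ v ∈ s, gk M (θ * v) ≤ ∑ v ∈ s, (G (b v) + G (2 * q - 1 - b v)) :=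
        Finset.sum_le_sum fun v _ => hbound v
    _ ≤ 2 * (2 * M + 2 * q * (2 + Real.log q)) := by
        rw [Finset.sum_add_distrib]
        linarith
    _ ≤ 4 * M + 8 * q * (1 + Real.log q) := by nlinarith

/-- Cut [1, Y] into runs of q/2 + 1 consecutive integers, inside which differences are at most q/2,
and apply the block estimate to each of the at most 2Y/q + 1 runs. -/
lemma sum_gk_le {θ : ℝ} {a : ℤ} {q : ℕ} (hq : 1 ≤ q) (hco : IsCoprime a (q : ℤ))
    (hθ : |θ - a / q| ≤ 1 / (q : ℝ) ^ 2) (M Y : ℕ) :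
    ∑ v ∈ Finset.Icc 1 Y, gk M (θ * v)
      ≤ (2 * Y / q + 1) * (4 * M + 8 * q * (1 + Real.log q)) := by
  have hq0 : (0 : ℝ) < q := by exact_mod_cast hq
  set B := q / 2 + 1 with hB
  have hBpos : 0 < B := by omega
  have h1 : ∑ v ∈ Finset.Icc 1 Y, gk M (θ * v)
      = ∑ i ∈ Finset.range (Y / B + 1), ∑ v ∈ Finset.Icc 1 Y with v / B = i, gk M (θ * v) := by
    rw [Finset.sum_fiberwise_of_maps_to]
    intro v hv
    rw [Finset.mem_Icc] at hv
    exact Finset.mem_range.mpr (Nat.lt_succ_of_le (Nat.div_le_div_right hv.2))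
  have h2 : ∀ i ∈ Finset.range (Y / B + 1),
      ∑ v ∈ Finset.Icc 1 Y with v / B = i, gk M (θ * v)
        ≤ 4 * M + 8 * q * (1 + Real.log q) := by
    intro i _
    apply sum_gk_block_le hq hco hθ
    intro u hu v hv
    simp only [Finset.mem_filter] at hu hv
    have h3 := Nat.div_add_mod u B
    have h4 := Nat.div_add_mod v B
    have h5 := Nat.mod_lt u hBpos
    have h6 := Nat.mod_lt v hBpos
    rw [hu.2] at h3
    rw [hv.2] at h4
    have h7 : |(u : ℤ) - v| ≤ q / 2 := by
      rw [abs_le]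
      constructor <;> omega
    omega
  have hlog : 0 ≤ Real.log q := Real.log_nonneg (by exact_mod_cast hq)
  rw [h1]
  refine (Finset.sum_le_sum h2).trans ?_
  rw [Finset.sum_const, Finset.card_range, nsmul_eq_mul]
  gcongr
  push_cast
  gcongr
  have h8 : ((Y / B : ℕ) : ℝ) ≤ Y / B := Nat.cast_div_le
  have h9 : (q : ℝ) / 2 ≤ B := by
    have : q ≤ 2 * B := by omega
    have h10 : (q : ℝ) ≤ 2 * B := by exact_mod_cast this
    linarith
  calc ((Y / B : ℕ) : ℝ) ≤ Y / B := h8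
    _ ≤ Y / (q / 2) := by gcongr
    _ = 2 * Y / q := by field_simp

/-! ### Weyl differencing for functions on an interval. -/

/-- Iterated multiplicative differencing, with shifts `t`. -/
noncomputable def dd : (j : ℕ) → (Fin j → ℤ) → (ℤ → ℂ) → ℤ → ℂ
  | 0, _, φ, n => φ n
  | j + 1, t, φ, n =>
    dd j (Fin.tail t) φ (n + t 0) * (starRingEnd ℂ) (dd j (Fin.tail t) φ n)

/-- Iterated additive differencing, with shifts `t`. -/
noncomputable def da : (j : ℕ) → (Fin j → ℤ) → (ℤ → ℝ) → ℤ → ℝ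
  | 0, _, f, n => f n
  | j + 1, t, f, n => da j (Fin.tail t) f (n + t 0) - da j (Fin.tail t) f n

/-- The box of shifts `|t i| < N`. -/
noncomputable def box (j N : ℕ) : Finset (Fin j → ℤ) := Fintype.piFinset fun _ => Finset.Ioo (-(N : ℤ)) N

lemma mem_box {j N : ℕ} {t : Fin j → ℤ} : t ∈ box j N ↔ ∀ i, |t i| < N := by
  simp [box, Fintype.mem_piFinset, abs_lt]

lemma card_Ioo_le (N : ℕ) : (Finset.Ioo (-(N : ℤ)) N).card ≤ 2 * N := by
  rw [Int.card_Ioo]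
  omega

lemma card_box_le (j N : ℕ) : (box j N).card ≤ (2 * N) ^ j := by
  rw [box, Fintype.card_piFinset]
  simp only [Finset.prod_const, Finset.card_univ, Fintype.card_fin]
  exact Nat.pow_le_pow_left (card_Ioo_le N) j

lemma sum_box_succ {β : Type*} [AddCommMonoid β] (j N : ℕ) (F : (Fin (j + 1) → ℤ) → β) :
    ∑ t ∈ box (j + 1) N, F t
      = ∑ t ∈ box j N, ∑ a ∈ Finset.Ioo (-(N : ℤ)) N, F (Fin.cons a t : Fin (j + 1) → ℤ) := by
  rw [← Finset.sum_product']
  refine Finset.sum_nbij' (fun t => (Fin.tail t, t 0)) (fun p => Fin.cons p.2 p.1) ?_ ?_ ?_ ?_ ?_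
  · intro t ht
    rw [mem_box] at ht
    rw [Finset.mem_product, mem_box, Finset.mem_Ioo, ← abs_lt]
    exact ⟨fun i => ht i.succ, ht 0⟩
  · rintro ⟨t, a⟩ ht
    rw [Finset.mem_product, mem_box, Finset.mem_Ioo, ← abs_lt] at ht
    rw [mem_box]
    intro i
    refine Fin.cases ?_ (fun i => ?_) i
    · simpa using ht.2
    · simpa using ht.1 i
  · intro t _
    exact Fin.cons_self_tail t
  · rintro ⟨t, a⟩ _
    simp
  · intro t _
    rw [Fin.cons_self_tail]

lemma dd_cons (j : ℕ) (a : ℤ) (t : Fin j → ℤ) (φ : ℤ → ℂ) (n : ℤ) :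
    dd (j + 1) (Fin.cons a t) φ n = dd j t φ (n + a) * (starRingEnd ℂ) (dd j t φ n) := by
  simp [dd]

/-- The unshifted copy is a factor at every level, so differencing never enlarges the support and
all sums can stay on one fixed interval. -/
lemma dd_eq_zero (j : ℕ) (t : Fin j → ℤ) (φ : ℤ → ℂ) (n : ℤ) (h : φ n = 0) :
    dd j t φ n = 0 := by
  induction j with
  | zero => exact h
  | succ j ih => simp [dd, ih]

/-- Squaring out a sum supported on an interval. -/
lemma norm_sq_sum_eq (N : ℕ) (a : ℤ) (ψ : ℤ → ℂ)
    (hψ : ∀ n, n ∉ Finset.Ico a (a + N) → ψ n = 0) :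
    ((‖∑ n ∈ Finset.Ico a (a + N), ψ n‖ ^ 2 : ℝ) : ℂ)
      = ∑ s ∈ Finset.Ioo (-(N : ℤ)) N, ∑ n ∈ Finset.Ico a (a + N),
          ψ (n + s) * (starRingEnd ℂ) (ψ n) := by
  have h1 : ((‖∑ n ∈ Finset.Ico a (a + N), ψ n‖ ^ 2 : ℝ) : ℂ)
      = (∑ n ∈ Finset.Ico a (a + N), ψ n) *
        (starRingEnd ℂ) (∑ n ∈ Finset.Ico a (a + N), ψ n) := by
    rw [Complex.mul_conj, Complex.normSq_eq_norm_sq]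
  rw [h1, map_sum, Finset.sum_mul_sum, Finset.sum_comm, Finset.sum_comm (s := Finset.Ioo _ _)]
  refine Finset.sum_congr rfl fun n hn => ?_
  rw [Finset.mem_Ico] at hn
  have h2 : ∑ s ∈ Finset.Ioo (-(N : ℤ)) N, ψ (n + s) * (starRingEnd ℂ) (ψ n)
      = ∑ m ∈ Finset.Ioo (n - N) (n + N), ψ m * (starRingEnd ℂ) (ψ n) := by
    refine Finset.sum_nbij' (fun s => n + s) (fun m => m - n) ?_ ?_ ?_ ?_ ?_
    · intro s hs
      rw [Finset.mem_Ioo] at hs ⊢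
      omega
    · intro s hs
      rw [Finset.mem_Ioo] at hs ⊢
      omega
    · intros
      ring
    · intros
      ring
    · intros
      rfl
  rw [h2]
  refine Finset.sum_subset ?_ ?_
  · intro m hm
    rw [Finset.mem_Ico] at hm
    rw [Finset.mem_Ioo]
    omega
  · intro m _ hm
    rw [hψ m hm, zero_mul]

/-- Summation over the newest shift reassembles an absolute square. In particular the differenced
sum is real and nonnegative, so Weyl's inequality can be stated with a real part, which stays linear
and allows further summation before absolute values are taken. -/
lemma sum_dd_succ_eq (N : ℕ) (a : ℤ) (φ : ℤ → ℂ)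
    (hφ : ∀ n, n ∉ Finset.Ico a (a + N) → φ n = 0) (j : ℕ) :
    (∑ t ∈ box (j + 1) N, ∑ n ∈ Finset.Ico a (a + N), dd (j + 1) t φ n)
      = ((∑ t ∈ box j N, ‖∑ n ∈ Finset.Ico a (a + N), dd j t φ n‖ ^ 2 : ℝ) : ℂ) := by
  rw [sum_box_succ, Complex.ofReal_sum]
  refine Finset.sum_congr rfl fun t _ => ?_
  rw [norm_sq_sum_eq N a _ fun n hn => dd_eq_zero j t φ n (hφ n hn)]
  simp only [dd_cons]

/-- Induction: square, apply Cauchy–Schwarz over the at most (2N)^j shifts, and expand the inner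
squares. The exponents obey 2^(j+1) - (j+1) - 1 = 2(2^j - j - 1) + j; truncated subtraction is
harmless because j < 2^j. -/
lemma weyl_differencing_norm (N : ℕ) (a : ℤ) (φ : ℤ → ℂ)
    (hφ : ∀ n, n ∉ Finset.Ico a (a + N) → φ n = 0) (j : ℕ) :
    ‖∑ n ∈ Finset.Ico a (a + N), φ n‖ ^ 2 ^ j
      ≤ (2 * N : ℝ) ^ (2 ^ j - j - 1) *
        ‖∑ t ∈ box j N, ∑ n ∈ Finset.Ico a (a + N), dd j t φ n‖ := by
  induction j with
  | zero =>
    have h1 : box 0 N = {default} := by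
      ext t
      simp [mem_box, Subsingleton.elim t default]
    simp [h1, dd]
  | succ j ih =>
    set W := ∑ t ∈ box j N, ∑ n ∈ Finset.Ico a (a + N), dd j t φ n with hW
    have h1 : ‖W‖ ^ 2 ≤ (2 * N : ℝ) ^ j *
        ‖∑ t ∈ box (j + 1) N, ∑ n ∈ Finset.Ico a (a + N), dd (j + 1) t φ n‖ := by
      have h2 : ‖W‖ ^ 2 ≤ (box j N).card *
          ∑ t ∈ box j N, ‖∑ n ∈ Finset.Ico a (a + N), dd j t φ n‖ ^ 2 := by
        calc ‖W‖ ^ 2 ≤ (∑ t ∈ box j N, ‖∑ n ∈ Finset.Ico a (a + N), dd j t φ n‖) ^ 2 := by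
              gcongr
              exact norm_sum_le _ _
          _ ≤ _ := sq_sum_le_card_mul_sum_sq
      rw [sum_dd_succ_eq N a φ hφ, Complex.norm_real, Real.norm_of_nonneg (by positivity)]
      refine h2.trans ?_
      gcongr
      exact_mod_cast card_box_le j N
    have hexp : 2 ^ (j + 1) - (j + 1) - 1 = (2 ^ j - j - 1) * 2 + j := by
      have : j < 2 ^ j := Nat.lt_two_pow_self
      rw [pow_succ]
      omega
    calc ‖∑ n ∈ Finset.Ico a (a + N), φ n‖ ^ 2 ^ (j + 1)
        = (‖∑ n ∈ Finset.Ico a (a + N), φ n‖ ^ 2 ^ j) ^ 2 := by rw [← pow_mul, pow_succ]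
      _ ≤ ((2 * N : ℝ) ^ (2 ^ j - j - 1) * ‖W‖) ^ 2 := by gcongr
      _ = (2 * N : ℝ) ^ ((2 ^ j - j - 1) * 2) * ‖W‖ ^ 2 := by rw [mul_pow, pow_mul]
      _ ≤ (2 * N : ℝ) ^ ((2 ^ j - j - 1) * 2) * ((2 * N : ℝ) ^ j *
        ‖∑ t ∈ box (j + 1) N, ∑ n ∈ Finset.Ico a (a + N), dd (j + 1) t φ n‖) := by gcongr
      _ = _ := by rw [hexp, pow_add, mul_assoc]

/-- Weyl's inequality for an arbitrary function supported on an interval. -/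
theorem weyl_differencing (N : ℕ) (a : ℤ) (φ : ℤ → ℂ)
    (hφ : ∀ n, n ∉ Finset.Ico a (a + N) → φ n = 0) {j : ℕ} (hj : 1 ≤ j) :
    ‖∑ n ∈ Finset.Ico a (a + N), φ n‖ ^ 2 ^ j
      ≤ (2 * N : ℝ) ^ (2 ^ j - j - 1) *
        (∑ t ∈ box j N, ∑ n ∈ Finset.Ico a (a + N), dd j t φ n).re := by
  obtain ⟨i, rfl⟩ : ∃ i, j = i + 1 := ⟨j - 1, by omega⟩
  have h := weyl_differencing_norm N a φ hφ (i + 1)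
  rw [sum_dd_succ_eq N a φ hφ, Complex.norm_real, Real.norm_of_nonneg (by positivity)] at h
  rwa [sum_dd_succ_eq N a φ hφ, Complex.ofReal_re]

lemma dd_mul (j : ℕ) (t : Fin j → ℤ) (φ ψ : ℤ → ℂ) (n : ℤ) :
    dd j t (fun m => φ m * ψ m) n = dd j t φ n * dd j t ψ n := by
  induction j generalizing n with
  | zero => rfl
  | succ j ih =>
    simp only [dd, ih, map_mul]
    ring

lemma dd_e (j : ℕ) (t : Fin j → ℤ) (f : ℤ → ℝ) (n : ℤ) :
    dd j t (fun m => e (f m)) n = e (da j t f n) := by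
  induction j generalizing n with
  | zero => rfl
  | succ j ih => simp only [dd, da, ih, e_sub]

lemma norm_dd_le (j : ℕ) (t : Fin j → ℤ) (φ : ℤ → ℂ) (B : ℝ) (hB : ∀ n, ‖φ n‖ ≤ B) (n : ℤ) :
    ‖dd j t φ n‖ ≤ B ^ 2 ^ j := by
  have hB0 : 0 ≤ B := (norm_nonneg _).trans (hB 0)
  induction j generalizing n with
  | zero => simpa [dd] using hB n
  | succ j ih =>
    rw [dd, norm_mul, RCLike.norm_conj, pow_succ 2 j, pow_mul, sq]
    have := ih (Fin.tail t)
    gcongr <;> exact this _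

/-! ### Differencing of cut-offs and of polynomials. -/

/-- The indicator function of an integer interval. -/
noncomputable def ind (a b n : ℤ) : ℂ := if n ∈ Finset.Ico a b then 1 else 0

lemma ind_mul_ind (a b c d n : ℤ) : ind a b n * ind c d n = ind (max a c) (min b d) n := by
  unfold ind
  simp only [Finset.mem_Ico, max_le_iff, lt_min_iff]
  split_ifs <;> simp_all

lemma ind_add (a b n s : ℤ) : ind a b (n + s) = ind (a - s) (b - s) n := by
  unfold ind
  simp only [Finset.mem_Ico]
  congr 1
  apply propext
  constructor <;> intro h <;> omega

lemma conj_ind (a b n : ℤ) : (starRingEnd ℂ) (ind a b n) = ind a b n := by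
  unfold ind
  split_ifs <;> simp

/-- A product of indicators of translates of an interval is the indicator of their intersection,
again a possibly empty interval. -/
lemma dd_ind (j : ℕ) (t : Fin j → ℤ) (a b : ℤ) :
    ∃ a' b', a ≤ a' ∧ b' ≤ b ∧ ∀ n, dd j t (ind a b) n = ind a' b' n := by
  induction j with
  | zero => exact ⟨a, b, le_refl _, le_refl _, fun n => rfl⟩
  | succ j ih =>
    obtain ⟨a', b', ha, hb, h⟩ := ih (Fin.tail t)
    refine ⟨max (a' - t 0) a', min (b' - t 0) b', ha.trans (le_max_right _ _),
      (min_le_right _ _).trans hb, fun n => ?_⟩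
    rw [dd, h, h, conj_ind, ind_add, ind_mul_ind]

/-- Differencing in one variable keeps sections in the other variable intervals. -/
lemma dd_ind_section (j : ℕ) (t : Fin j → ℤ) (w : ℤ → ℤ → ℂ) (a b : ℤ → ℤ)
    (hw : ∀ m n, w m n = ind (a n) (b n) m) (n : ℤ) :
    ∃ a' b', a n ≤ a' ∧ b' ≤ b n ∧ ∀ m, dd j t (w m) n = ind a' b' m := by
  induction j generalizing n with
  | zero => exact ⟨a n, b n, le_refl _, le_refl _, fun m => hw m n⟩
  | succ j ih =>
    obtain ⟨a', b', ha, hb, h⟩ := ih (Fin.tail t) n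
    obtain ⟨a'', b'', _, _, h'⟩ := ih (Fin.tail t) (n + t 0)
    refine ⟨max a'' a', min b'' b', ha.trans (le_max_right _ _),
      (min_le_right _ _).trans hb, fun m => ?_⟩
    rw [dd, h, h', conj_ind, ind_mul_ind]

lemma da_sum {ι : Type*} (j : ℕ) (t : Fin j → ℤ) (s : Finset ι) (c : ι → ℝ) (f : ι → ℤ → ℝ)
    (n : ℤ) : da j t (fun m => ∑ i ∈ s, c i * f i m) n = ∑ i ∈ s, c i * da j t (f i) n := by
  induction j generalizing n with
  | zero => rfl
  | succ j ih =>
    simp only [da, ih, mul_sub, Finset.sum_sub_distrib]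

lemma taylor_coeff_eq_sum {Q : ℝ[X]} {m s : ℕ} (hQ : Q.natDegree ≤ m + s) (c : ℝ) :
    (taylor c Q).coeff m
      = ∑ i ∈ Finset.range (s + 1), ((i + m).choose m : ℝ) * Q.coeff (i + m) * c ^ i := by
  rw [taylor_coeff, eval_eq_sum_range' (n := s + 1)]
  · simp only [hasseDeriv_coeff]
  · have := natDegree_hasseDeriv_le Q m
    omega

lemma natDegree_taylor_sub_le {Q : ℝ[X]} {i : ℕ} (hQ : Q.natDegree ≤ i + 1) (c : ℝ) :
    (taylor c Q - Q).natDegree ≤ i := by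
  rw [natDegree_le_iff_coeff_eq_zero]
  intro m hm
  rw [coeff_sub, taylor_coeff_eq_sum (s := 0) (hQ.trans hm)]
  simp

lemma coeff_taylor_sub {Q : ℝ[X]} {i : ℕ} (hQ : Q.natDegree ≤ i + 1) (c : ℝ) :
    (taylor c Q - Q).coeff i = (i + 1) * c * Q.coeff (i + 1) := by
  rw [coeff_sub, taylor_coeff_eq_sum (s := 1) hQ]
  rw [Finset.sum_range_succ, Finset.sum_range_one, add_comm 1 i, Nat.choose_succ_self_right]
  simp only [zero_add, Nat.choose_self, pow_zero, pow_one]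
  push_cast
  ring

lemma coeff_taylor_sub_two {Q : ℝ[X]} {i : ℕ} (hQ : Q.natDegree ≤ i + 2) (c : ℝ) :
    2 * (taylor c Q - Q).coeff i
      = 2 * (i + 1) * c * Q.coeff (i + 1) + (i + 2) * (i + 1) * c ^ 2 * Q.coeff (i + 2) := by
  rw [coeff_sub, taylor_coeff_eq_sum (s := 2) hQ]
  rw [Finset.sum_range_succ, Finset.sum_range_succ, Finset.sum_range_one, add_comm 1 i,
    add_comm 2 i, Nat.choose_succ_self_right]
  have h : ((i + 2).choose i : ℝ) = (i + 2) * (i + 1) / 2 := by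
    rw [Nat.choose_symm_add, Nat.cast_choose_two]
    push_cast
    ring
  rw [h]
  simp only [zero_add, Nat.choose_self, pow_zero, pow_one]
  push_cast
  ring

/-- Each step lowers the degree by one and multiplies the leading coefficient by the current degree
times the shift. -/
lemma da_eval (P : ℝ[X]) (i j : ℕ) (hP : P.natDegree ≤ i + j) (t : Fin j → ℤ) :
    ∃ Q : ℝ[X], Q.natDegree ≤ i ∧
      Q.coeff i = (i + j).descFactorial j * (∏ l, (t l : ℝ)) * P.coeff (i + j) ∧
      ∀ n : ℤ, da j t (fun m => P.eval (m : ℝ)) n = Q.eval (n : ℝ) := by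
  induction j generalizing i with
  | zero => exact ⟨P, hP, by simp, fun n => rfl⟩
  | succ j ih =>
    obtain ⟨Q, hQ1, hQ2, hQ3⟩ := ih (i + 1) (by omega) (Fin.tail t)
    refine ⟨taylor (t 0 : ℝ) Q - Q, natDegree_taylor_sub_le hQ1 _, ?_, fun n => ?_⟩
    · have h1 : i + (j + 1) = i + 1 + j := by ring
      rw [coeff_taylor_sub hQ1, hQ2, h1, Nat.descFactorial_succ, Fin.prod_univ_succ]
      have h2 : i + 1 + j - j = i + 1 := by omega
      rw [h2]
      simp only [Fin.tail]
      push_cast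
      ring
    · rw [da, hQ3, hQ3, eval_sub, taylor_eval]
      push_cast
      ring

/-- The two top coefficients are tracked together, because the last differenced polynomial is linear
and its constant term is needed as well. The second one is doubled to avoid halves. -/
lemma da_pow_aux (i j : ℕ) (t : Fin j → ℤ) :
    ∃ Q : ℝ[X], Q.natDegree ≤ i + 1 ∧
      Q.coeff (i + 1) = (i + 1 + j).descFactorial j * ∏ l, (t l : ℝ) ∧
      2 * Q.coeff i = (i + 1) * Q.coeff (i + 1) * ∑ l, (t l : ℝ) ∧
      ∀ n : ℤ, da j t (fun m => (m : ℝ) ^ (i + 1 + j)) n = Q.eval (n : ℝ) := by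
  induction j generalizing i with
  | zero =>
    refine ⟨X ^ (i + 1), by simp, by simp, ?_, fun n => by simp [da]⟩
    simp [coeff_X_pow]
  | succ j ih =>
    obtain ⟨Q, hQ1, hQ2, hQ3, hQ4⟩ := ih (i + 1) (Fin.tail t)
    have hc := coeff_taylor_sub hQ1 (t 0 : ℝ)
    refine ⟨taylor (t 0 : ℝ) Q - Q, natDegree_taylor_sub_le hQ1 _, ?_, ?_, fun n => ?_⟩
    · have h1 : i + 1 + (j + 1) = i + 1 + 1 + j := by ring
      rw [hc, hQ2, h1, Nat.descFactorial_succ, Fin.prod_univ_succ]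
      have h2 : i + 1 + 1 + j - j = i + 1 + 1 := by omega
      rw [h2]
      simp only [Fin.tail]
      push_cast
      ring
    · rw [hc, coeff_taylor_sub_two hQ1, Fin.sum_univ_succ]
      simp only [Fin.tail] at hQ3
      push_cast at hQ3 ⊢
      linear_combination (i + 1) * (t 0 : ℝ) * hQ3
    · have h1 : i + 1 + (j + 1) = i + 1 + 1 + j := by ring
      rw [da, h1, hQ4, hQ4, eval_sub, taylor_eval]
      push_cast
      ring

/-- Differencing `x ^ (j + 1)` exactly `j` times. -/
lemma da_pow {j : ℕ} (hj : 1 ≤ j) (t : Fin j → ℤ) (n : ℤ) :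
    da j t (fun m => (m : ℝ) ^ (j + 1)) n
      = (((j + 1).factorial / 2 : ℕ) * (∏ l, t l) * (2 * n + ∑ l, t l) : ℤ) := by
  obtain ⟨Q, hQ1, hQ2, hQ3, hQ4⟩ := da_pow_aux 0 j t
  have h1 : 0 + 1 + j = j + 1 := by ring
  rw [h1] at hQ2 hQ4
  have h2 : (j + 1).descFactorial j = (j + 1).factorial := by
    have := Nat.factorial_mul_descFactorial (n := j + 1) (k := j) (by omega)
    simpa using this
  rw [h2] at hQ2
  rw [hQ4, eval_eq_sum_range' (n := 2) (by omega), Finset.sum_range_succ, Finset.sum_range_one]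
  -- Since (j+1)! is even, the value is an integer divisible by every shift and by 2n + ∑ t. These
  -- factors recover the shifts and n, which is what the later divisor count needs.
  obtain ⟨F, hF⟩ : 2 ∣ (j + 1).factorial := Nat.dvd_factorial (by norm_num) (by omega)
  rw [hF] at hQ2 ⊢
  rw [Nat.mul_div_cancel_left F (by norm_num)]
  simp only [zero_add, pow_zero, pow_one] at hQ2 hQ3 ⊢
  rw [hQ2] at hQ3 ⊢
  push_cast at hQ3 ⊢
  linarith

/-! ### Weyl's inequality, single and averaged over families. -/

/-- Weyl's inequality for polynomial phases on an interval. -/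
theorem weyl_polynomial {j : ℕ} (P : ℝ[X]) (hP : P.natDegree ≤ j + 1) (a b : ℤ) (M : ℕ)
    (hab : b - a ≤ M) :
    ‖∑ n ∈ Finset.Ico a b, e (P.eval (n : ℝ))‖ ^ 2 ^ j
      ≤ (2 * M : ℝ) ^ (2 ^ j - j - 1) *
        ∑ s ∈ box j M, gk M ((j + 1).factorial * (∏ l, (s l : ℝ)) * P.coeff (j + 1)) := by
  have h1 : ∑ n ∈ Finset.Ico a b, e (P.eval (n : ℝ))
      = ∑ n ∈ Finset.Ico a (a + M), ind a b n * e (P.eval (n : ℝ)) := by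
    simp only [ind, ite_mul, one_mul, zero_mul]
    rw [← Finset.sum_filter]
    refine Finset.sum_congr ?_ fun _ _ => rfl
    ext n
    simp only [Finset.mem_filter, Finset.mem_Ico]
    omega
  rw [h1]
  refine (weyl_differencing_norm M a _ ?_ j).trans ?_
  · intro n hn
    have : n ∉ Finset.Ico a b := by
      simp only [Finset.mem_Ico] at hn ⊢
      omega
    simp [ind, this]
  · gcongr
    refine (norm_sum_le _ _).trans (Finset.sum_le_sum fun s _ => ?_)
    obtain ⟨a', b', ha, hb, hind⟩ := dd_ind j s a b
    -- After j differencings of a polynomial of degree j + 1 the phase is linear, so the inner sum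
    -- is geometric.
    obtain ⟨Q, hQ1, hQ2, hQ3⟩ := da_eval P 1 j (by omega) s
    have h2 : ∀ n : ℤ, dd j s (fun n => ind a b n * e (P.eval (n : ℝ))) n
        = ind a' b' n * e (Q.coeff 1 * n + Q.coeff 0) := by
      intro n
      rw [dd_mul, dd_e, hQ3]
      have h3 : dd j s (fun m => ind a b m) n = ind a' b' n := hind n
      rw [h3, eval_eq_sum_range' (n := 2) (by omega), Finset.sum_range_succ,
        Finset.sum_range_one]
      congr 2
      ring
    have h4 : ∑ n ∈ Finset.Ico a (a + M), ind a' b' n * e (Q.coeff 1 * n + Q.coeff 0)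
        = ∑ n ∈ Finset.Ico a' b', e (Q.coeff 1 * n + Q.coeff 0) := by
      simp only [ind, ite_mul, one_mul, zero_mul]
      rw [← Finset.sum_filter]
      refine Finset.sum_congr ?_ fun _ _ => rfl
      ext n
      simp only [Finset.mem_filter, Finset.mem_Ico]
      omega
    simp only [h2]
    rw [h4]
    refine (norm_sum_e_le _ _ _ _ M (by omega)).trans (le_of_eq ?_)
    rw [hQ2]
    have h5 : (1 + j).descFactorial j = (j + 1).factorial := by
      have := Nat.factorial_mul_descFactorial (n := 1 + j) (k := j) (by omega)
      have h6 : 1 + j - j = 1 := by omega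
      rw [h6] at this
      simpa [add_comm] using this
    rw [h5, add_comm 1 j]

lemma pow_sum_le_card_pow_mul {τ : Type*} (s : Finset τ) (f : τ → ℝ) (hf : ∀ t ∈ s, 0 ≤ f t)
    {n : ℕ} (hn : 1 ≤ n) {S : ℝ} (hS : (s.card : ℝ) ≤ S) :
    (∑ t ∈ s, f t) ^ n ≤ S ^ (n - 1) * ∑ t ∈ s, f t ^ n := by
  obtain ⟨m, rfl⟩ : ∃ m, n = m + 1 := ⟨n - 1, by omega⟩
  rw [Nat.add_sub_cancel]
  have h0 : 0 ≤ ∑ t ∈ s, f t ^ (m + 1) := Finset.sum_nonneg fun t ht => pow_nonneg (hf t ht) _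
  have h1 : (∑ t ∈ s, f t) ^ (m + 1) ≤ (s.card : ℝ) ^ m * ∑ t ∈ s, f t ^ (m + 1) :=
    pow_sum_le_card_mul_sum_pow hf m
  refine h1.trans ?_
  gcongr

/-- The integers dividing `v` up to sign. -/
noncomputable def intDivisors (v : ℕ) : Finset ℤ :=
  v.divisors.image (fun d : ℕ => (d : ℤ)) ∪ v.divisors.image (fun d : ℕ => -(d : ℤ))

lemma card_intDivisors_le (v : ℕ) : (intDivisors v).card ≤ 2 * v.divisors.card := by
  refine (Finset.card_union_le _ _).trans ?_
  have h1 := Finset.card_image_le (s := v.divisors) (f := fun d : ℕ => (d : ℤ))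
  have h2 := Finset.card_image_le (s := v.divisors) (f := fun d : ℕ => -(d : ℤ))
  omega

lemma mem_intDivisors {v : ℕ} (hv : v ≠ 0) {d : ℤ} (h : d ∣ (v : ℤ)) : d ∈ intDivisors v := by
  have h1 : d.natAbs ∈ v.divisors := by
    rw [Nat.mem_divisors]
    exact ⟨Int.natCast_dvd_natCast.mp (by simpa using h), hv⟩
  rw [intDivisors, Finset.mem_union, Finset.mem_image, Finset.mem_image]
  rcases Int.natAbs_eq d with h2 | h2
  · exact Or.inl ⟨d.natAbs, h1, h2.symm⟩
  · exact Or.inr ⟨d.natAbs, h1, h2.symm⟩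

/-- An element t is determined by the integers `κ t i`, all of which divide `val t`. Hence a given
absolute value v arises from at most (2τ(v))^|ι| elements, signs included. -/
lemma sum_le_divisor_count {τ ι : Type*} [Fintype ι] (T : Finset τ) (val : τ → ℤ)
    (κ : τ → ι → ℤ) (hinj : Set.InjOn κ T) (hne : ∀ t ∈ T, val t ≠ 0) {Y : ℕ}
    (hY : ∀ t ∈ T, (val t).natAbs ≤ Y) (hdvd : ∀ t ∈ T, ∀ i, κ t i ∣ val t) {R : ℕ}
    (hR : ∀ v ∈ Finset.Icc 1 Y, (2 * v.divisors.card) ^ Fintype.card ι ≤ R)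
    (F : ℕ → ℝ) (hF : ∀ v, 0 ≤ F v) :
    ∑ t ∈ T, F (val t).natAbs ≤ R * ∑ v ∈ Finset.Icc 1 Y, F v := by
  classical
  have hmaps : ∀ t ∈ T, (val t).natAbs ∈ Finset.Icc 1 Y := fun t ht =>
    Finset.mem_Icc.mpr ⟨Int.natAbs_pos.mpr (hne t ht), hY t ht⟩
  rw [← Finset.sum_fiberwise_of_maps_to hmaps, Finset.mul_sum]
  refine Finset.sum_le_sum fun v hv => ?_
  have h1 : ∑ t ∈ T with (val t).natAbs = v, F (val t).natAbs
      = (T.filter fun t => (val t).natAbs = v).card * F v := by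
    rw [← nsmul_eq_mul, ← Finset.sum_const]
    refine Finset.sum_congr rfl fun t ht => ?_
    rw [(Finset.mem_filter.mp ht).2]
  rw [h1]
  gcongr
  · exact hF v
  refine le_trans ?_ (hR v hv)
  have hv0 : v ≠ 0 := by
    have := (Finset.mem_Icc.mp hv).1
    omega
  calc (T.filter fun t => (val t).natAbs = v).card
      ≤ (Fintype.piFinset fun _ : ι => intDivisors v).card := by
        refine Finset.card_le_card_of_injOn κ ?_ ?_
        · intro t ht
          rw [Finset.mem_coe, Finset.mem_filter] at ht
          rw [Finset.mem_coe, Fintype.mem_piFinset]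
          intro i
          apply mem_intDivisors hv0
          rw [← ht.2]
          exact Int.dvd_natAbs.mpr (hdvd t ht.1 i)
        · exact hinj.mono fun t ht => (Finset.mem_filter.mp ht).1
    _ ≤ (2 * v.divisors.card) ^ Fintype.card ι := by
        rw [Fintype.card_piFinset, Finset.prod_const, Finset.card_univ]
        exact Nat.pow_le_pow_left (card_intDivisors_le v) _

lemma card_box_filter_le (j N : ℕ) (i : Fin j) :
    ((box j N).filter fun t => t i = 0).card ≤ (2 * N) ^ (j - 1) := by
  classical
  have h1 : ((box j N).filter fun t => t i = 0)
      ⊆ Fintype.piFinset fun l => if l = i then {0} else Finset.Ioo (-(N : ℤ)) N := by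
    intro t ht
    rw [Finset.mem_filter, mem_box] at ht
    rw [Fintype.mem_piFinset]
    intro l
    split_ifs with h
    · simp [h, ht.2]
    · rw [Finset.mem_Ioo, ← abs_lt]
      exact ht.1 l
  refine (Finset.card_le_card h1).trans ?_
  rw [Fintype.card_piFinset]
  calc ∏ l, (if l = i then ({0} : Finset ℤ) else Finset.Ioo (-(N : ℤ)) N).card
      ≤ ∏ l, (if l = i then 1 else 2 * N) := by
        refine Finset.prod_le_prod' fun l _ => ?_
        split_ifs
        · simp
        · exact card_Ioo_le N
    _ = (2 * N) ^ (j - 1) := by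
        rw [Finset.prod_ite, Finset.prod_const_one, one_mul, Finset.prod_const,
          Finset.filter_ne', Finset.card_erase_of_mem (Finset.mem_univ _), Finset.card_univ,
          Fintype.card_fin]

lemma card_box_degenerate_le (j N : ℕ) :
    ((box j N).filter fun t => ∃ i, t i = 0).card ≤ j * (2 * N) ^ (j - 1) := by
  classical
  have h1 : ((box j N).filter fun t => ∃ i, t i = 0)
      ⊆ Finset.univ.biUnion fun i => (box j N).filter fun t => t i = 0 := by
    intro t ht
    rw [Finset.mem_filter] at ht
    obtain ⟨h, i, hi⟩ := ht
    rw [Finset.mem_biUnion]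
    exact ⟨i, Finset.mem_univ _, Finset.mem_filter.mpr ⟨h, hi⟩⟩
  refine (Finset.card_le_card h1).trans (Finset.card_biUnion_le.trans ?_)
  refine (Finset.sum_le_sum fun i _ => card_box_filter_le j N i).trans ?_
  simp

/-- Weyl's inequality on average over a family of polynomials whose leading coefficients are
distinct-ish integer multiples of a number `θ` with a good rational approximation. -/
theorem sum_weyl_le {τ ι : Type*} [Fintype ι] {j : ℕ} {θ : ℝ} {α : ℤ} {q : ℕ} (hq : 1 ≤ q)
    (hco : IsCoprime α (q : ℤ)) (hθ : |θ - α / q| ≤ 1 / (q : ℝ) ^ 2)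
    (T : Finset τ) (P : τ → ℝ[X]) (hP : ∀ t ∈ T, (P t).natDegree ≤ j + 1)
    (c : τ → ℤ) (hc : ∀ t ∈ T, (P t).coeff (j + 1) = θ * c t) (hc0 : ∀ t ∈ T, c t ≠ 0)
    {C : ℕ} (hC : ∀ t ∈ T, (c t).natAbs ≤ C)
    (κ : τ → ι → ℤ) (hinj : Set.InjOn κ T) (hκ : ∀ t ∈ T, ∀ i, κ t i ∣ c t)
    (a b : τ → ℤ) {M : ℕ} (hab : ∀ t ∈ T, b t - a t ≤ M) {R Y : ℕ}
    (hY : (j + 1).factorial * M ^ j * C ≤ Y)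
    (hR : ∀ v ∈ Finset.Icc 1 Y, (2 * v.divisors.card) ^ (Fintype.card ι + j) ≤ R)
    {T₀ : ℝ} (hT₀ : (T.card : ℝ) ≤ T₀) :
    (∑ t ∈ T, ‖∑ n ∈ Finset.Ico (a t) (b t), e ((P t).eval (n : ℝ))‖) ^ 2 ^ j
      ≤ T₀ ^ (2 ^ j - 1) * ((2 * M : ℝ) ^ (2 ^ j - j - 1) *
        (T₀ * (j * (2 * M : ℝ) ^ j)
          + R * ((2 * Y / q + 1) * (4 * M + 8 * q * (1 + Real.log q))))) := by
  classical
  have hT₀' : 0 ≤ T₀ := (Nat.cast_nonneg _).trans hT₀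
  refine (pow_sum_le_card_pow_mul T _ (fun _ _ => norm_nonneg _) Nat.one_le_two_pow hT₀).trans ?_
  gcongr
  refine (Finset.sum_le_sum fun t ht => weyl_polynomial (P t) (hP t ht) _ _ M (hab t ht)).trans ?_
  rw [← Finset.mul_sum]
  gcongr
  -- Shift vectors with a vanishing coordinate are few and get the trivial bound 2M; for the others
  -- the frequency is θ times a nonzero integer.
  have hsplit : ∀ t ∈ T, ∑ s ∈ box j M,
      gk M ((j + 1).factorial * (∏ l, (s l : ℝ)) * (P t).coeff (j + 1))
      ≤ j * (2 * M : ℝ) ^ j + ∑ s ∈ (box j M).filter fun s => ∀ i, s i ≠ 0,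
        gk M (θ * (((j + 1).factorial * (∏ l, s l) * c t : ℤ).natAbs : ℕ)) := by
    intro t ht
    rw [← Finset.sum_filter_not_add_sum_filter (box j M) (fun s => ∀ i, s i ≠ 0)]
    refine add_le_add ?_ (Finset.sum_le_sum fun s _ => le_of_eq ?_)
    · have h1 : ((box j M).filter fun s => ¬ ∀ i, s i ≠ 0)
          = (box j M).filter fun t => ∃ i, t i = 0 := by
        simp
      rw [h1]
      refine (Finset.sum_le_card_nsmul _ _ (2 * M : ℝ) fun s _ => gk_le M _).trans ?_
      rw [nsmul_eq_mul]
      rcases Nat.eq_zero_or_pos j with rfl | hj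
      · simp
      · have h2 : ((((box j M).filter fun t => ∃ i, t i = 0).card : ℕ) : ℝ)
            ≤ j * (2 * M : ℝ) ^ (j - 1) := by exact_mod_cast card_box_degenerate_le j M
        calc _ ≤ (j * (2 * M : ℝ) ^ (j - 1)) * (2 * M) := by gcongr
          _ = j * (2 * M : ℝ) ^ j := by
            rw [mul_assoc, ← pow_succ, Nat.sub_add_cancel hj]
    · rw [hc t ht]
      set z : ℤ := (j + 1).factorial * (∏ l, s l) * c t with hz
      have h3 : (j + 1).factorial * (∏ l, (s l : ℝ)) * (θ * c t) = θ * z := by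
        rw [hz]
        push_cast
        ring
      have h4 : ((z.natAbs : ℕ) : ℝ) = |(z : ℝ)| := by
        rw [Nat.cast_natAbs, Int.cast_abs]
      rw [h3, h4]
      rcases abs_choice (z : ℝ) with h | h
      · rw [h]
      · rw [h, mul_neg, gk_neg]
  refine (Finset.sum_le_sum hsplit).trans ?_
  rw [Finset.sum_add_distrib, Finset.sum_const, nsmul_eq_mul]
  gcongr
  rw [← Finset.sum_product']
  -- The pair (t, s) is recovered from the divisors `κ t` of `c t` together with the shifts s, all
  -- dividing (j+1)! ∏ s · `c t`.
  refine (sum_le_divisor_count (ι := ι ⊕ Fin j) (R := R) (Y := Y) _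
    (fun p : τ × (Fin j → ℤ) => ((j + 1).factorial * (∏ l, p.2 l) * c p.1 : ℤ))
    (fun p => Sum.elim (κ p.1) p.2) ?_ ?_ ?_ ?_ ?_ (fun v => gk M (θ * v))
    (fun v => gk_nonneg _ _)).trans ?_
  · rintro ⟨t, s⟩ ht ⟨t', s'⟩ ht' h
    rw [Finset.mem_coe, Finset.mem_product] at ht ht'
    rw [Sum.elim_eq_iff] at h
    exact Prod.ext (hinj ht.1 ht'.1 h.1) h.2
  · rintro ⟨t, s⟩ ht
    rw [Finset.mem_product, Finset.mem_filter] at ht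
    refine mul_ne_zero (mul_ne_zero ?_ ?_) (hc0 t ht.1)
    · exact_mod_cast (Nat.factorial_pos _).ne'
    · exact Finset.prod_ne_zero_iff.mpr fun i _ => ht.2.2 i
  · rintro ⟨t, s⟩ ht
    rw [Finset.mem_product, Finset.mem_filter, mem_box] at ht
    refine le_trans ?_ hY
    rw [Int.natAbs_mul, Int.natAbs_mul, Int.natAbs_natCast]
    gcongr
    · have hprod : (∏ l, s l).natAbs = ∏ l, (s l).natAbs := map_prod Int.natAbsHom s _
      rw [hprod]
      refine (Finset.prod_le_prod' (g := fun _ => M) fun i _ => ?_).trans (by simp)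
      have := ht.2.1 i
      zify
      exact this.le
    · exact hC t ht.1
  · rintro ⟨t, s⟩ ht i
    rw [Finset.mem_product, Finset.mem_filter, mem_box] at ht
    rcases i with i | i
    · exact Dvd.dvd.mul_left (hκ t ht.1 i) _
    · exact Dvd.dvd.mul_right (Dvd.dvd.mul_left (Finset.dvd_prod_of_mem _ (Finset.mem_univ i)) _) _
  · simpa using hR
  · gcongr
    exact sum_gk_le hq hco hθ M Y

/-- Form of the averaged inequality as (trivial bound)^(2^j) times a saving. The parameter S
measures how far the range of the coefficients `c t` exceeds the size of the family: it will be M^j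
for linear sums and 1 for bilinear ones. -/
theorem sum_weyl_le_normalized {τ ι : Type*} [Fintype ι] {j : ℕ} (hj : 1 ≤ j) {θ : ℝ} {α : ℤ}
    {q : ℕ} (hq : 1 ≤ q)
    (hco : IsCoprime α (q : ℤ)) (hθ : |θ - α / q| ≤ 1 / (q : ℝ) ^ 2)
    (T : Finset τ) (P : τ → ℝ[X]) (hP : ∀ t ∈ T, (P t).natDegree ≤ j + 1)
    (c : τ → ℤ) (hc : ∀ t ∈ T, (P t).coeff (j + 1) = θ * c t) (hc0 : ∀ t ∈ T, c t ≠ 0)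
    {C : ℕ} (hC : ∀ t ∈ T, (c t).natAbs ≤ C)
    (κ : τ → ι → ℤ) (hinj : Set.InjOn κ T) (hκ : ∀ t ∈ T, ∀ i, κ t i ∣ c t)
    (a b : τ → ℤ) {M : ℕ} (hM : 1 ≤ M) (hab : ∀ t ∈ T, b t - a t ≤ M) {R Y : ℕ} (hR1 : 1 ≤ R)
    (hY : (j + 1).factorial * M ^ j * C ≤ Y)
    (hR : ∀ v ∈ Finset.Icc 1 Y, (2 * v.divisors.card) ^ (Fintype.card ι + j) ≤ R)
    {T₀ : ℝ} (hT₀1 : 1 ≤ T₀) (hT₀ : (T.card : ℝ) ≤ T₀) {S L : ℝ} (hS : 1 ≤ S)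
    (hL : 1 + Real.log q ≤ L) {y : ℕ} (hYS : (Y : ℝ) ≤ y * T₀ * M ^ j * S) :
    (∑ t ∈ T, ‖∑ n ∈ Finset.Ico (a t) (b t), e ((P t).eval (n : ℝ))‖) ^ 2 ^ j
      ≤ (2 ^ 2 ^ j * (j * 2 ^ j + 16 * y + 8) : ℕ) * R * L * (T₀ * M) ^ 2 ^ j *
        (S / q + S / M + q / (T₀ * M ^ (j + 1))) := by
  refine (sum_weyl_le hq hco hθ T P hP c hc hc0 hC κ hinj hκ a b hab hY hR hT₀).trans ?_
  have hq0 : (1 : ℝ) ≤ q := by exact_mod_cast hq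
  have hM0 : (1 : ℝ) ≤ M := by exact_mod_cast hM
  have hR0 : (1 : ℝ) ≤ R := by exact_mod_cast hR1
  have hlog : 0 ≤ Real.log q := Real.log_nonneg hq0
  have hL1 : 1 ≤ L := by linarith
  have hK : j + 1 ≤ 2 ^ j := Nat.lt_two_pow_self
  have hRL : 1 ≤ R * L := one_le_mul_of_one_le_of_one_le hR0 hL1
  set K := 2 ^ j with hKdef
  have hTM : (T₀ * M) ^ K = T₀ ^ (K - 1) * (M : ℝ) ^ (K - j - 1) * (T₀ * M ^ (j + 1)) := by
    have h1 : K = K - 1 + 1 := by omega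
    have h2 : K = (K - j - 1) + (j + 1) := by omega
    rw [mul_pow]
    conv_lhs => rw [h1, pow_succ T₀, ← h1]
    conv_lhs => rw [h2, pow_add (M : ℝ), ← h2]
    ring
  have hbr : T₀ * (j * (2 * M : ℝ) ^ j) + R * ((2 * Y / q + 1) * (4 * M + 8 * q * (1 + Real.log q)))
      ≤ (T₀ * M ^ (j + 1)) * (R * L * ((j * 2 ^ j + 16 * y + 8) *
        (S / q + S / M + q / (T₀ * M ^ (j + 1))))) := by
    have hMj : (M : ℝ) ≤ M ^ j := by
      calc (M : ℝ) = M ^ 1 := (pow_one _).symm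
        _ ≤ M ^ j := pow_le_pow_right₀ hM0 hj
    have e1 : T₀ * (j * (2 * M : ℝ) ^ j) ≤ R * L * (j * 2 ^ j * (T₀ * M ^ (j + 1) * (S / M))) := by
      have : T₀ * M ^ (j + 1) * (S / M) = T₀ * M ^ j * S := by
        rw [pow_succ]
        field_simp
      rw [this, mul_pow]
      calc T₀ * (j * (2 ^ j * (M : ℝ) ^ j)) = 1 * (j * 2 ^ j * (T₀ * M ^ j * 1)) := by ring
        _ ≤ R * L * (j * 2 ^ j * (T₀ * M ^ j * S)) := by gcongr
    have e2 : R * ((2 * Y / q + 1) * (4 * M + 8 * q * (1 + Real.log q)))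
        ≤ R * L * (8 * y * (T₀ * M ^ (j + 1) * (S / q)) + 16 * y * (T₀ * M ^ (j + 1) * (S / M))
          + 4 * (T₀ * M ^ (j + 1) * (S / M)) + 8 * q) := by
      have h1 : T₀ * M ^ (j + 1) * (S / M) = T₀ * M ^ j * S := by
        rw [pow_succ]
        field_simp
      have h2 : T₀ * M ^ (j + 1) * (S / q) = T₀ * M ^ j * S * (M / q) := by
        rw [pow_succ]
        field_simp
      rw [h1, h2, mul_assoc (R : ℝ)]
      refine mul_le_mul_of_nonneg_left ?_ (by positivity)
      set W := T₀ * M ^ j * S with hW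
      have hYW : (Y : ℝ) ≤ y * W := by rw [hW]; linarith
      have hMW : (M : ℝ) ≤ W := by
        rw [hW]
        calc (M : ℝ) = 1 * M * 1 := by ring
          _ ≤ T₀ * M ^ j * S := by gcongr
      have hW0 : 0 ≤ W := by positivity
      calc (2 * Y / q + 1) * (4 * M + 8 * q * (1 + Real.log q))
          ≤ (2 * Y / q + 1) * (4 * M * L + 8 * q * L) := by
            refine mul_le_mul_of_nonneg_left ?_ (by positivity)
            nlinarith
        _ = L * (8 * Y * (M / q) + 16 * Y + 4 * M + 8 * q) := by
            field_simp
            ring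
        _ ≤ L * (8 * (y * W) * (M / q) + 16 * (y * W) + 4 * W + 8 * q) := by gcongr
        _ = _ := by ring
    refine (add_le_add e1 e2).trans ?_
    rw [← mul_add, mul_left_comm _ (R * L : ℝ)]
    refine mul_le_mul_of_nonneg_left ?_ (by positivity)
    have h3 : T₀ * (M : ℝ) ^ (j + 1) * (q / (T₀ * M ^ (j + 1))) = q := by
      field_simp
    set Z := T₀ * (M : ℝ) ^ (j + 1) with hZ
    have hZ0 : 0 < Z := by positivity
    have p1 : 0 ≤ Z * (S / q) := by positivity
    have p2 : 0 ≤ Z * (S / M) := by positivity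
    have p4 : (0 : ℝ) ≤ j * 2 ^ j := by positivity
    have p5 : (0 : ℝ) ≤ y := by positivity
    have h4 : Z * ((j * 2 ^ j + 16 * y + 8) * (S / q + S / M + q / Z))
        = (j * 2 ^ j + 16 * y + 8) * (Z * (S / q) + Z * (S / M) + q) := by
      linear_combination (j * 2 ^ j + 16 * y + 8 : ℝ) * h3
    rw [h4]
    nlinarith [mul_nonneg p4 p1, mul_nonneg p4 p2, mul_nonneg p5 p1, mul_nonneg p5 p2,
      mul_nonneg p4 (by linarith : (0 : ℝ) ≤ q), mul_nonneg p5 (by linarith : (0 : ℝ) ≤ q)]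
  have h2M : (2 * M : ℝ) ^ (K - j - 1) ≤ 2 ^ K * (M : ℝ) ^ (K - j - 1) := by
    rw [mul_pow]
    gcongr
    · norm_num
    · omega
  calc T₀ ^ (K - 1) * ((2 * M : ℝ) ^ (K - j - 1) * (T₀ * (j * (2 * M : ℝ) ^ j)
          + R * ((2 * Y / q + 1) * (4 * M + 8 * q * (1 + Real.log q)))))
      ≤ T₀ ^ (K - 1) * (2 ^ K * (M : ℝ) ^ (K - j - 1) * ((T₀ * M ^ (j + 1)) *
        (R * L * ((j * 2 ^ j + 16 * y + 8) *
        (S / q + S / M + q / (T₀ * M ^ (j + 1))))))) := by gcongr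
    _ = _ := by
      have hKc : (K : ℝ) = 2 ^ j := by
        rw [hKdef]
        push_cast
        rfl
      rw [hTM]
      push_cast
      rw [hKc]
      ring

/-! ### Admissible parameters and linear sums over dyadic blocks. -/

/-- The largest integer at which the divisor function has to be bounded. -/
def divisorRange (j x : ℕ) : ℕ := (j + 1).factorial ^ 2 * (j + 2) * 2 ^ (j + 2) * x ^ (j + 2)

/-- The data for the estimate of `∑ Λ(n) e(h f(n))`, `n ≤ x`, averaged over `h ≤ H`; the
saving is `δ`. -/
structure IsAdmissible (j : ℕ) (f : ℝ[X]) (α : ℤ) (q x H R : ℕ) (δ L : ℝ) : Prop where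
  one_le_j : 1 ≤ j
  natDegree_le : f.natDegree ≤ j + 1
  one_le_q : 1 ≤ q
  coprime : IsCoprime α (q : ℤ)
  approx : |f.coeff (j + 1) - α / q| ≤ 1 / (q : ℝ) ^ 2
  one_le_x : 1 ≤ x
  one_le_H : 1 ≤ H
  H_le_x : H ≤ x
  δ_pos : 0 < δ
  δ_le_one : δ ≤ 1
  -- These three conditions say that δ^(4^j) is at least 1/q, x^(-1/2) and q/x^(j+1). The exponent
  -- is 4^j because bilinear sums are differenced in both variables.
  one_le_q_mul : 1 ≤ q * δ ^ (2 ^ j * 2 ^ j)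
  one_le_x_mul : 1 ≤ x * (δ ^ (2 ^ j * 2 ^ j)) ^ 2
  q_le : q ≤ (x : ℝ) ^ (j + 1) * δ ^ (2 ^ j * 2 ^ j)
  log_x_le : 1 + Real.log x ≤ L
  log_q_le : 1 + Real.log q ≤ L
  one_le_R : 1 ≤ R
  -- The exponent counts the divisors recorded in the bilinear case: h, 2n + ∑ t, j shifts from the
  -- first differencing and j from the second.
  divisors_le : ∀ v ∈ Finset.Icc 1 (divisorRange j x), (2 * v.divisors.card) ^ (2 * j + 2) ≤ R

namespace IsAdmissible

variable {j : ℕ} {f : ℝ[X]} {α : ℤ} {q x H R : ℕ} {δ L : ℝ}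

lemma one_le_L (h : IsAdmissible j f α q x H R δ L) : 1 ≤ L := by
  have := Real.log_nonneg (by exact_mod_cast h.one_le_x : (1 : ℝ) ≤ x)
  linarith [h.log_x_le]

end IsAdmissible

/-- The polynomial `h f(d X)`. -/
noncomputable def dilate (f : ℝ[X]) (h d : ℝ) : ℝ[X] := C h * f.comp (C d * X)

lemma eval_dilate (f : ℝ[X]) (h d y : ℝ) : (dilate f h d).eval y = h * f.eval (d * y) := by
  simp [dilate]

lemma natDegree_dilate_le (f : ℝ[X]) (h d : ℝ) : (dilate f h d).natDegree ≤ f.natDegree := by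
  refine (natDegree_C_mul_le _ _).trans (natDegree_comp_le.trans ?_)
  calc f.natDegree * (C d * X : ℝ[X]).natDegree ≤ f.natDegree * 1 := by
        gcongr
        exact (natDegree_C_mul_le _ _).trans natDegree_X_le
    _ = f.natDegree := mul_one _

lemma coeff_dilate (f : ℝ[X]) (h d : ℝ) (i : ℕ) :
    (dilate f h d).coeff i = h * (f.coeff i * d ^ i) := by
  rw [dilate, coeff_C_mul, comp_C_mul_X_coeff]

/-- Linear (Type I) sums over a dyadic block. -/
theorem typeI_block {j : ℕ} {f : ℝ[X]} {α : ℤ} {q x H R : ℕ} {δ L : ℝ}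
    (hA : IsAdmissible j f α q x H R δ L) {M : ℕ} (hM : 1 ≤ M) (hMδ : M * δ ^ 2 ^ j ≤ 1)
    {y : ℤ} (hy : 1 ≤ y) :
    ∑ h ∈ Finset.Icc 1 H, ∑ d ∈ Finset.Ico M (2 * M),
      ‖∑ n ∈ Finset.Ico y ((x / d : ℕ) + 1), e (h * f.eval ((d : ℝ) * n))‖
      ≤ (2 ^ 2 ^ j * (j * 2 ^ j + 16 * ((j + 1).factorial * 2 ^ (j + 1)) + 8) * 2 ^ (j + 3) : ℕ)
        * R * L * (H * x * δ) := by
  obtain ⟨hj, hf, hq, hco, happ, hx, hH, hHx, hδ, hδ1, hqδ, hxδ, hqle, hLx, hLq, hR1, hR⟩ := hA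
  set K := 2 ^ j with hKdef
  have hKc : (K : ℝ) = 2 ^ j := by
    rw [hKdef]
    push_cast
    rfl
  have hK : j + 1 ≤ K := Nat.lt_two_pow_self
  have hx0 : (1 : ℝ) ≤ x := by exact_mod_cast hx
  have hM0 : (1 : ℝ) ≤ M := by exact_mod_cast hM
  have hH0 : (1 : ℝ) ≤ H := by exact_mod_cast hH
  have hq0 : (1 : ℝ) ≤ q := by exact_mod_cast hq
  have hL1 : 1 ≤ L := by linarith [Real.log_nonneg hx0]
  have hR0 : (1 : ℝ) ≤ R := by exact_mod_cast hR1
  rw [pow_mul] at hqδ hxδ hqle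
  set D := δ ^ K with hD
  have hD0 : 0 < D := by positivity
  have hD1 : D ≤ 1 := pow_le_one₀ hδ.le hδ1
  have hDK0 : 0 < D ^ K := by positivity
  have hDK1 : D ^ K ≤ 1 := pow_le_one₀ hD0.le hD1
  have hDKj : D ^ K ≤ D ^ (j + 1) := pow_le_pow_of_le_one hD0.le hD1 hK
  have hDKD : D ^ K ≤ D := by
    calc D ^ K ≤ D ^ 1 := pow_le_pow_of_le_one hD0.le hD1 (by omega)
      _ = D := pow_one D
  have hMx : M ≤ x := by
    have h1 : (M : ℝ) ≤ x := by
      calc (M : ℝ) = M * 1 := (mul_one _).symm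
        _ ≤ M * (x * (D ^ K) ^ 2) := by gcongr
        _ = x * (M * D ^ K) * D ^ K := by ring
        _ ≤ x * (M * D) * 1 := by gcongr
        _ ≤ x * 1 * 1 := by gcongr
        _ = x := by ring
    exact_mod_cast h1
  set N := x / M with hN
  have hN1 : 1 ≤ N := Nat.div_pos hMx hM
  have hNM : N * M ≤ x := Nat.div_mul_le_self x M
  have hxN : (x : ℝ) ≤ 2 * M * N := by
    have h1 : x < N * M + M := Nat.lt_div_mul_add hM
    have h2 : x ≤ 2 * M * N := by nlinarith
    exact_mod_cast h2
  set B : ℕ := 2 ^ 2 ^ j * (j * 2 ^ j + 16 * ((j + 1).factorial * 2 ^ (j + 1)) + 8) with hB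
  -- The family is indexed by (h, d): the phase h f(dn) has leading coefficient θ h d^(j+1) in n,
  -- and the two divisors h and d identify the member.
  have key := sum_weyl_le_normalized (ι := Bool) hj hq hco happ
    (Finset.Icc 1 H ×ˢ Finset.Ico M (2 * M)) (fun p => dilate f p.1 p.2)
    (fun p _ => (natDegree_dilate_le _ _ _).trans hf)
    (fun p => ((p.1 * p.2 ^ (j + 1) : ℕ) : ℤ)) (fun p _ => by
      rw [coeff_dilate]
      push_cast
      ring) (fun p hp => by
      rw [Finset.mem_product, Finset.mem_Icc, Finset.mem_Ico] at hp
      have h1 : 0 < p.1 := by omega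
      have h2 : 0 < p.2 := by omega
      positivity) (C := H * (2 * M) ^ (j + 1)) (fun p hp => by
      rw [Finset.mem_product, Finset.mem_Icc, Finset.mem_Ico] at hp
      rw [Int.natAbs_natCast]
      gcongr
      · exact hp.1.2
      · exact hp.2.2.le)
    (fun p i => if i then (p.1 : ℤ) else p.2) (by
      rintro ⟨h, d⟩ _ ⟨h', d'⟩ _ heq
      have h1 := congrFun heq true
      have h2 := congrFun heq false
      simp only [if_true, Bool.false_eq_true, if_false, Nat.cast_inj] at h1 h2
      rw [h1, h2]) (fun p _ i => by
      cases i
      · simp only [Bool.false_eq_true, if_false]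
        exact_mod_cast Dvd.dvd.mul_left (dvd_pow_self _ (by omega)) _
      · simp only [if_true]
        exact_mod_cast Dvd.intro _ rfl)
    (fun _ => y) (fun p => ((x / p.2 : ℕ) : ℤ) + 1) (M := N) hN1 (fun p hp => by
      rw [Finset.mem_product, Finset.mem_Icc, Finset.mem_Ico] at hp
      have h1 : x / p.2 ≤ N := Nat.div_le_div_left hp.2.1 hM
      omega) (R := R) (Y := (j + 1).factorial * N ^ j * (H * (2 * M) ^ (j + 1))) hR1 le_rfl
    (fun v hv => by
      refine le_trans ?_ (hR v ?_)
      · have h1 : 1 ≤ v.divisors.card := by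
          rw [Finset.mem_Icc] at hv
          exact Finset.card_pos.mpr ⟨1, Nat.one_mem_divisors.mpr (by omega)⟩
        refine Nat.pow_le_pow_right (by omega) ?_
        simp only [Fintype.card_bool]
        omega
      · rw [Finset.mem_Icc] at hv ⊢
        refine ⟨hv.1, hv.2.trans ?_⟩
        calc (j + 1).factorial * N ^ j * (H * (2 * M) ^ (j + 1))
            = (j + 1).factorial * 1 * 1 * 2 ^ (j + 1) * ((N * M) ^ j * H * M) := by ring
          _ ≤ (j + 1).factorial * (j + 1).factorial * (j + 2) * 2 ^ (j + 2) * (x ^ j * x * x) := by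
            gcongr
            · exact Nat.factorial_pos _
            · omega
            · norm_num
            · omega
          _ = divisorRange j x := by
            rw [divisorRange]
            ring)
    (T₀ := H * M) (one_le_mul_of_one_le_of_one_le hH0 hM0) (by
      rw [Finset.card_product, Nat.card_Icc, Nat.card_Ico]
      have : 2 * M - M = M := by omega
      simp [this]) (S := M ^ j) (L := L) (one_le_pow₀ hM0) hLq
    (y := (j + 1).factorial * 2 ^ (j + 1)) (by
      push_cast
      refine le_of_eq ?_
      ring)
  rw [← hB, ← hKdef] at key
  rw [Finset.sum_product] at key
  simp only [eval_dilate] at key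
  set W := ∑ h ∈ Finset.Icc 1 H, ∑ d ∈ Finset.Ico M (2 * M),
      ‖∑ n ∈ Finset.Ico y ((x / d : ℕ) + 1), e (h * f.eval ((d : ℝ) * n))‖ with hW
  have hW0 : 0 ≤ W := Finset.sum_nonneg fun _ _ => Finset.sum_nonneg fun _ _ => norm_nonneg _
  -- Here D = δ^(2^j) and D^K = δ^(4^j). From MD ≤ 1 and K ≥ j + 1 follows M^j D^K ≤ D, so each term
  -- is O(D), and the K-th root of D is the saving δ.
  have hbr : (M : ℝ) ^ j / q + (M : ℝ) ^ j / N + q / (H * M * (N : ℝ) ^ (j + 1))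
      ≤ 2 ^ (j + 3) * D := by
    have hN0 : (1 : ℝ) ≤ N := by exact_mod_cast hN1
    have hMDj : ((M : ℝ) * D) ^ j ≤ 1 := pow_le_one₀ (by positivity) hMδ
    have hMDK : (M : ℝ) ^ j * D ^ K ≤ D := by
      calc (M : ℝ) ^ j * D ^ K ≤ M ^ j * D ^ (j + 1) := by gcongr
        _ = (M * D) ^ j * D := by ring
        _ ≤ 1 * D := by gcongr
        _ = D := one_mul D
    have t1 : (M : ℝ) ^ j / q ≤ D := by
      rw [div_le_iff₀ (by linarith)]
      calc (M : ℝ) ^ j = M ^ j * 1 := (mul_one _).symm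
        _ ≤ M ^ j * (q * D ^ K) := by gcongr
        _ = (M ^ j * D ^ K) * q := by ring
        _ ≤ D * q := by gcongr
    have t2 : (M : ℝ) ^ j / N ≤ 2 * D := by
      rw [div_le_iff₀ (by linarith)]
      calc (M : ℝ) ^ j = M ^ j * 1 := (mul_one _).symm
        _ ≤ M ^ j * (x * (D ^ K) ^ 2) := by gcongr
        _ ≤ M ^ j * (2 * M * N * (D ^ K) ^ 2) := by gcongr
        _ = 2 * (M ^ j * D ^ K) * (M * D ^ K) * N := by ring
        _ ≤ 2 * D * (M * D) * N := by gcongr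
        _ ≤ 2 * D * 1 * N := by gcongr
        _ = 2 * D * N := by ring
    have t3 : q / (H * M * (N : ℝ) ^ (j + 1)) ≤ 2 ^ (j + 1) * D := by
      rw [div_le_iff₀ (by positivity)]
      calc (q : ℝ) ≤ x ^ (j + 1) * D ^ K := hqle
        _ ≤ (2 * M * N) ^ (j + 1) * D ^ K := by gcongr
        _ = 2 ^ (j + 1) * (M ^ j * D ^ K) * (1 * M * N ^ (j + 1)) := by ring
        _ ≤ 2 ^ (j + 1) * D * (H * M * N ^ (j + 1)) := by gcongr
    have h2 : (2 : ℝ) ^ (j + 3) = 2 ^ (j + 1) * 4 := by ring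
    have h3 : (1 : ℝ) ≤ 2 ^ (j + 1) := one_le_pow₀ (by norm_num)
    rw [h2]
    nlinarith
  have hB1 : 1 ≤ B := by
    rw [hB]
    exact Nat.mul_pos (by positivity) (by omega)
  have hfin : W ^ K ≤ ((B * 2 ^ (j + 3) : ℕ) * R * L * (H * x * δ)) ^ K := by
    have hbase : 1 ≤ ((B * 2 ^ (j + 3) : ℕ) : ℝ) * R * L := by
      have h1 : (1 : ℝ) ≤ (B * 2 ^ (j + 3) : ℕ) := by
        exact_mod_cast Nat.mul_pos hB1 (by positivity)
      exact one_le_mul_of_one_le_of_one_le (one_le_mul_of_one_le_of_one_le h1 hR0) hL1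
    have hNMx : (M : ℝ) * N ≤ x := by
      rw [mul_comm]
      exact_mod_cast hNM
    calc W ^ K ≤ B * R * L * (H * M * N) ^ K * (2 ^ (j + 3) * D) := by
          refine key.trans ?_
          gcongr
      _ = ((B * 2 ^ (j + 3) : ℕ) * R * L) * ((H * (M * N)) ^ K * D) := by
          push_cast
          ring
      _ ≤ ((B * 2 ^ (j + 3) : ℕ) * R * L) * ((H * x) ^ K * D) := by gcongr
      _ = ((B * 2 ^ (j + 3) : ℕ) * R * L) * (H * x * δ) ^ K := by rw [hD, ← mul_pow]
      _ ≤ ((B * 2 ^ (j + 3) : ℕ) * R * L) ^ K * (H * x * δ) ^ K := by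
          gcongr
          exact le_self_pow₀ hbase (by omega)
      _ = _ := by rw [← mul_pow]
  exact le_of_pow_le_pow_left₀ (by omega) (by positivity) hfin

/-! ### Bilinear sums over dyadic blocks. -/

/-- The constant in the estimate for polynomial families occurring in bilinear sums. -/
def bilinearConst (j : ℕ) : ℕ :=
  2 ^ 2 ^ j * (j * 2 ^ j + 16 * ((j + 1).factorial ^ 2 * (j + 2)) + 8)

/-- The polynomial in `d` obtained by differencing `h f(d n)` in the variable `n`. -/
noncomputable def diffPoly (j : ℕ) (f : ℝ[X]) (h : ℝ) (t : Fin j → ℤ) (n : ℤ) : ℝ[X] :=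
  ∑ i ∈ Finset.range (j + 2), C (h * f.coeff i * da j t (fun m => (m : ℝ) ^ i) n) * X ^ i

lemma natDegree_diffPoly_le (j : ℕ) (f : ℝ[X]) (h : ℝ) (t : Fin j → ℤ) (n : ℤ) :
    (diffPoly j f h t n).natDegree ≤ j + 1 := by
  refine natDegree_sum_le_of_forall_le _ _ fun i hi => ?_
  rw [Finset.mem_range] at hi
  exact (natDegree_C_mul_X_pow_le _ _).trans (by omega)

lemma coeff_diffPoly {j : ℕ} (hj : 1 ≤ j) (f : ℝ[X]) (h : ℝ) (t : Fin j → ℤ) (n : ℤ) :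
    (diffPoly j f h t n).coeff (j + 1) = h * f.coeff (j + 1) *
      (((j + 1).factorial / 2 : ℕ) * (∏ l, t l) * (2 * n + ∑ l, t l) : ℤ) := by
  rw [← da_pow hj, diffPoly, finsetSum_coeff]
  simp only [coeff_C_mul, coeff_X_pow]
  rw [Finset.sum_eq_single (j + 1)]
  · simp
  · intro i _ hi
    rw [if_neg hi.symm, mul_zero]
  · intro hi
    simp at hi

/-- Differencing acts on n only; for fixed shifts and n the result is still a polynomial in d, so
that Weyl's inequality can be applied a second time, now in d. -/
lemma da_dilate_eq {j : ℕ} {f : ℝ[X]} (hf : f.natDegree ≤ j + 1) (h : ℝ) (t : Fin j → ℤ)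
    (d n : ℤ) :
    da j t (fun m => h * f.eval ((d : ℝ) * m)) n = (diffPoly j f h t n).eval (d : ℝ) := by
  have h1 : (fun m : ℤ => h * f.eval ((d : ℝ) * m))
      = fun m : ℤ => ∑ i ∈ Finset.range (j + 2), (h * f.coeff i * (d : ℝ) ^ i) * (m : ℝ) ^ i := by
    funext m
    rw [eval_eq_sum_range' (n := j + 2) (by omega), Finset.mul_sum]
    refine Finset.sum_congr rfl fun i _ => ?_
    ring
  rw [h1, da_sum j t _ _ (fun i m => (m : ℝ) ^ i), diffPoly, eval_finsetSum]
  refine Finset.sum_congr rfl fun i _ => ?_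
  simp only [eval_mul, eval_C, eval_pow, eval_X]
  ring

/-- The leading coefficient in d vanishes only if some shift is zero or n = -(∑ t)/2. The second
condition determines n from t, so either way one free parameter is lost. -/
lemma card_degenerate_le (j H N : ℕ) :
    ((Finset.Icc 1 H ×ˢ (box j N ×ˢ Finset.Ico (1 : ℤ) (N + 1))).filter fun p =>
      ¬ ((∀ i, p.2.1 i ≠ 0) ∧ 2 * p.2.2 + ∑ i, p.2.1 i ≠ 0)).card
      ≤ H * ((j + 1) * (2 * N) ^ j) := by
  classical
  have h1 : ((Finset.Icc 1 H ×ˢ (box j N ×ˢ Finset.Ico (1 : ℤ) (N + 1))).filter fun p =>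
      ¬ ((∀ i, p.2.1 i ≠ 0) ∧ 2 * p.2.2 + ∑ i, p.2.1 i ≠ 0))
      ⊆ Finset.Icc 1 H ×ˢ
        (((box j N).filter fun t => ∃ i, t i = 0) ×ˢ Finset.Ico (1 : ℤ) (N + 1)
        ∪ (box j N).image fun t => (t, (-∑ i, t i) / 2)) := by
    rintro ⟨h, t, n⟩ hp
    rw [Finset.mem_filter, Finset.mem_product, Finset.mem_product] at hp
    rw [Finset.mem_product, Finset.mem_union, Finset.mem_product, Finset.mem_filter,
      Finset.mem_image]
    refine ⟨hp.1.1, ?_⟩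
    by_cases h2 : ∃ i, t i = 0
    · exact Or.inl ⟨⟨hp.1.2.1, h2⟩, hp.1.2.2⟩
    · right
      have h3 : 2 * n + ∑ i, t i = 0 := by
        by_contra h4
        push Not at h2
        exact hp.2 ⟨h2, h4⟩
      refine ⟨t, hp.1.2.1, Prod.ext rfl ?_⟩
      simp only
      omega
  refine (Finset.card_le_card h1).trans ?_
  rw [Finset.card_product, Nat.card_Icc, Nat.add_sub_cancel]
  gcongr
  refine (Finset.card_union_le _ _).trans ?_
  have h2 := Finset.card_image_le (s := box j N) (f := fun t => (t, (-∑ i, t i) / 2))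
  have h3 := card_box_le j N
  have h4 := card_box_degenerate_le j N
  have h5 : (Finset.Ico (1 : ℤ) (N + 1)).card = N := by simp
  rw [Finset.card_product, h5]
  have h6 : j * (2 * N) ^ (j - 1) * N ≤ j * (2 * N) ^ j := by
    rcases Nat.eq_zero_or_pos j with rfl | hj
    · simp
    · calc j * (2 * N) ^ (j - 1) * N ≤ j * (2 * N) ^ (j - 1) * (2 * N) := by
            gcongr
            omega
        _ = j * (2 * N) ^ j := by rw [mul_assoc, ← pow_succ, Nat.sub_add_cancel hj]
  have h7 := Nat.mul_le_mul_right N h4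
  calc _ ≤ j * (2 * N) ^ j + (2 * N) ^ j := by omega
    _ = (j + 1) * (2 * N) ^ j := by ring

/-- The part of the bilinear estimate coming from nondegenerate shifts. -/
theorem typeII_nondegenerate {j : ℕ} {f : ℝ[X]} {α : ℤ} {q x H R : ℕ} {δ L : ℝ}
    (hA : IsAdmissible j f α q x H R δ L) {M N : ℕ} (hM : 1 ≤ M) (hN : 1 ≤ N) (hMN : M * N ≤ x)
    (u v : (Fin j → ℤ) → ℤ → ℤ) (huv : ∀ t n, v t n - u t n ≤ M) :
    (∑ p ∈ (Finset.Icc 1 H ×ˢ (box j N ×ˢ Finset.Ico (1 : ℤ) (N + 1))).filter fun p =>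
      ((∀ i, p.2.1 i ≠ 0) ∧ 2 * p.2.2 + ∑ i, p.2.1 i ≠ 0),
      ‖∑ d ∈ Finset.Ico (u p.2.1 p.2.2) (v p.2.1 p.2.2),
        e ((diffPoly j f p.1 p.2.1 p.2.2).eval (d : ℝ))‖) ^ 2 ^ j
      ≤ bilinearConst j * R * L * (H * (2 * N : ℝ) ^ (j + 1) * M) ^ 2 ^ j *
        (1 / q + 1 / M + q / (H * (2 * N : ℝ) ^ (j + 1) * M ^ (j + 1))) := by
  obtain ⟨hj, hf, hq, hco, happ, hx, hH, hHx, hδ, hδ1, hqδ, hxδ, hqle, hLx, hLq, hR1, hR⟩ := hA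
  have hH0 : (1 : ℝ) ≤ H := by exact_mod_cast hH
  have hN0 : (1 : ℝ) ≤ N := by exact_mod_cast hN
  have hNx : N ≤ x := by nlinarith
  unfold bilinearConst
  set T := (Finset.Icc 1 H ×ˢ (box j N ×ˢ Finset.Ico (1 : ℤ) (N + 1))).filter fun p =>
      ((∀ i, p.2.1 i ≠ 0) ∧ 2 * p.2.2 + ∑ i, p.2.1 i ≠ 0) with hT
  have hmem : ∀ p ∈ T, (1 ≤ p.1 ∧ p.1 ≤ H) ∧ (∀ i, |p.2.1 i| < N) ∧ (1 ≤ p.2.2 ∧ p.2.2 < N + 1) ∧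
      (∀ i, p.2.1 i ≠ 0) ∧ 2 * p.2.2 + ∑ i, p.2.1 i ≠ 0 := by
    intro p hp
    rw [hT, Finset.mem_filter, Finset.mem_product, Finset.mem_Icc, Finset.mem_product, mem_box,
      Finset.mem_Ico] at hp
    exact ⟨hp.1.1, hp.1.2.1, hp.1.2.2, hp.2⟩
  -- The family consists of the triples (h, t, n), identified by the divisors h, 2n + ∑ t and the
  -- individual shifts; once t is known, n follows from 2n + ∑ t.
  refine sum_weyl_le_normalized (τ := ℕ × (Fin j → ℤ) × ℤ) (ι := Bool ⊕ Fin j) hj hq hco happ T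
    (fun p => diffPoly j f p.1 p.2.1 p.2.2) (fun p _ => natDegree_diffPoly_le _ _ _ _ _)
    (fun p => ((p.1 : ℕ) : ℤ) *
      (((j + 1).factorial / 2 : ℕ) * (∏ l, p.2.1 l) * (2 * p.2.2 + ∑ l, p.2.1 l)))
    (fun p _ => ?_) (fun p hp => ?_)
    (C := H * ((j + 1).factorial * N ^ j * ((j + 2) * N))) (fun p hp => ?_)
    (fun p => Sum.elim (fun i => if i then ((p.1 : ℕ) : ℤ) else 2 * p.2.2 + ∑ l, p.2.1 l) p.2.1)
    ?_ (fun p _ i => ?_) (fun p => u p.2.1 p.2.2) (fun p => v p.2.1 p.2.2) hM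
    (fun p _ => huv _ _) (R := R)
    (Y := (j + 1).factorial * M ^ j * (H * ((j + 1).factorial * N ^ j * ((j + 2) * N))))
    hR1 le_rfl (fun w hw => ?_)
    (T₀ := H * (2 * N : ℝ) ^ (j + 1)) ?_ ?_ (S := 1) (L := L) le_rfl hLq
    (y := (j + 1).factorial ^ 2 * (j + 2)) ?_
  · rw [coeff_diffPoly hj]
    push_cast
    ring
  · obtain ⟨hh, -, -, ht, hn⟩ := hmem p hp
    have h1 : 2 ≤ (j + 1).factorial := by
      calc 2 = Nat.factorial 2 := rfl
        _ ≤ (j + 1).factorial := Nat.factorial_le (by omega)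
    refine mul_ne_zero ?_ (mul_ne_zero (mul_ne_zero ?_ ?_) hn)
    · have := hh.1
      exact_mod_cast (by omega : p.1 ≠ 0)
    · exact_mod_cast (by omega : (j + 1).factorial / 2 ≠ 0)
    · exact Finset.prod_ne_zero_iff.mpr fun i _ => ht i
  · obtain ⟨h1, h2, h3, -⟩ := hmem p hp
    rw [Int.natAbs_mul, Int.natAbs_mul, Int.natAbs_mul, Int.natAbs_natCast, Int.natAbs_natCast]
    have hprod : (∏ l, p.2.1 l).natAbs = ∏ l, (p.2.1 l).natAbs :=
      map_prod Int.natAbsHom p.2.1 _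
    gcongr
    · exact h1.2
    · exact Nat.div_le_self _ _
    · rw [hprod]
      refine (Finset.prod_le_prod' (g := fun _ => N) fun i _ => ?_).trans (by simp)
      have := h2 i
      zify
      exact this.le
    · zify
      have h4 : |∑ l, p.2.1 l| ≤ j * N := by
        refine (Finset.abs_sum_le_sum_abs _ _).trans ?_
        refine (Finset.sum_le_sum fun i _ => (h2 i).le).trans ?_
        simp
      have h5 : |2 * p.2.2| ≤ 2 * N := by
        rw [abs_of_pos (by omega)]
        omega
      calc |2 * p.2.2 + ∑ l, p.2.1 l| ≤ |2 * p.2.2| + |∑ l, p.2.1 l| := abs_add_le _ _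
        _ ≤ 2 * N + j * N := by gcongr
        _ = (j + 2) * N := by ring
  · rintro ⟨h, t, n⟩ _ ⟨h', t', n'⟩ _ heq
    rw [Sum.elim_eq_iff] at heq
    obtain ⟨h1, h2⟩ := heq
    have h3 := congrFun h1 true
    have h4 := congrFun h1 false
    simp only [if_true, Bool.false_eq_true, if_false, Nat.cast_inj] at h2 h3 h4
    rw [h2] at h4
    have h5 : n = n' := by omega
    rw [h2, h3, h5]
  · rcases i with i | i
    · cases i
      · exact Dvd.dvd.mul_left (Dvd.intro_left _ rfl) _
      · exact Dvd.intro _ rfl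
    · exact Dvd.dvd.mul_left (Dvd.dvd.mul_right (Dvd.dvd.mul_left
        (Finset.dvd_prod_of_mem _ (Finset.mem_univ i)) _) _) _
  · refine le_trans (le_of_eq ?_) (hR w ?_)
    · congr 1
      simp only [Fintype.card_sum, Fintype.card_bool, Fintype.card_fin]
      ring
    · rw [Finset.mem_Icc] at hw ⊢
      refine ⟨hw.1, hw.2.trans ?_⟩
      calc (j + 1).factorial * M ^ j * (H * ((j + 1).factorial * N ^ j * ((j + 2) * N)))
          = (j + 1).factorial ^ 2 * (j + 2) * 1 * ((M * N) ^ j * H * N) := by ring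
        _ ≤ (j + 1).factorial ^ 2 * (j + 2) * 2 ^ (j + 2) * (x ^ j * x * x) := by
          gcongr
          exact Nat.one_le_two_pow
        _ = divisorRange j x := by
          rw [divisorRange]
          ring
  · exact one_le_mul_of_one_le_of_one_le hH0 (one_le_pow₀ (by linarith))
  · have h1 := Finset.card_filter_le (Finset.Icc 1 H ×ˢ (box j N ×ˢ Finset.Ico (1 : ℤ) (N + 1)))
      (fun p => ((∀ i, p.2.1 i ≠ 0) ∧ 2 * p.2.2 + ∑ i, p.2.1 i ≠ 0))
    have h5 : (Finset.Ico (1 : ℤ) (N + 1)).card = N := by simp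
    rw [Finset.card_product, Finset.card_product, Nat.card_Icc, Nat.add_sub_cancel, h5] at h1
    have h2 : H * ((box j N).card * N) ≤ H * (2 * N) ^ (j + 1) := by
      rw [pow_succ]
      have := card_box_le j N
      gcongr
      omega
    exact_mod_cast h1.trans h2
  · push_cast
    have h1 : (N : ℝ) ^ (j + 1) ≤ (2 * N : ℝ) ^ (j + 1) := by
      gcongr
      linarith
    calc ((j + 1).factorial : ℝ) * M ^ j * (H * ((j + 1).factorial * N ^ j * ((j + 2) * N)))
        = (j + 1).factorial ^ 2 * (j + 2) * (H * (N : ℝ) ^ (j + 1)) * M ^ j * 1 := by ring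
      _ ≤ _ := by gcongr

/-- The numerical part of the bilinear estimate. -/
lemma bilinear_numerics {j : ℕ} {f : ℝ[X]} {α : ℤ} {q x H R : ℕ} {δ L : ℝ}
    (hA : IsAdmissible j f α q x H R δ L) {M N : ℕ} (hM : 1 ≤ M) (hN : 1 ≤ N) (hMN : M * N ≤ x)
    (hNM : N ≤ 2 * M) {B E : ℝ} (hB : 1 ≤ B)
    (hE : E ^ 2 ^ j ≤ B * R * L * (H * (2 * N : ℝ) ^ (j + 1) * M) ^ 2 ^ j *
        (1 / q + 1 / M + q / (H * (2 * N : ℝ) ^ (j + 1) * M ^ (j + 1)))) :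
    (M * N : ℝ) ^ 2 ^ j * (E / (H * (2 * N : ℝ) ^ (j + 1) * M))
      ≤ 4 * B * R * L * (x * δ) ^ 2 ^ j := by
  have hL1 := hA.one_le_L
  obtain ⟨hj, hf, hq, hco, happ, hx, hH, hHx, hδ, hδ1, hqδ, hxδ, hqle, hLx, hLq, hR1, hR⟩ := hA
  set K := 2 ^ j with hKdef
  have hK : j + 1 ≤ K := Nat.lt_two_pow_self
  have hKK : j + 1 ≤ K * K := hK.trans (Nat.le_mul_of_pos_left K (by omega))
  have hx0 : (1 : ℝ) ≤ x := by exact_mod_cast hx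
  have hM0 : (1 : ℝ) ≤ M := by exact_mod_cast hM
  have hN0 : (1 : ℝ) ≤ N := by exact_mod_cast hN
  have hH0 : (1 : ℝ) ≤ H := by exact_mod_cast hH
  have hq0 : (1 : ℝ) ≤ q := by exact_mod_cast hq
  have hR0 : (1 : ℝ) ≤ R := by exact_mod_cast hR1
  have hMNx : (M : ℝ) * N ≤ x := by exact_mod_cast hMN
  have hNM' : (N : ℝ) ≤ 2 * M := by exact_mod_cast hNM
  set G := δ ^ (K * K) with hG
  have hG0 : 0 < G := by positivity
  set P := (M : ℝ) * N with hP
  have hP0 : 0 < P := by positivity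
  set Z := H * (2 * N : ℝ) ^ (j + 1) with hZ
  have hZ0 : 0 < Z := by positivity
  have b1 : P ^ (K * K) * (1 / q) ≤ x ^ (K * K) * G := by
    gcongr
    rw [div_le_iff₀ (by linarith), mul_comm]
    exact hqδ
  -- N ≤ 2M gives MN ≤ 2M², so 1/M is at most a constant times (MN)^(-1/2). Squaring avoids the root
  -- and matches the squared form of the condition on x.
  have b2 : P ^ (K * K) * (1 / M) ≤ 2 * (x ^ (K * K) * G) := by
    refine le_of_pow_le_pow_left₀ two_ne_zero (by positivity) ?_
    have h1 : P ≤ 2 * M ^ 2 := by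
      rw [hP]
      nlinarith
    have h2 : K * K * 2 = (K * K * 2 - 1) + 1 := by omega
    calc (P ^ (K * K) * (1 / M)) ^ 2 = P ^ (K * K * 2) * (1 / M ^ 2) := by
          rw [mul_pow, ← pow_mul, div_pow, one_pow]
      _ = P ^ (K * K * 2 - 1) * (P / M ^ 2) := by
          conv_lhs => rw [h2, pow_succ]
          ring
      _ ≤ P ^ (K * K * 2 - 1) * 2 := by
          gcongr
          rw [div_le_iff₀ (by positivity)]
          exact h1
      _ ≤ x ^ (K * K * 2 - 1) * 2 := by gcongr
      _ = x ^ (K * K * 2 - 1) * 1 * 2 := by ring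
      _ ≤ x ^ (K * K * 2 - 1) * (x * G ^ 2) * 2 := by gcongr
      _ = x ^ (K * K * 2) * G ^ 2 * 2 := by
          conv_rhs => rw [h2, pow_succ]
          ring
      _ ≤ x ^ (K * K * 2) * G ^ 2 * 4 := by
          gcongr
          norm_num
      _ = (2 * (x ^ (K * K) * G)) ^ 2 := by
          rw [mul_pow, mul_pow, ← pow_mul]
          ring
  have b3 : P ^ (K * K) * (q / (Z * M ^ (j + 1))) ≤ x ^ (K * K) * G := by
    have h1 : P ^ (j + 1) ≤ Z * M ^ (j + 1) := by
      rw [hZ, hP, mul_pow, mul_comm]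
      gcongr
      calc (N : ℝ) ^ (j + 1) ≤ (2 * N : ℝ) ^ (j + 1) := by
            gcongr
            linarith
        _ = 1 * (2 * N : ℝ) ^ (j + 1) := (one_mul _).symm
        _ ≤ _ := by gcongr
    have h2 : K * K = (K * K - (j + 1)) + (j + 1) := by omega
    calc P ^ (K * K) * (q / (Z * M ^ (j + 1))) ≤ P ^ (K * K) * (q / P ^ (j + 1)) := by gcongr
      _ = P ^ (K * K - (j + 1)) * q := by
          conv_lhs => rw [h2, pow_add]
          field_simp
      _ ≤ x ^ (K * K - (j + 1)) * (x ^ (j + 1) * G) := by gcongr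
      _ = x ^ (K * K) * G := by
          conv_rhs => rw [h2, pow_add]
          ring
  have hBRL : 1 ≤ B * R * L :=
    one_le_mul_of_one_le_of_one_le (one_le_mul_of_one_le_of_one_le hB hR0) hL1
  refine le_of_pow_le_pow_left₀ (n := K) (by omega) (by positivity) ?_
  calc (P ^ K * (E / (Z * M))) ^ K = P ^ (K * K) * (E ^ K / (Z * M) ^ K) := by
        rw [mul_pow, ← pow_mul, div_pow]
    _ ≤ P ^ (K * K) * ((B * R * L * (Z * M) ^ K *
        (1 / q + 1 / M + q / (Z * M ^ (j + 1)))) / (Z * M) ^ K) := by gcongr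
    _ = B * R * L * (P ^ (K * K) * (1 / q) + P ^ (K * K) * (1 / M)
        + P ^ (K * K) * (q / (Z * M ^ (j + 1)))) := by
        have : (Z * M) ^ K ≠ 0 := by positivity
        rw [mul_right_comm, mul_div_assoc, div_self this]
        ring
    _ ≤ B * R * L * (x ^ (K * K) * G + 2 * (x ^ (K * K) * G) + x ^ (K * K) * G) := by gcongr
    _ = (4 * B * R * L) * ((x * δ) ^ K) ^ K := by
        rw [← pow_mul, mul_pow, hG]
        ring
    _ ≤ (4 * B * R * L) ^ K * ((x * δ) ^ K) ^ K := by
        gcongr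
        refine le_self_pow₀ ?_ (by omega)
        nlinarith
    _ = _ := by rw [← mul_pow]

/-- Bilinear (Type II) sums over a dyadic block. -/
theorem typeII_block {j : ℕ} {f : ℝ[X]} {α : ℤ} {q x H R : ℕ} {δ L : ℝ}
    (hA : IsAdmissible j f α q x H R δ L) {M N : ℕ} (hM : 1 ≤ M) (hN : 1 ≤ N) (hMN : M * N ≤ x)
    (hNM : N ≤ 2 * M) (hNδ : 1 ≤ N * δ ^ 2 ^ j) (a b : ℤ → ℂ) {A B : ℝ} (ha : ∀ d, ‖a d‖ ≤ A)
    (hb : ∀ n, ‖b n‖ ≤ B) (w : ℤ → ℤ → ℂ) (u v : ℤ → ℤ) (hw : ∀ d n, w d n = ind (u n) (v n) d)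
    (hu : ∀ n, M ≤ u n) (hv : ∀ n, v n ≤ 2 * M) :
    ∑ h ∈ Finset.Icc 1 H, ‖∑ d ∈ Finset.Ico (M : ℤ) (2 * M), a d *
      ∑ n ∈ Finset.Ico (1 : ℤ) (1 + N), b n * w d n * e (h * f.eval ((d : ℝ) * n))‖
      ≤ (2 * (j + 1 + 4 * bilinearConst j) : ℕ) * R * L * A * B * (H * x * δ) := by
  have hA' := hA
  have hL1 := hA.one_le_L
  obtain ⟨hj, hf, hq, hco, happ, hx, hH, hHx, hδ, hδ1, hqδ, hxδ, hqle, hLx, hLq, hR1, hR⟩ := hA'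
  have hA0 : 0 ≤ A := (norm_nonneg _).trans (ha 0)
  have hB0 : 0 ≤ B := (norm_nonneg _).trans (hb 0)
  have hM0 : (1 : ℝ) ≤ M := by exact_mod_cast hM
  have hN0 : (1 : ℝ) ≤ N := by exact_mod_cast hN
  have hH0 : (1 : ℝ) ≤ H := by exact_mod_cast hH
  have hR0 : (1 : ℝ) ≤ R := by exact_mod_cast hR1
  have hK : j + 1 ≤ 2 ^ j := Nat.lt_two_pow_self
  -- The weight may couple d and n; after differencing in n it is, for fixed n, still the indicator
  -- of an interval in d.
  choose u' v' hu' hv' huv using fun (t : Fin j → ℤ) (n : ℤ) => dd_ind_section j t w u v hw n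
  let φ : ℕ → ℤ → ℤ → ℂ := fun h d n =>
    (ind 1 (1 + N) n * b n) * w d n * e (h * f.eval ((d : ℝ) * n))
  have hφ : ∀ (h : ℕ) (d n : ℤ), n ∉ Finset.Ico (1 : ℤ) (1 + N) → φ h d n = 0 := by
    intro h d n hn
    simp only [φ, ind, if_neg hn, zero_mul]
  have hinner : ∀ (h : ℕ) (d : ℤ),
      ∑ n ∈ Finset.Ico (1 : ℤ) (1 + N), b n * w d n * e (h * f.eval ((d : ℝ) * n))
        = ∑ n ∈ Finset.Ico (1 : ℤ) (1 + N), φ h d n := by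
    intro h d
    refine Finset.sum_congr rfl fun n hn => ?_
    simp only [φ, ind, if_pos hn, one_mul]
  simp only [hinner]
  set J := Finset.Ico (1 : ℤ) (1 + N) with hJ
  set D := Finset.Ico (M : ℤ) (2 * M) with hD
  have hdd : ∀ (h : ℕ) (d : ℤ) (t : Fin j → ℤ) (n : ℤ), dd j t (φ h d) n
      = dd j t (fun n => ind 1 (1 + N) n * b n) n *
        (ind (u' t n) (v' t n) d * e ((diffPoly j f h t n).eval (d : ℝ))) := by
    intro h d t n
    simp only [φ]
    rw [dd_mul, dd_mul, dd_e, da_dilate_eq hf, mul_assoc]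
    congr 2
    exact huv t n d
  have hcoef : ∀ (t : Fin j → ℤ) (n : ℤ),
      ‖dd j t (fun n => ind 1 (1 + N) n * b n) n‖ ≤ B ^ 2 ^ j := by
    intro t n
    refine norm_dd_le j t _ B (fun n => ?_) n
    rw [norm_mul, ind]
    split_ifs
    · simpa using hb n
    · simpa using hB0
  have hsumd : ∀ (h : ℕ) (t : Fin j → ℤ) (n : ℤ), ‖∑ d ∈ D, dd j t (φ h d) n‖
      ≤ B ^ 2 ^ j * ‖∑ d ∈ Finset.Ico (u' t n) (v' t n),
        e ((diffPoly j f h t n).eval (d : ℝ))‖ := by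
    intro h t n
    simp only [hdd]
    rw [← Finset.mul_sum, norm_mul]
    have h1 : ∑ d ∈ D, ind (u' t n) (v' t n) d * e ((diffPoly j f h t n).eval (d : ℝ))
        = ∑ d ∈ Finset.Ico (u' t n) (v' t n), e ((diffPoly j f h t n).eval (d : ℝ)) := by
      simp only [ind, ite_mul, one_mul, zero_mul]
      rw [← Finset.sum_filter]
      refine Finset.sum_congr ?_ fun _ _ => rfl
      ext d
      have := hu' t n
      have := hv' t n
      have := hu n
      have := hv n
      simp only [hD, Finset.mem_filter, Finset.mem_Ico]
      omega
    rw [h1]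
    gcongr
    exact hcoef t n
  have hlen : ∀ t n, v' t n - u' t n ≤ M := by
    intro t n
    have := hu' t n
    have := hv' t n
    have := hu n
    have := hv n
    omega
  set Tall := Finset.Icc 1 H ×ˢ (box j N ×ˢ Finset.Ico (1 : ℤ) (N + 1)) with hTall
  let g : ℕ × (Fin j → ℤ) × ℤ → ℝ := fun p =>
    ‖∑ d ∈ Finset.Ico (u' p.2.1 p.2.2) (v' p.2.1 p.2.2),
        e ((diffPoly j f p.1 p.2.1 p.2.2).eval (d : ℝ))‖
  set E := ∑ p ∈ Tall.filter (fun p =>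
      ((∀ i, p.2.1 i ≠ 0) ∧ 2 * p.2.2 + ∑ i, p.2.1 i ≠ 0)), g p with hEdef
  have hE0 : 0 ≤ E := Finset.sum_nonneg fun _ _ => norm_nonneg _
  have hbc : (1 : ℝ) ≤ bilinearConst j := by
    have : 1 ≤ bilinearConst j := Nat.mul_pos (by positivity) (by omega)
    exact_mod_cast this
  have hE := bilinear_numerics hA hM hN hMN hNM hbc
    (typeII_nondegenerate hA hM hN hMN u' v' hlen)
  set K := 2 ^ j with hKdef
  -- Degenerate triples are bounded trivially by the length M of the d-interval; E collects the
  -- others.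
  have hall : ∑ p ∈ Tall, g p ≤ (H * ((j + 1) * (2 * N : ℝ) ^ j)) * M + E := by
    rw [← Finset.sum_filter_not_add_sum_filter Tall (fun p =>
      ((∀ i, p.2.1 i ≠ 0) ∧ 2 * p.2.2 + ∑ i, p.2.1 i ≠ 0))]
    refine add_le_add ?_ le_rfl
    refine (Finset.sum_le_card_nsmul _ _ (M : ℝ) fun p _ => ?_).trans ?_
    · refine (norm_sum_le _ _).trans ?_
      simp only [norm_e, Finset.sum_const, Int.card_Ico, nsmul_eq_mul, mul_one]
      have := hlen p.2.1 p.2.2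
      exact_mod_cast (by omega : (v' p.2.1 p.2.2 - u' p.2.1 p.2.2).toNat ≤ M)
    · rw [nsmul_eq_mul]
      gcongr
      exact_mod_cast card_degenerate_le j H N
  -- Weyl differencing in n for each (h, d), then d becomes the innermost variable. The coefficients
  -- b only contribute a factor at most B^K, while the phase in d is `diffPoly`.
  have hmain : ∑ h ∈ Finset.Icc 1 H, ∑ d ∈ D, ‖∑ n ∈ J, φ h d n‖ ^ K
      ≤ (2 * N : ℝ) ^ (K - j - 1) * (B ^ K * ((H * ((j + 1) * (2 * N : ℝ) ^ j)) * M + E)) := by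
    have h1 : ∀ (h : ℕ) (d : ℤ), ‖∑ n ∈ J, φ h d n‖ ^ K ≤ (2 * N : ℝ) ^ (K - j - 1) *
        (∑ t ∈ box j N, ∑ n ∈ J, dd j t (φ h d) n).re := fun h d =>
      weyl_differencing N 1 (φ h d) (hφ h d) hj
    refine (Finset.sum_le_sum fun h _ => Finset.sum_le_sum fun d _ => h1 h d).trans ?_
    simp only [← Finset.mul_sum]
    gcongr
    have h2 : ∑ h ∈ Finset.Icc 1 H, ∑ d ∈ D, (∑ t ∈ box j N, ∑ n ∈ J, dd j t (φ h d) n).re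
        = (∑ p ∈ Tall, ∑ d ∈ D, dd j p.2.1 (φ p.1 d) p.2.2).re := by
      rw [hTall, Finset.sum_product, Complex.re_sum]
      refine Finset.sum_congr rfl fun h _ => ?_
      rw [← Complex.re_sum, Finset.sum_product, Finset.sum_comm]
      congr 1
      refine Finset.sum_congr rfl fun t _ => ?_
      rw [Finset.sum_comm, hJ, add_comm]
    rw [h2]
    refine (Complex.re_le_norm _).trans ((norm_sum_le _ _).trans ?_)
    refine (Finset.sum_le_sum fun p _ => hsumd p.1 p.2.1 p.2.2).trans ?_
    rw [← Finset.mul_sum]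
    gcongr
  refine le_of_pow_le_pow_left₀ (n := K) (by omega) (by positivity) ?_
  have hstep : ∑ h ∈ Finset.Icc 1 H, ‖∑ d ∈ D, a d * ∑ n ∈ J, φ h d n‖
      ≤ A * ∑ p ∈ Finset.Icc 1 H ×ˢ D, ‖∑ n ∈ J, φ p.1 p.2 n‖ := by
    rw [Finset.sum_product, Finset.mul_sum]
    refine Finset.sum_le_sum fun h _ => (norm_sum_le _ _).trans ?_
    rw [Finset.mul_sum]
    refine Finset.sum_le_sum fun d _ => ?_
    rw [norm_mul]
    gcongr
    exact ha d
  have hcard : ((Finset.Icc 1 H ×ˢ D).card : ℝ) ≤ H * M := by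
    rw [Finset.card_product, Nat.card_Icc, hD, Int.card_Ico]
    have : (2 * (M : ℤ) - M).toNat = M := by omega
    rw [this]
    simp
  set Z := H * (2 * N : ℝ) ^ (j + 1) with hZ
  have hZ0 : 0 < Z := by positivity
  have hid : (H * M : ℝ) ^ (K - 1) * (2 * N : ℝ) ^ (K - j - 1) * (Z * M)
      = 2 ^ K * H ^ K * (M * N) ^ K := by
    have h1 : K = K - 1 + 1 := by omega
    have h2 : K = (K - j - 1) + (j + 1) := by omega
    have h3 : (2 : ℝ) ^ K * H ^ K * (M * N) ^ K = (H * M) ^ K * (2 * N : ℝ) ^ K := by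
      simp only [mul_pow]
      ring
    have h4 : (H * M : ℝ) ^ K = (H * M : ℝ) ^ (K - 1) * (H * M) := by
      conv_lhs => rw [h1, pow_succ]
    have h5 : (2 * N : ℝ) ^ K = (2 * N : ℝ) ^ (K - j - 1) * (2 * N : ℝ) ^ (j + 1) := by
      conv_lhs => rw [h2, pow_add]
    rw [h3, h4, h5, hZ]
    ring
  have hMNx : (M : ℝ) * N ≤ x := by exact_mod_cast hMN
  calc (∑ h ∈ Finset.Icc 1 H, ‖∑ d ∈ D, a d * ∑ n ∈ J, φ h d n‖) ^ K
      ≤ (A * ∑ p ∈ Finset.Icc 1 H ×ˢ D, ‖∑ n ∈ J, φ p.1 p.2 n‖) ^ K := by gcongr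
    _ ≤ A ^ K * ((H * M : ℝ) ^ (K - 1) * ∑ p ∈ Finset.Icc 1 H ×ˢ D,
          ‖∑ n ∈ J, φ p.1 p.2 n‖ ^ K) := by
        rw [mul_pow]
        gcongr
        exact pow_sum_le_card_pow_mul _ _ (fun _ _ => norm_nonneg _) (by omega) hcard
    _ ≤ A ^ K * ((H * M : ℝ) ^ (K - 1) * ((2 * N : ℝ) ^ (K - j - 1) *
          (B ^ K * ((H * ((j + 1) * (2 * N : ℝ) ^ j)) * M + E)))) := by
        rw [Finset.sum_product]
        gcongr
    _ = A ^ K * B ^ K * (((H * M : ℝ) ^ (K - 1) * (2 * N : ℝ) ^ (K - j - 1) * (Z * M)) *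
          ((j + 1) / (2 * N) + E / (Z * M))) := by
        have h1 : Z * M * ((j + 1) / (2 * N) + E / (Z * M))
            = (H * ((j + 1) * (2 * N : ℝ) ^ j)) * M + E := by
          rw [mul_add, mul_div_cancel₀ E (by positivity), hZ, pow_succ]
          field_simp
        rw [mul_assoc (_ * _) (Z * M), h1]
        ring
    _ = A ^ K * B ^ K * (2 ^ K * H ^ K) * ((M * N) ^ K * ((j + 1) / (2 * N))
          + (M * N) ^ K * (E / (Z * M))) := by
        rw [hid]
        ring
    _ ≤ A ^ K * B ^ K * (2 ^ K * H ^ K) * ((j + 1) * R * L * (x * δ) ^ K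
          + 4 * bilinearConst j * R * L * (x * δ) ^ K) := by
        refine mul_le_mul_of_nonneg_left (add_le_add ?_ hE) (by positivity)
        -- The degenerate triples lose a factor 1/N, which the assumption N δ^K ≥ 1 turns into δ^K.
        have h1 : ((j : ℝ) + 1) / (2 * N) ≤ (j + 1) * δ ^ K := by
          rw [div_le_iff₀ (by positivity)]
          nlinarith
        calc (M * N : ℝ) ^ K * ((j + 1) / (2 * N)) ≤ x ^ K * ((j + 1) * δ ^ K) := by gcongr
          _ = (j + 1) * 1 * 1 * (x * δ) ^ K := by
              rw [mul_pow]
              ring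
          _ ≤ _ := by gcongr
    _ = ((j + 1 + 4 * bilinearConst j) * R * L) * (2 * A * B * (H * x * δ)) ^ K := by
        simp only [mul_pow]
        ring
    _ ≤ ((j + 1 + 4 * bilinearConst j) * R * L) ^ K * (2 * A * B * (H * x * δ)) ^ K := by
        gcongr
        refine le_self_pow₀ ?_ (by omega)
        refine one_le_mul_of_one_le_of_one_le (one_le_mul_of_one_le_of_one_le ?_ hR0) hL1
        have : (0 : ℝ) ≤ j := by positivity
        linarith
    _ = _ := by
        rw [← mul_pow]
        push_cast
        ring

/-! ### Vaughan's identity and exponential sums over primes. -/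

open ArithmeticFunction in
lemma sum_conv_eq (a b : ArithmeticFunction ℝ) (F : ℕ → ℂ) (x : ℕ) :
    ∑ n ∈ Finset.Icc 1 x, (((a * b) n : ℝ) : ℂ) * F n
      = ∑ d ∈ Finset.Icc 1 x, ∑ n ∈ Finset.Icc 1 x,
        if d * n ≤ x then (a d : ℂ) * (b n : ℂ) * F (d * n) else 0 := by
  have h1 : ∀ n ∈ Finset.Icc 1 x, (((a * b) n : ℝ) : ℂ) * F n
      = ∑ p ∈ Finset.Icc 1 x ×ˢ Finset.Icc 1 x,
        if p.1 * p.2 = n then (a p.1 : ℂ) * (b p.2 : ℂ) * F (p.1 * p.2) else 0 := by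
    intro n hn
    rw [Finset.mem_Icc] at hn
    rw [mul_apply, ← Finset.sum_filter, Complex.ofReal_sum, Finset.sum_mul]
    refine Finset.sum_congr ?_ ?_
    · ext p
      rw [Nat.mem_divisorsAntidiagonal, Finset.mem_filter, Finset.mem_product, Finset.mem_Icc,
        Finset.mem_Icc]
      constructor
      · rintro ⟨rfl, h⟩
        have h1 := Nat.pos_of_ne_zero (left_ne_zero_of_mul h)
        have h2 := Nat.pos_of_ne_zero (right_ne_zero_of_mul h)
        have h3 := Nat.le_mul_of_pos_right p.1 h2
        have h4 := Nat.le_mul_of_pos_left p.2 h1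
        omega
      · rintro ⟨_, h⟩
        exact ⟨h, by omega⟩
    · intro p hp
      rw [Finset.mem_filter] at hp
      rw [hp.2]
      push_cast
      ring
  rw [Finset.sum_congr rfl h1, Finset.sum_comm, Finset.sum_product]
  refine Finset.sum_congr rfl fun d hd => Finset.sum_congr rfl fun n hn => ?_
  rw [Finset.mem_Icc] at hd hn
  rw [Finset.sum_ite_eq]
  have : 1 ≤ d * n := Nat.mul_pos hd.1 hn.1
  simp only [Finset.mem_Icc, this, true_and]

/-- The part of an arithmetic function supported on `n ≤ u`. -/
noncomputable def lowPart (u : ℕ) (a : ArithmeticFunction ℝ) : ArithmeticFunction ℝ :=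
  ⟨fun n => if n ≤ u then a n else 0, by simp⟩

/-- The part of an arithmetic function supported on `n > u`. -/
noncomputable def highPart (u : ℕ) (a : ArithmeticFunction ℝ) : ArithmeticFunction ℝ :=
  ⟨fun n => if u < n then a n else 0, by simp⟩

lemma lowPart_apply (u : ℕ) (a : ArithmeticFunction ℝ) (n : ℕ) :
    lowPart u a n = if n ≤ u then a n else 0 := rfl

lemma highPart_apply (u : ℕ) (a : ArithmeticFunction ℝ) (n : ℕ) :
    highPart u a n = if u < n then a n else 0 := rfl

lemma lowPart_add_highPart (u : ℕ) (a : ArithmeticFunction ℝ) :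
    lowPart u a + highPart u a = a := by
  ext n
  rw [ArithmeticFunction.add_apply, lowPart_apply, highPart_apply]
  split_ifs <;> first | omega | simp

open ArithmeticFunction in
/-- Vaughan's identity. -/
lemma vaughan_identity (u : ℕ) :
    (vonMangoldt : ArithmeticFunction ℝ) = lowPart u vonMangoldt
      + lowPart u (moebius : ArithmeticFunction ℝ) * log
      - (lowPart u (moebius : ArithmeticFunction ℝ) * lowPart u vonMangoldt) *
        (zeta : ArithmeticFunction ℝ)
      + highPart u (moebius : ArithmeticFunction ℝ) *
        (highPart u vonMangoldt * (zeta : ArithmeticFunction ℝ)) := by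
  set m₁ := lowPart u (moebius : ArithmeticFunction ℝ)
  set m₂ := highPart u (moebius : ArithmeticFunction ℝ)
  set v₁ := lowPart u vonMangoldt
  set v₂ := highPart u vonMangoldt
  set z := (zeta : ArithmeticFunction ℝ)
  have hm : m₁ + m₂ = (moebius : ArithmeticFunction ℝ) := lowPart_add_highPart _ _
  have hv : v₁ + v₂ = vonMangoldt := lowPart_add_highPart _ _
  have hmz : (m₁ + m₂) * z = 1 := by rw [hm]; exact coe_moebius_mul_coe_zeta
  have hvz : (v₁ + v₂) * z = log := by rw [hv]; exact vonMangoldt_mul_zeta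
  -- Only the high part of Λ is multiplied by 1 = μ * ζ; adding and subtracting the low part turns
  -- m₁ * v₂ * ζ into m₁ * log minus a short convolution.
  calc vonMangoldt = v₁ + v₂ * ((m₁ + m₂) * z) := by rw [hmz, mul_one, hv]
    _ = v₁ + m₁ * ((v₁ + v₂) * z) - m₁ * v₁ * z + m₂ * (v₂ * z) := by ring
    _ = _ := by rw [hvz]

lemma sum_Ico_cast (g : ℤ → ℂ) (a b : ℕ) :
    ∑ z ∈ Finset.Ico (a : ℤ) b, g z = ∑ n ∈ Finset.Ico a b, g n := by
  refine (Finset.sum_nbij (fun n : ℕ => (n : ℤ)) ?_ (fun _ _ _ _ h => Nat.cast_injective h) ?_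
    fun _ _ => rfl).symm
  · intro n hn
    rw [Finset.mem_Ico] at hn ⊢
    omega
  · intro z hz
    rw [Finset.mem_coe, Finset.mem_Ico] at hz
    refine ⟨z.toNat, ?_, by simp only; omega⟩
    rw [Finset.mem_coe, Finset.mem_Ico]
    omega

lemma natLog_two_add_one_le {x : ℕ} (hx : 1 ≤ x) {L : ℝ} (hL : 1 + Real.log x ≤ L) :
    ((Nat.log 2 x + 1 : ℕ) : ℝ) ≤ 2 * L := by
  have h1 : ((Nat.log 2 x : ℕ) : ℝ) * Real.log 2 ≤ Real.log x := by
    rw [← Real.log_pow]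
    apply Real.log_le_log (by positivity)
    exact_mod_cast Nat.pow_log_le_self 2 (by omega)
  have h2 := Real.log_two_gt_d9
  have h3 : (0 : ℝ) ≤ Nat.log 2 x := Nat.cast_nonneg _
  push_cast
  nlinarith

/-- Splitting a sum into dyadic blocks. -/
lemma sum_dyadic {β : Type*} [AddCommMonoid β] (g : ℕ → β) (x : ℕ) :
    ∑ d ∈ Finset.Icc 1 x, g d = ∑ i ∈ Finset.range (Nat.log 2 x + 1),
      ∑ d ∈ Finset.Ico (2 ^ i) (2 * 2 ^ i), if d ≤ x then g d else 0 := by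
  have hmaps : ∀ d ∈ Finset.Icc 1 x, Nat.log 2 d ∈ Finset.range (Nat.log 2 x + 1) := by
    intro d hd
    rw [Finset.mem_Icc] at hd
    exact Finset.mem_range.mpr (Nat.lt_succ_of_le (Nat.log_mono_right hd.2))
  rw [← Finset.sum_fiberwise_of_maps_to hmaps]
  refine Finset.sum_congr rfl fun i _ => ?_
  rw [← Finset.sum_filter]
  refine Finset.sum_congr ?_ fun _ _ => rfl
  ext d
  rw [Finset.mem_filter, Finset.mem_filter, Finset.mem_Icc, Finset.mem_Ico]
  constructor
  · rintro ⟨⟨h1, h2⟩, rfl⟩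
    refine ⟨⟨Nat.pow_log_le_self 2 (by omega), ?_⟩, h2⟩
    have := Nat.lt_pow_succ_log_self (b := 2) (by norm_num) d
    rw [pow_succ] at this
    omega
  · rintro ⟨⟨h1, h2⟩, h3⟩
    have h4 : 0 < 2 ^ i := by positivity
    refine ⟨⟨by omega, h3⟩, ?_⟩
    rw [Nat.log_eq_iff (Or.inr ⟨by norm_num, by omega⟩), pow_succ]
    omega

/-- The constant for linear sums. -/
def linearConst (j : ℕ) : ℕ :=
  2 ^ 2 ^ j * (j * 2 ^ j + 16 * ((j + 1).factorial * 2 ^ (j + 1)) + 8) * 2 ^ (j + 3)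

/-- Linear (Type I) sums. -/
theorem typeI_sum {j : ℕ} {f : ℝ[X]} {α : ℤ} {q x H R : ℕ} {δ L : ℝ}
    (hA : IsAdmissible j f α q x H R δ L) {u : ℕ} (hu0 : 1 ≤ u) (huδ : u * δ ^ 2 ^ j ≤ 1) (hux : u ≤ x)
    (a : ℕ → ℝ) {A : ℝ} (ha : ∀ d ≤ x, |a d| ≤ A) (hau : ∀ d, u < d → a d = 0)
    {y : ℕ} (hy : 1 ≤ y) :
    ∑ h ∈ Finset.Icc 1 H, ‖∑ d ∈ Finset.Icc 1 x, ∑ n ∈ Finset.Icc 1 x,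
      if d * n ≤ x then (a d : ℂ) * ((if y ≤ n then 1 else 0 : ℝ) : ℂ) *
        e (h * f.eval ((d * n : ℕ) : ℝ)) else 0‖
      ≤ 2 * linearConst j * R * L ^ 2 * A * (H * x * δ) := by
  have hA0 : 0 ≤ A := (abs_nonneg _).trans (ha 0 (by omega))
  have hL1 := hA.one_le_L
  have hx := hA.one_le_x
  have h1 : ∀ h : ℕ, ∀ d ∈ Finset.Icc 1 x, ∑ n ∈ Finset.Icc 1 x,
      (if d * n ≤ x then (a d : ℂ) * ((if y ≤ n then 1 else 0 : ℝ) : ℂ) *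
        e (h * f.eval ((d * n : ℕ) : ℝ)) else 0)
      = a d * ∑ n ∈ Finset.Ico (y : ℤ) ((x / d : ℕ) + 1), e (h * f.eval ((d : ℝ) * n)) := by
    intro h d hd
    rw [Finset.mem_Icc] at hd
    have h2 := sum_Ico_cast (fun n => e (h * f.eval ((d : ℝ) * n))) y (x / d + 1)
    push_cast at h2 ⊢
    rw [h2, Finset.mul_sum, ← Finset.sum_filter]
    have h3 : Finset.Ico y (x / d + 1)
        = ((Finset.Icc 1 x).filter fun n => d * n ≤ x).filter fun n => y ≤ n := by
      ext n
      rw [Finset.mem_filter, Finset.mem_filter, Finset.mem_Icc, Finset.mem_Ico, Nat.lt_succ_iff,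
        Nat.le_div_iff_mul_le hd.1]
      constructor
      · rintro ⟨h4, h5⟩
        have := Nat.le_mul_of_pos_right n hd.1
        refine ⟨⟨⟨by omega, by omega⟩, by linarith⟩, h4⟩
      · rintro ⟨⟨_, h4⟩, h5⟩
        exact ⟨h5, by linarith⟩
    rw [h3]
    conv_rhs => rw [Finset.sum_filter]
    refine Finset.sum_congr rfl fun n _ => ?_
    split_ifs <;> simp
  have h2 : ∀ h : ℕ, ‖∑ d ∈ Finset.Icc 1 x, ∑ n ∈ Finset.Icc 1 x,
      if d * n ≤ x then (a d : ℂ) * ((if y ≤ n then 1 else 0 : ℝ) : ℂ) *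
        e (h * f.eval ((d * n : ℕ) : ℝ)) else 0‖
      ≤ A * ∑ i ∈ Finset.range (Nat.log 2 u + 1), ∑ d ∈ Finset.Ico (2 ^ i) (2 * 2 ^ i),
        ‖∑ n ∈ Finset.Ico (y : ℤ) ((x / d : ℕ) + 1), e (h * f.eval ((d : ℝ) * n))‖ := by
    intro h
    rw [Finset.sum_congr rfl (h1 h)]
    have h3 : ∑ d ∈ Finset.Icc 1 x, (a d : ℂ) *
          ∑ n ∈ Finset.Ico (y : ℤ) ((x / d : ℕ) + 1), e (h * f.eval ((d : ℝ) * n))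
        = ∑ d ∈ Finset.Icc 1 u, (a d : ℂ) *
          ∑ n ∈ Finset.Ico (y : ℤ) ((x / d : ℕ) + 1), e (h * f.eval ((d : ℝ) * n)) := by
      symm
      refine Finset.sum_subset (Finset.Icc_subset_Icc_right hux) fun d hd hd' => ?_
      rw [Finset.mem_Icc] at hd hd'
      rw [hau d (by omega)]
      simp
    rw [h3]
    refine (norm_sum_le _ _).trans ?_
    rw [sum_dyadic, Finset.mul_sum]
    refine Finset.sum_le_sum fun i _ => ?_
    rw [Finset.mul_sum]
    refine Finset.sum_le_sum fun d _ => ?_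
    split_ifs with hd
    · rw [norm_mul, Complex.norm_real, Real.norm_eq_abs]
      gcongr
      exact ha d (hd.trans hux)
    · positivity
  refine (Finset.sum_le_sum fun h _ => h2 h).trans ?_
  rw [← Finset.mul_sum, Finset.sum_comm]
  have h4 : ∀ i ∈ Finset.range (Nat.log 2 u + 1), ∑ h ∈ Finset.Icc 1 H,
      ∑ d ∈ Finset.Ico (2 ^ i) (2 * 2 ^ i),
        ‖∑ n ∈ Finset.Ico (y : ℤ) ((x / d : ℕ) + 1), e (h * f.eval ((d : ℝ) * n))‖
      ≤ linearConst j * R * L * (H * x * δ) := by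
    intro i hi
    rw [Finset.mem_range, Nat.lt_succ_iff] at hi
    have h5 : 2 ^ i ≤ u := (Nat.pow_le_pow_right (by norm_num) hi).trans
      (Nat.pow_log_le_self 2 (by omega))
    refine typeI_block hA Nat.one_le_two_pow ?_ (by exact_mod_cast hy)
    refine le_trans ?_ huδ
    have := hA.δ_pos
    gcongr
  refine (mul_le_mul_of_nonneg_left (Finset.sum_le_sum h4) hA0).trans ?_
  rw [Finset.sum_const, Finset.card_range, nsmul_eq_mul]
  have h6 : ((Nat.log 2 u + 1 : ℕ) : ℝ) ≤ 2 * L := by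
    refine natLog_two_add_one_le hu0 (le_trans ?_ hA.log_x_le)
    gcongr
  have hδ := hA.δ_pos
  calc A * (((Nat.log 2 u + 1 : ℕ) : ℝ) * (linearConst j * R * L * (H * x * δ)))
      ≤ A * (2 * L * (linearConst j * R * L * (H * x * δ))) := by gcongr
    _ = _ := by ring

/-- Bilinear (Type II) sums, restricted to `n ≤ d` or `n < d`. -/
theorem typeII_half {j : ℕ} {f : ℝ[X]} {α : ℤ} {q x H R : ℕ} {δ L : ℝ}
    (hA : IsAdmissible j f α q x H R δ L) (s : ℕ) (a b : ℕ → ℝ) {A B : ℝ}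
    (ha : ∀ d ≤ x, |a d| ≤ A) (hb : ∀ n ≤ x, |b n| ≤ B)
    (hbδ : ∀ n : ℕ, n * δ ^ 2 ^ j < 1 → b n = 0) :
    ∑ h ∈ Finset.Icc 1 H, ‖∑ d ∈ Finset.Icc 1 x, ∑ n ∈ Finset.Icc 1 x,
      if n + s ≤ d ∧ d * n ≤ x then (a d : ℂ) * (b n : ℂ) *
        e (h * f.eval ((d * n : ℕ) : ℝ)) else 0‖
      ≤ 4 * (j + 1 + 4 * bilinearConst j : ℕ) * R * L ^ 2 * A * B * (H * x * δ) := by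
  have hA0 : 0 ≤ A := (abs_nonneg _).trans (ha 0 (by omega))
  have hB0 : 0 ≤ B := (abs_nonneg _).trans (hb 0 (by omega))
  have hL1 := hA.one_le_L
  have hx := hA.one_le_x
  have hδ := hA.δ_pos
  let a' : ℤ → ℂ := fun z => if z ≤ x then (a z.toNat : ℂ) else 0
  let b' : ℤ → ℂ := fun z => if z ≤ x then (b z.toNat : ℂ) else 0
  have ha' : ∀ z, ‖a' z‖ ≤ A := by
    intro z
    simp only [a']
    split_ifs
    · rw [Complex.norm_real]
      exact ha _ (by omega)
    · simpa using hA0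
  have hb' : ∀ z, ‖b' z‖ ≤ B := by
    intro z
    simp only [b']
    split_ifs
    · rw [Complex.norm_real]
      exact hb _ (by omega)
    · simpa using hB0
  set T : ℕ → ℕ → ℂ := fun h d => ∑ n ∈ Finset.Icc 1 x,
      if n + s ≤ d ∧ d * n ≤ x then (a d : ℂ) * (b n : ℂ) *
        e (h * f.eval ((d * n : ℕ) : ℝ)) else 0 with hT
  have hblock : ∀ i ∈ Finset.range (Nat.log 2 x + 1), ∑ h ∈ Finset.Icc 1 H,
      ‖∑ d ∈ Finset.Ico (2 ^ i) (2 * 2 ^ i), if d ≤ x then T h d else 0‖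
      ≤ (2 * (j + 1 + 4 * bilinearConst j) : ℕ) * R * L * A * B * (H * x * δ) := by
    intro i hi
    rw [Finset.mem_range, Nat.lt_succ_iff] at hi
    have hMx : 2 ^ i ≤ x := (Nat.pow_le_pow_right (by norm_num) hi).trans
      (Nat.pow_log_le_self 2 (by omega))
    have hM : 1 ≤ 2 ^ i := Nat.one_le_two_pow
    generalize 2 ^ i = M at hM hMx
    -- For M ≤ d < 2M the conditions n ≤ d and dn ≤ x force n ≤ N, and N ≤ 2M holds by construction.
    set N := min (2 * M) (x / M) with hN
    have hNx : N ≤ x := (min_le_right _ _).trans (Nat.div_le_self x M)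
    have hout : ∀ d n : ℕ, M ≤ d → d < 2 * M → n + s ≤ d → d * n ≤ x → n ≤ N := by
      intro d n h1 h2 h3 h4
      refine le_min (by omega) ?_
      rw [Nat.le_div_iff_mul_le hM]
      nlinarith
    by_cases hNδ : 1 ≤ N * δ ^ 2 ^ j
    · have hN1 : 1 ≤ N := by
        rcases Nat.eq_zero_or_pos N with h | h
        · rw [h] at hNδ
          norm_num at hNδ
        · exact h
      -- For fixed n the region n + s ≤ d, dn ≤ x is an interval in d, which is the shape of weight
      -- that the block estimate allows.
      let u : ℤ → ℤ := fun n => max M (n + s)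
      let v : ℤ → ℤ := fun n => min (2 * M) (x / n + 1)
      have key := typeII_block hA hM hN1 (by
          calc M * N ≤ M * (x / M) := by
                gcongr
                exact min_le_right _ _
            _ ≤ x := Nat.mul_div_le x M) (min_le_left _ _) hNδ a' b' ha' hb'
          (fun d n => ind (u n) (v n) d) u v (fun _ _ => rfl) (fun _ => le_max_left _ _)
          (fun _ => min_le_left _ _)
      refine le_trans (le_of_eq ?_) key
      refine Finset.sum_congr rfl fun h _ => ?_
      congr 1
      have h1 : ((2 * (M : ℤ))) = ((2 * M : ℕ) : ℤ) := by push_cast; ring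
      rw [h1, sum_Ico_cast]
      refine Finset.sum_congr rfl fun d hd => ?_
      rw [Finset.mem_Ico] at hd
      have h2 : (1 + (N : ℤ)) = ((1 + N : ℕ) : ℤ) := by push_cast; ring
      have h3 : (1 : ℤ) = ((1 : ℕ) : ℤ) := rfl
      rw [h2, h3, sum_Ico_cast]
      by_cases hdx : d ≤ x
      · have e1 : a' d = a d := by
          simp only [a']
          rw [if_pos (by exact_mod_cast hdx)]
          simp
        rw [if_pos hdx, hT, e1, Finset.mul_sum]
        symm
        have hsub : Finset.Ico 1 (1 + N) ⊆ Finset.Icc 1 x := by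
          intro n hn
          rw [Finset.mem_Ico] at hn
          rw [Finset.mem_Icc]
          omega
        simp only
        rw [← Finset.sum_subset hsub]
        · refine Finset.sum_congr rfl fun n hn => ?_
          rw [Finset.mem_Ico] at hn
          have e2 : b' n = b n := by
            simp only [b']
            rw [if_pos (by exact_mod_cast (by omega : n ≤ x))]
            simp
          have e3 : ind (u n) (v n) d = if n + s ≤ d ∧ d * n ≤ x then 1 else 0 := by
            unfold ind
            congr 1
            rw [Finset.mem_Ico, max_le_iff, lt_min_iff]
            apply propext
            have h4 : (d : ℤ) < x / n + 1 ↔ d * n ≤ x := by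
              rw [Int.lt_add_one_iff, ← Nat.le_div_iff_mul_le (by omega)]
              norm_cast
            rw [h4]
            constructor
            · rintro ⟨⟨_, h5⟩, _, h6⟩
              exact ⟨by exact_mod_cast h5, h6⟩
            · rintro ⟨h5, h6⟩
              exact ⟨⟨by exact_mod_cast hd.1, by exact_mod_cast h5⟩, by exact_mod_cast hd.2, h6⟩
          rw [e2, e3]
          push_cast
          split_ifs
          · ring
          · ring
        · intro n hn hn'
          rw [if_neg]
          rintro ⟨h5, h6⟩
          have := hout d n hd.1 hd.2 h5 h6
          rw [Finset.mem_Icc] at hn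
          rw [Finset.mem_Ico] at hn'
          omega
      · have e1 : a' d = 0 := by
          simp only [a']
          rw [if_neg (by exact_mod_cast hdx)]
        rw [if_neg hdx, e1, zero_mul]
    -- If N is below δ^(-2^j), then b vanishes at every n that occurs, and the block is empty.
    · have hz : ∀ h : ℕ, ∀ d ∈ Finset.Ico M (2 * M), (if d ≤ x then T h d else 0) = 0 := by
        intro h d hd
        rw [Finset.mem_Ico] at hd
        split_ifs
        · rw [hT]
          refine Finset.sum_eq_zero fun n _ => ?_
          split_ifs with hc
          · have h1 := hout d n hd.1 hd.2 hc.1 hc.2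
            have h2 : b n = 0 := by
              apply hbδ
              refine lt_of_le_of_lt ?_ (not_le.mp hNδ)
              gcongr
            rw [h2]
            simp
          · rfl
        · rfl
      have hz' : ∀ h : ℕ, ∑ d ∈ Finset.Ico M (2 * M), (if d ≤ x then T h d else 0) = 0 :=
        fun h => Finset.sum_eq_zero (hz h)
      simp only [hz', norm_zero, Finset.sum_const_zero]
      positivity
  have h1 : ∀ h : ℕ, ‖∑ d ∈ Finset.Icc 1 x, T h d‖ ≤ ∑ i ∈ Finset.range (Nat.log 2 x + 1),
      ‖∑ d ∈ Finset.Ico (2 ^ i) (2 * 2 ^ i), if d ≤ x then T h d else 0‖ := by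
    intro h
    rw [sum_dyadic]
    exact norm_sum_le _ _
  refine (Finset.sum_le_sum fun h _ => h1 h).trans ?_
  rw [Finset.sum_comm]
  refine (Finset.sum_le_sum hblock).trans ?_
  rw [Finset.sum_const, Finset.card_range, nsmul_eq_mul]
  have h6 : ((Nat.log 2 x + 1 : ℕ) : ℝ) ≤ 2 * L := natLog_two_add_one_le hx hA.log_x_le
  calc ((Nat.log 2 x + 1 : ℕ) : ℝ) *
        ((2 * (j + 1 + 4 * bilinearConst j) : ℕ) * R * L * A * B * (H * x * δ))
      ≤ (2 * L) * ((2 * (j + 1 + 4 * bilinearConst j) : ℕ) * R * L * A * B * (H * x * δ)) := by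
        gcongr
    _ = _ := by
        push_cast
        ring

/-- Bilinear (Type II) sums. -/
theorem typeII_sum {j : ℕ} {f : ℝ[X]} {α : ℤ} {q x H R : ℕ} {δ L : ℝ}
    (hA : IsAdmissible j f α q x H R δ L) (a b : ℕ → ℝ) {A B : ℝ}
    (ha : ∀ d ≤ x, |a d| ≤ A) (hb : ∀ n ≤ x, |b n| ≤ B)
    (haδ : ∀ n : ℕ, n * δ ^ 2 ^ j < 1 → a n = 0)
    (hbδ : ∀ n : ℕ, n * δ ^ 2 ^ j < 1 → b n = 0) :
    ∑ h ∈ Finset.Icc 1 H, ‖∑ d ∈ Finset.Icc 1 x, ∑ n ∈ Finset.Icc 1 x,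
      if d * n ≤ x then (a d : ℂ) * (b n : ℂ) * e (h * f.eval ((d * n : ℕ) : ℝ)) else 0‖
      ≤ 8 * (j + 1 + 4 * bilinearConst j : ℕ) * R * L ^ 2 * A * B * (H * x * δ) := by
  -- The larger of the two variables always plays the role of d. The values s = 0 and s = 1 assign
  -- the diagonal to exactly one half.
  have h1 := typeII_half hA 0 a b ha hb hbδ
  have h2 := typeII_half hA 1 b a hb ha haδ
  have h3 : ∀ h : ℕ, ‖∑ d ∈ Finset.Icc 1 x, ∑ n ∈ Finset.Icc 1 x,
      if d * n ≤ x then (a d : ℂ) * (b n : ℂ) * e (h * f.eval ((d * n : ℕ) : ℝ)) else 0‖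
      ≤ ‖∑ d ∈ Finset.Icc 1 x, ∑ n ∈ Finset.Icc 1 x,
      if n + 0 ≤ d ∧ d * n ≤ x then (a d : ℂ) * (b n : ℂ) *
        e (h * f.eval ((d * n : ℕ) : ℝ)) else 0‖
      + ‖∑ d ∈ Finset.Icc 1 x, ∑ n ∈ Finset.Icc 1 x,
      if n + 1 ≤ d ∧ d * n ≤ x then (b d : ℂ) * (a n : ℂ) *
        e (h * f.eval ((d * n : ℕ) : ℝ)) else 0‖ := by
    intro h
    refine le_trans (le_of_eq ?_) (norm_add_le _ _)
    congr 1
    rw [Finset.sum_comm (f := fun d n => if n + 1 ≤ d ∧ d * n ≤ x then (b d : ℂ) * (a n : ℂ) *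
        e (h * f.eval ((d * n : ℕ) : ℝ)) else 0), ← Finset.sum_add_distrib]
    refine Finset.sum_congr rfl fun d _ => ?_
    rw [← Finset.sum_add_distrib]
    refine Finset.sum_congr rfl fun n _ => ?_
    rw [mul_comm n d, mul_comm (b n : ℂ)]
    by_cases h4 : d * n ≤ x
    · by_cases h5 : n ≤ d
      · have h6 : ¬ (d + 1 ≤ n) := by omega
        simp [h4, h5, h6]
      · have h6 : d + 1 ≤ n := by omega
        simp [h4, h5, h6]
    · simp [h4]
  refine (Finset.sum_le_sum fun h _ => h3 h).trans ?_
  rw [Finset.sum_add_distrib]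
  refine (add_le_add h1 h2).trans (le_of_eq ?_)
  ring

/-- The bilinear sum attached to `a`, `b` and the phase `h f`. -/
noncomputable def bsum (f : ℝ[X]) (x : ℕ) (a b : ℕ → ℝ) (h : ℕ) : ℂ :=
  ∑ d ∈ Finset.Icc 1 x, ∑ n ∈ Finset.Icc 1 x,
    if d * n ≤ x then (a d : ℂ) * (b n : ℂ) * e (h * f.eval ((d * n : ℕ) : ℝ)) else 0

lemma bsum_congr_right (f : ℝ[X]) (x : ℕ) (a b b' : ℕ → ℝ) (h : ℕ)
    (hb : ∀ n ∈ Finset.Icc 1 x, b n = b' n) : bsum f x a b h = bsum f x a b' h := by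
  refine Finset.sum_congr rfl fun d _ => Finset.sum_congr rfl fun n hn => ?_
  rw [hb n hn]

lemma bsum_add_left (f : ℝ[X]) (x : ℕ) (a a' b : ℕ → ℝ) (h : ℕ) :
    bsum f x (fun n => a n + a' n) b h = bsum f x a b h + bsum f x a' b h := by
  simp only [bsum]
  rw [← Finset.sum_add_distrib]
  refine Finset.sum_congr rfl fun d _ => ?_
  rw [← Finset.sum_add_distrib]
  refine Finset.sum_congr rfl fun n _ => ?_
  split_ifs
  · push_cast
    ring
  · ring

lemma bsum_add_right (f : ℝ[X]) (x : ℕ) (a b b' : ℕ → ℝ) (h : ℕ) :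
    bsum f x a (fun n => b n + b' n) h = bsum f x a b h + bsum f x a b' h := by
  simp only [bsum]
  rw [← Finset.sum_add_distrib]
  refine Finset.sum_congr rfl fun d _ => ?_
  rw [← Finset.sum_add_distrib]
  refine Finset.sum_congr rfl fun n _ => ?_
  split_ifs
  · push_cast
    ring
  · ring

lemma bsum_sum_right {ι : Type*} (s : Finset ι) (w : ι → ℝ) (f : ℝ[X]) (x : ℕ) (a : ℕ → ℝ)
    (b : ι → ℕ → ℝ) (h : ℕ) :
    bsum f x a (fun n => ∑ i ∈ s, w i * b i n) h = ∑ i ∈ s, (w i : ℂ) * bsum f x a (b i) h := by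
  simp only [bsum, Finset.mul_sum]
  conv_rhs => rw [Finset.sum_comm]
  refine Finset.sum_congr rfl fun d _ => ?_
  conv_rhs => rw [Finset.sum_comm]
  refine Finset.sum_congr rfl fun n _ => ?_
  split_ifs
  · push_cast
    rw [Finset.mul_sum, Finset.sum_mul]
    refine Finset.sum_congr rfl fun i _ => ?_
    ring
  · simp

lemma sum_indicator_le (x w : ℕ) {c : ℝ} (hc : 0 ≤ c) :
    ∑ d ∈ Finset.Icc 1 x, (if d ≤ w then c else 0) ≤ w * c := by
  rw [← Finset.sum_filter, Finset.sum_const, nsmul_eq_mul]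
  gcongr
  calc ((Finset.Icc 1 x).filter fun d => d ≤ w).card ≤ (Finset.Icc 1 w).card := by
        refine Finset.card_le_card fun d hd => ?_
        rw [Finset.mem_filter, Finset.mem_Icc] at hd
        exact Finset.mem_Icc.mpr ⟨hd.1.1, hd.2⟩
    _ = w := by simp

lemma norm_bsum_le (f : ℝ[X]) (x : ℕ) (a b : ℕ → ℝ) (h : ℕ) {u v : ℕ} {A B : ℝ} (hA : 0 ≤ A)
    (hB : 0 ≤ B) (ha : ∀ d ≤ x, |a d| ≤ if d ≤ u then A else 0)
    (hb : ∀ d ≤ x, |b d| ≤ if d ≤ v then B else 0) :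
    ‖bsum f x a b h‖ ≤ (u * A) * (v * B) := by
  have h1 : ∀ d ∈ Finset.Icc 1 x, ∀ n ∈ Finset.Icc 1 x,
      ‖if d * n ≤ x then (a d : ℂ) * (b n : ℂ) * e (h * f.eval ((d * n : ℕ) : ℝ)) else 0‖
      ≤ (if d ≤ u then A else 0) * (if n ≤ v then B else 0) := by
    intro d hd n hn
    rw [Finset.mem_Icc] at hd hn
    have h2 := ha d hd.2
    have h3 := hb n hn.2
    have h4 : |a d| * |b n| ≤ (if d ≤ u then A else 0) * (if n ≤ v then B else 0) := by
      gcongr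
    refine le_trans ?_ h4
    split_ifs
    · rw [norm_mul, norm_mul, norm_e, Complex.norm_real, Complex.norm_real, mul_one]
      rfl
    · rw [norm_zero]
      positivity
  refine (norm_sum_le _ _).trans ?_
  refine (Finset.sum_le_sum fun d hd => (norm_sum_le _ _).trans
    (Finset.sum_le_sum fun n hn => h1 d hd n hn)).trans ?_
  rw [← Finset.sum_mul_sum]
  gcongr
  · exact sum_indicator_le x u hA
  · exact sum_indicator_le x v hB

/-- Writes log as a superposition of cut-offs y ≤ n, for partial summation. The convention `Real.log
0 = 0` makes the term y = 1 vanish, so all weights are nonnegative. -/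
lemma log_eq_sum (n : ℕ) :
    Real.log n = ∑ y ∈ Finset.Icc 1 n, (Real.log y - Real.log ((y - 1 : ℕ) : ℝ)) := by
  induction n with
  | zero => simp
  | succ n ih =>
    rw [Finset.sum_Icc_succ_top (by omega), ← ih]
    simp

open ArithmeticFunction in
-- Dominated by the identity 1 * Λ = log.
lemma abs_mul_le_log {a b : ArithmeticFunction ℝ} (ha : ∀ n, |a n| ≤ 1)
    (hb : ∀ n, |b n| ≤ vonMangoldt n) (n : ℕ) : |(a * b) n| ≤ Real.log n := by
  rw [mul_apply, ← vonMangoldt_sum, ← Nat.sum_divisorsAntidiagonal' (f := fun _ i => vonMangoldt i)]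
  refine (Finset.abs_sum_le_sum_abs _ _).trans (Finset.sum_le_sum fun p _ => ?_)
  rw [abs_mul]
  calc |a p.1| * |b p.2| ≤ 1 * vonMangoldt p.2 := by
        gcongr
        · exact ha _
        · exact hb _
    _ = vonMangoldt p.2 := one_mul _

/-- The constant in the estimate for exponential sums over primes. -/
def expConst (j : ℕ) : ℕ := 2 + 4 * linearConst j + 16 * (j + 1 + 4 * bilinearConst j)

open ArithmeticFunction in
/-- Exponential sums over primes with polynomial phases, on average over multiples of the
phase. -/
theorem sum_norm_vonMangoldt_le {j : ℕ} {f : ℝ[X]} {α : ℤ} {q x H R : ℕ} {δ L : ℝ}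
    (hA : IsAdmissible j f α q x H R δ L) :
    ∑ h ∈ Finset.Icc 1 H, ‖∑ n ∈ Finset.Icc 1 x, (vonMangoldt n : ℂ) * e (h * f.eval (n : ℝ))‖
      ≤ expConst j * R * L ^ 3 * (H * x * δ) := by
  have hj := hA.one_le_j
  have hL1 := hA.one_le_L
  have hx := hA.one_le_x
  have hδ := hA.δ_pos
  have hδ1 := hA.δ_le_one
  have hxδ := hA.one_le_x_mul
  have hH0 : (0 : ℝ) ≤ H := Nat.cast_nonneg _
  have hR0 : (1 : ℝ) ≤ R := by exact_mod_cast hA.one_le_R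
  have hx0 : (1 : ℝ) ≤ x := by exact_mod_cast hx
  have hK : 2 ≤ 2 ^ j := by
    calc 2 = 2 ^ 1 := rfl
      _ ≤ 2 ^ j := Nat.pow_le_pow_right (by norm_num) hj
  have hlogx : 0 ≤ Real.log x := Real.log_nonneg hx0
  have hlogL : ∀ n ≤ x, Real.log n ≤ L := by
    intro n hn
    have h1 : Real.log n ≤ Real.log x := by
      rcases Nat.eq_zero_or_pos n with rfl | h
      · simpa using hlogx
      · gcongr
    linarith [hA.log_x_le]
  set D := δ ^ 2 ^ j with hD
  have hD0 : 0 < D := by positivity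
  have hD1 : D ≤ 1 := pow_le_one₀ hδ.le hδ1
  -- The cut of Vaughan's identity sits at δ^(-2^j): variables up to u are admissible in linear
  -- sums, variables beyond u in bilinear sums.
  set u := ⌊D⁻¹⌋₊ with hu
  have hu1 : 1 ≤ u := Nat.le_floor (by
    rw [Nat.cast_one]
    exact (one_le_inv₀ hD0).mpr hD1)
  have huD : u * D ≤ 1 := by
    have h1 : (u : ℝ) ≤ D⁻¹ := Nat.floor_le (by positivity)
    calc (u : ℝ) * D ≤ D⁻¹ * D := by gcongr
      _ = 1 := inv_mul_cancel₀ hD0.ne'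
  have hulow : ∀ n : ℕ, n * D < 1 → n ≤ u := by
    intro n hn
    refine Nat.le_floor ?_
    rw [inv_eq_one_div, le_div_iff₀ hD0]
    exact hn.le
  -- Since 2·4^j ≥ 3·2^j + 1 for j ≥ 1, the condition on x gives u³ ≤ xδ. This pays for the pieces
  -- that are bounded trivially.
  have hu3 : (u : ℝ) ^ 3 ≤ x * δ := by
    have h1 : δ ^ (2 ^ j * 2 ^ j) * δ ^ (2 ^ j * 2 ^ j) ≤ D ^ 3 * δ := by
      rw [hD, ← pow_add, ← pow_mul, ← pow_succ]
      refine pow_le_pow_of_le_one hδ.le hδ1 ?_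
      nlinarith
    calc (u : ℝ) ^ 3 = u ^ 3 * 1 := (mul_one _).symm
      _ ≤ u ^ 3 * (x * (δ ^ (2 ^ j * 2 ^ j)) ^ 2) := by gcongr
      _ = u ^ 3 * (x * (δ ^ (2 ^ j * 2 ^ j) * δ ^ (2 ^ j * 2 ^ j))) := by ring
      _ ≤ u ^ 3 * (x * (D ^ 3 * δ)) := by gcongr
      _ = (u * D) ^ 3 * (x * δ) := by ring
      _ ≤ 1 ^ 3 * (x * δ) := by gcongr
      _ = x * δ := by ring
  have hu1' : (1 : ℝ) ≤ u := by exact_mod_cast hu1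
  have huu3 : (u : ℝ) ≤ u ^ 3 := by
    calc (u : ℝ) = u ^ 1 := (pow_one _).symm
      _ ≤ u ^ 3 := pow_le_pow_right₀ hu1' (by norm_num)
  have hux : u ≤ x := by
    have h1 : (u : ℝ) ≤ x := by
      calc (u : ℝ) ≤ x * δ := huu3.trans hu3
        _ ≤ x * 1 := by gcongr
        _ = x := mul_one _
    exact_mod_cast h1
  set m₁ := lowPart u (moebius : ArithmeticFunction ℝ) with hm₁
  set m₂ := highPart u (moebius : ArithmeticFunction ℝ) with hm₂
  set v₁ := lowPart u vonMangoldt with hv₁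
  set v₂ := highPart u vonMangoldt with hv₂
  set z := (zeta : ArithmeticFunction ℝ) with hz
  have hmob : ∀ n, |(moebius : ArithmeticFunction ℝ) n| ≤ 1 := by
    intro n
    rw [intCoe_apply]
    exact_mod_cast abs_moebius_le_one (n := n)
  have hm₁' : ∀ n, |m₁ n| ≤ 1 := by
    intro n
    rw [hm₁, lowPart_apply]
    split_ifs
    · exact hmob n
    · simp
  have hm₂' : ∀ n, |m₂ n| ≤ 1 := by
    intro n
    rw [hm₂, highPart_apply]
    split_ifs
    · exact hmob n
    · simp
  have hv₁' : ∀ n, |v₁ n| ≤ vonMangoldt n := by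
    intro n
    rw [hv₁, lowPart_apply]
    split_ifs
    · rw [abs_of_nonneg vonMangoldt_nonneg]
    · simp
  have hv₂' : ∀ n, |v₂ n| ≤ vonMangoldt n := by
    intro n
    rw [hv₂, highPart_apply]
    split_ifs
    · rw [abs_of_nonneg vonMangoldt_nonneg]
    · simp
  have hz' : ∀ n, |z n| ≤ 1 := by
    intro n
    rw [hz, natCoe_apply, zeta_apply]
    split_ifs <;> simp
  set c := m₁ * v₁ with hc
  set g := v₂ * z with hg
  have hcL : ∀ n ≤ x, |c n| ≤ L := fun n hn => (abs_mul_le_log hm₁' hv₁' n).trans (hlogL n hn)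
  have hgL : ∀ n ≤ x, |g n| ≤ L := fun n hn => by
    rw [hg, mul_comm]
    exact (abs_mul_le_log hz' hv₂' n).trans (hlogL n hn)
  have hcsupp : ∀ n, u * u < n → c n = 0 := by
    intro n hn
    rw [hc, mul_apply]
    refine Finset.sum_eq_zero fun p hp => ?_
    rw [Nat.mem_divisorsAntidiagonal] at hp
    rw [hm₁, hv₁, lowPart_apply, lowPart_apply]
    split_ifs with h1 h2
    · have := Nat.mul_le_mul h1 h2
      omega
    · simp
    · simp
    · simp
  have hgsupp : ∀ n ≤ u, g n = 0 := by
    intro n hn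
    rw [hg, mul_apply]
    refine Finset.sum_eq_zero fun p hp => ?_
    rw [Nat.mem_divisorsAntidiagonal] at hp
    have h1 : p.1 ≤ n := Nat.le_of_dvd (Nat.pos_of_ne_zero hp.2) (Dvd.intro _ hp.1)
    rw [hv₂, highPart_apply, if_neg (by omega), zero_mul]
  -- decomposition
  have hdec : ∀ h : ℕ, ∑ n ∈ Finset.Icc 1 x, (vonMangoldt n : ℂ) * e (h * f.eval (n : ℝ))
      = ∑ n ∈ Finset.Icc 1 x, (v₁ n : ℂ) * e (h * f.eval (n : ℝ)) + bsum f x m₁ log h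
        - (bsum f x (lowPart u c) (fun n => if 1 ≤ n then 1 else 0) h
          + bsum f x (highPart u c) (lowPart u z) h + bsum f x (highPart u c) (highPart u z) h)
        + bsum f x m₂ g h := by
    intro h
    have e1 : bsum f x m₁ log h = ∑ n ∈ Finset.Icc 1 x, (((m₁ * log) n : ℝ) : ℂ) *
        e (h * f.eval (n : ℝ)) := (sum_conv_eq m₁ log (fun n => e (h * f.eval (n : ℝ))) x).symm
    have e2 : bsum f x m₂ g h = ∑ n ∈ Finset.Icc 1 x, (((m₂ * g) n : ℝ) : ℂ) *
        e (h * f.eval (n : ℝ)) := (sum_conv_eq m₂ g (fun n => e (h * f.eval (n : ℝ))) x).symm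
    have e3 : bsum f x c z h = ∑ n ∈ Finset.Icc 1 x, (((c * z) n : ℝ) : ℂ) *
        e (h * f.eval (n : ℝ)) := (sum_conv_eq c z (fun n => e (h * f.eval (n : ℝ))) x).symm
    -- The coefficient c lives up to u², too far for linear sums. Its part up to u is linear; beyond
    -- u it is paired with the low part of ζ (trivially at most u³ up to a logarithm) and with the
    -- high part of ζ (bilinear).
    have e4 : bsum f x c z h = bsum f x (lowPart u c) (fun n => if 1 ≤ n then 1 else 0) h
          + bsum f x (highPart u c) (lowPart u z) h
          + bsum f x (highPart u c) (highPart u z) h := by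
      have h1 : (c : ℕ → ℝ) = fun n => lowPart u c n + highPart u c n := by
        funext n
        rw [← ArithmeticFunction.add_apply, lowPart_add_highPart]
      have h2 : (z : ℕ → ℝ) = fun n => lowPart u z n + highPart u z n := by
        funext n
        rw [← ArithmeticFunction.add_apply, lowPart_add_highPart]
      conv_lhs => rw [h1]
      rw [bsum_add_left, add_assoc]
      congr 1
      · refine bsum_congr_right f x _ _ _ h fun n hn => ?_
        rw [Finset.mem_Icc] at hn
        rw [hz, natCoe_apply, zeta_apply, if_neg (by omega), if_pos hn.1]
        simp
      · conv_lhs => rw [h2]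
        rw [bsum_add_right]
    rw [← e4, e1, e2, e3, ← Finset.sum_add_distrib, ← Finset.sum_sub_distrib,
      ← Finset.sum_add_distrib]
    refine Finset.sum_congr rfl fun n _ => ?_
    conv_lhs => rw [vaughan_identity u]
    rw [ArithmeticFunction.add_apply, ← hm₁, ← hm₂, ← hv₁, ← hv₂, ← hz, ← hc, ← hg]
    have h3 : (v₁ + m₁ * log - c * z) n = v₁ n + (m₁ * log) n - (c * z) n := by
      rw [sub_eq_add_neg, ArithmeticFunction.add_apply, ArithmeticFunction.add_apply]
      rfl
    rw [h3]
    push_cast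
    ring
  set Q := H * x * δ with hQ
  have hQ0 : 0 ≤ Q := by positivity
  have t0 : ∑ h ∈ Finset.Icc 1 H, ‖∑ n ∈ Finset.Icc 1 x, (v₁ n : ℂ) * e (h * f.eval (n : ℝ))‖
      ≤ L * Q := by
    have h1 : ∀ h ∈ Finset.Icc 1 H,
        ‖∑ n ∈ Finset.Icc 1 x, (v₁ n : ℂ) * e (h * f.eval (n : ℝ))‖ ≤ L * (x * δ) := by
      intro h _
      refine (norm_sum_le _ _).trans ?_
      have h2 : ∀ n ∈ Finset.Icc 1 x, ‖(v₁ n : ℂ) * e (h * f.eval (n : ℝ))‖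
          ≤ if n ≤ u then L else 0 := by
        intro n hn
        rw [Finset.mem_Icc] at hn
        rw [norm_mul, norm_e, mul_one, Complex.norm_real, hv₁, lowPart_apply]
        split_ifs
        · rw [Real.norm_of_nonneg vonMangoldt_nonneg]
          exact vonMangoldt_le_log.trans (hlogL n hn.2)
        · simp
      refine (Finset.sum_le_sum h2).trans ((sum_indicator_le x u (by linarith)).trans ?_)
      rw [mul_comm]
      gcongr
      exact huu3.trans hu3
    refine (Finset.sum_le_sum h1).trans (le_of_eq ?_)
    rw [Finset.sum_const, Nat.card_Icc, nsmul_eq_mul, Nat.add_sub_cancel, hQ]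
    ring
  have t1 : ∑ h ∈ Finset.Icc 1 H, ‖bsum f x m₁ log h‖ ≤ 2 * linearConst j * R * L ^ 3 * Q := by
    -- Partial summation removes the logarithm: each cut-off gives a linear sum, and the nonnegative
    -- weights telescope to log x.
    have h1 : ∀ h : ℕ, ‖bsum f x m₁ log h‖ ≤ ∑ y ∈ Finset.Icc 1 x,
        (Real.log y - Real.log ((y - 1 : ℕ) : ℝ)) *
          ‖bsum f x m₁ (fun n => if y ≤ n then 1 else 0) h‖ := by
      intro h
      rw [bsum_congr_right f x m₁ log (fun n => ∑ y ∈ Finset.Icc 1 x,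
        (Real.log y - Real.log ((y - 1 : ℕ) : ℝ)) * (if y ≤ n then 1 else 0)) h, bsum_sum_right]
      · refine (norm_sum_le _ _).trans (Finset.sum_le_sum fun y hy => ?_)
        rw [norm_mul, Complex.norm_real, Real.norm_of_nonneg]
        rw [Finset.mem_Icc] at hy
        rw [sub_nonneg]
        rcases Nat.eq_or_lt_of_le hy.1 with h2 | h2
        · rw [← h2]
          simp
        · have : (0 : ℝ) < ((y - 1 : ℕ) : ℝ) := by exact_mod_cast (by omega : 0 < y - 1)
          gcongr
          omega
      · intro n hn
        rw [Finset.mem_Icc] at hn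
        rw [log_apply, log_eq_sum]
        simp only [mul_ite, mul_one, mul_zero]
        rw [← Finset.sum_filter]
        refine Finset.sum_congr ?_ fun _ _ => rfl
        ext y
        rw [Finset.mem_filter, Finset.mem_Icc, Finset.mem_Icc]
        omega
    refine (Finset.sum_le_sum fun h _ => h1 h).trans ?_
    rw [Finset.sum_comm]
    have h2 : ∀ y ∈ Finset.Icc 1 x, ∑ h ∈ Finset.Icc 1 H,
        (Real.log y - Real.log ((y - 1 : ℕ) : ℝ)) *
          ‖bsum f x m₁ (fun n => if y ≤ n then 1 else 0) h‖
        ≤ (Real.log y - Real.log ((y - 1 : ℕ) : ℝ)) *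
          (2 * linearConst j * R * L ^ 2 * 1 * Q) := by
      intro y hy
      rw [Finset.mem_Icc] at hy
      rw [← Finset.mul_sum]
      refine mul_le_mul_of_nonneg_left ?_ ?_
      · exact typeI_sum hA hu1 huD hux m₁ (fun d _ => hm₁' d) (fun d hd => by
          rw [hm₁, lowPart_apply, if_neg (by omega)]) hy.1
      · rw [sub_nonneg]
        rcases Nat.eq_or_lt_of_le hy.1 with h2 | h2
        · rw [← h2]
          simp
        · have : (0 : ℝ) < ((y - 1 : ℕ) : ℝ) := by exact_mod_cast (by omega : 0 < y - 1)
          gcongr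
          omega
    refine (Finset.sum_le_sum h2).trans ?_
    rw [← Finset.sum_mul, ← log_eq_sum]
    calc Real.log x * (2 * linearConst j * R * L ^ 2 * 1 * Q)
        ≤ L * (2 * linearConst j * R * L ^ 2 * 1 * Q) := by
          gcongr
          exact hlogL x le_rfl
      _ = _ := by ring
  have t2 : ∑ h ∈ Finset.Icc 1 H, ‖bsum f x (lowPart u c) (fun n => if 1 ≤ n then 1 else 0) h‖
      ≤ 2 * linearConst j * R * L ^ 3 * Q := by
    refine (typeI_sum hA hu1 huD hux (lowPart u c) (A := L) (fun d hd => ?_) (fun d hd => ?_)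
      le_rfl).trans (le_of_eq (by ring))
    · rw [lowPart_apply]
      split_ifs
      · exact hcL d hd
      · simpa using (by linarith : 0 ≤ L)
    · rw [lowPart_apply, if_neg (by omega)]
  have t3 : ∑ h ∈ Finset.Icc 1 H, ‖bsum f x (highPart u c) (lowPart u z) h‖ ≤ L * Q := by
    have h1 : ∀ h ∈ Finset.Icc 1 H, ‖bsum f x (highPart u c) (lowPart u z) h‖ ≤ L * (x * δ) := by
      intro h _
      refine (norm_bsum_le f x _ _ h (u := u * u) (v := u) (A := L) (B := 1) (by linarith)
        zero_le_one (fun d hd => ?_) (fun d hd => ?_)).trans ?_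
      · rw [highPart_apply]
        split_ifs with h2 h3
        · exact hcL d hd
        · rw [hcsupp d (by omega), abs_zero]
        · rw [abs_zero]
          linarith
        · simp
      · rw [lowPart_apply]
        split_ifs
        · exact hz' d
        · simp
      · push_cast
        calc (u : ℝ) * u * L * (u * 1) = L * u ^ 3 := by ring
          _ ≤ L * (x * δ) := by gcongr
    refine (Finset.sum_le_sum h1).trans (le_of_eq ?_)
    rw [Finset.sum_const, Nat.card_Icc, nsmul_eq_mul, Nat.add_sub_cancel, hQ]
    ring
  have hchi : ∀ n ≤ x, |highPart u c n| ≤ L := by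
    intro n hn
    rw [highPart_apply]
    split_ifs
    · exact hcL n hn
    · simpa using (by linarith : 0 ≤ L)
  have hhi0 : ∀ (a : ArithmeticFunction ℝ) (n : ℕ), n * D < 1 → highPart u a n = 0 := by
    intro a n hn
    have := hulow n hn
    rw [highPart_apply, if_neg (by omega)]
  have t4 : ∑ h ∈ Finset.Icc 1 H, ‖bsum f x (highPart u c) (highPart u z) h‖
      ≤ 8 * (j + 1 + 4 * bilinearConst j : ℕ) * R * L ^ 3 * Q := by
    refine (typeII_sum hA (highPart u c) (highPart u z) (A := L) (B := 1) hchi (fun n _ => ?_)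
      (hhi0 c) (hhi0 z)).trans (le_of_eq (by ring))
    rw [highPart_apply]
    split_ifs
    · exact hz' n
    · simp
  have t5 : ∑ h ∈ Finset.Icc 1 H, ‖bsum f x m₂ g h‖
      ≤ 8 * (j + 1 + 4 * bilinearConst j : ℕ) * R * L ^ 3 * Q :=
    (typeII_sum hA m₂ g (A := 1) (B := L) (fun n _ => hm₂' n) hgL
      (hhi0 _) (fun n hn => hgsupp n (hulow n hn))).trans (le_of_eq (by ring))
  have hnorm : ∀ h : ℕ, ‖∑ n ∈ Finset.Icc 1 x, (vonMangoldt n : ℂ) * e (h * f.eval (n : ℝ))‖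
      ≤ ‖∑ n ∈ Finset.Icc 1 x, (v₁ n : ℂ) * e (h * f.eval (n : ℝ))‖ + ‖bsum f x m₁ log h‖
        + (‖bsum f x (lowPart u c) (fun n => if 1 ≤ n then 1 else 0) h‖
          + ‖bsum f x (highPart u c) (lowPart u z) h‖
          + ‖bsum f x (highPart u c) (highPart u z) h‖)
        + ‖bsum f x m₂ g h‖ := by
    intro h
    rw [hdec h]
    refine (norm_add_le _ _).trans ?_
    gcongr
    refine (norm_sub_le _ _).trans ?_
    gcongr
    · exact norm_add_le _ _
    · refine (norm_add_le _ _).trans ?_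
      gcongr
      exact norm_add_le _ _
  refine (Finset.sum_le_sum fun h _ => hnorm h).trans ?_
  simp only [Finset.sum_add_distrib]
  have hRL : L * Q ≤ R * L ^ 3 * Q := by
    have h1 : L ≤ L ^ 3 := by
      calc L = L ^ 1 := (pow_one _).symm
        _ ≤ L ^ 3 := pow_le_pow_right₀ hL1 (by norm_num)
    calc L * Q = 1 * L * Q := by ring
      _ ≤ R * L ^ 3 * Q := by gcongr
  calc _ ≤ L * Q + 2 * linearConst j * R * L ^ 3 * Q + (2 * linearConst j * R * L ^ 3 * Q + L * Q
        + 8 * (j + 1 + 4 * bilinearConst j : ℕ) * R * L ^ 3 * Q)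
        + 8 * (j + 1 + 4 * bilinearConst j : ℕ) * R * L ^ 3 * Q := by gcongr
    _ = 2 * (L * Q) + (4 * linearConst j + 16 * (j + 1 + 4 * bilinearConst j : ℕ)) *
        (R * L ^ 3 * Q) := by ring
    _ ≤ 2 * (R * L ^ 3 * Q) + (4 * linearConst j + 16 * (j + 1 + 4 * bilinearConst j : ℕ)) *
        (R * L ^ 3 * Q) := by gcongr
    _ = expConst j * R * L ^ 3 * Q := by
        rw [expConst]
        push_cast
        ring

/-! ### From small exponential sums to small fractional parts. -/

lemma norm_sq_trigonometric (M : ℕ) (c : ℕ → ℝ) (t : ℝ) :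
    ((‖∑ s ∈ Finset.range M, (c s : ℂ) * e (s * t)‖ ^ 2 : ℝ) : ℂ)
      = ∑ s ∈ Finset.range M, ∑ s' ∈ Finset.range M,
        ((c s * c s' : ℝ) : ℂ) * e (((s : ℤ) - (s' : ℤ) : ℤ) * t) := by
  push_cast
  rw [← Complex.mul_conj', map_sum, Finset.sum_mul_sum]
  refine Finset.sum_congr rfl fun s _ => Finset.sum_congr rfl fun s' _ => ?_
  rw [map_mul, Complex.conj_ofReal, sub_mul, e_sub]
  ring

lemma norm_sum_e_neg {ι : Type*} (T : Finset ι) (w φ : ι → ℝ) (h : ℤ) :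
    ‖∑ n ∈ T, (w n : ℂ) * e ((-h : ℤ) * φ n)‖ = ‖∑ n ∈ T, (w n : ℂ) * e (h * φ n)‖ := by
  rw [← Complex.norm_conj, map_sum]
  congr 1
  refine Finset.sum_congr rfl fun n _ => ?_
  rw [map_mul, Complex.conj_ofReal, conj_e]
  congr 2
  push_cast
  ring

/-- Use |c s c s'| ≤ (c s² + c s'²)/2; for fixed s each value of |s - s'| occurs at most twice. -/
lemma sum_offdiag_le (M : ℕ) (c : ℕ → ℝ) (T : ℕ → ℝ) (hT : ∀ h, 0 ≤ T h) :
    ∑ s ∈ Finset.range M, ∑ s' ∈ (Finset.range M).erase s,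
      |c s * c s'| * T (((s : ℤ) - (s' : ℤ)).natAbs)
      ≤ 2 * (∑ s ∈ Finset.range M, c s ^ 2) * ∑ h ∈ Finset.Icc 1 M, T h := by
  have hE : 0 ≤ ∑ h ∈ Finset.Icc 1 M, T h := Finset.sum_nonneg fun h _ => hT h
  have h0 : ∀ s ∈ Finset.range M, ∑ s' ∈ (Finset.range M).erase s,
      T (((s : ℤ) - (s' : ℤ)).natAbs) ≤ 2 * ∑ h ∈ Finset.Icc 1 M, T h := by
    intro s hs
    rw [Finset.mem_range] at hs
    have h1 : (Finset.range M).erase s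
        = (Finset.range s) ∪ (Finset.Ico (s + 1) M) := by
      ext i
      simp only [Finset.mem_erase, Finset.mem_range, Finset.mem_union, Finset.mem_Ico]
      omega
    rw [h1, Finset.sum_union, two_mul]
    · refine add_le_add ?_ ?_
      · have h2 : ∑ i ∈ Finset.range s, T (((s : ℤ) - (i : ℤ)).natAbs)
            = ∑ h ∈ (Finset.range s).image (fun i => s - i), T h := by
          rw [Finset.sum_image]
          · refine Finset.sum_congr rfl fun i hi => ?_
            rw [Finset.mem_range] at hi
            congr 1
            omega
          · intro a ha b hb hab
            simp only [Finset.coe_range, Set.mem_Iio] at ha hb hab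
            omega
        rw [h2]
        refine Finset.sum_le_sum_of_subset_of_nonneg ?_ fun h _ _ => hT h
        intro h hh
        rw [Finset.mem_image] at hh
        obtain ⟨i, hi, rfl⟩ := hh
        rw [Finset.mem_range] at hi
        rw [Finset.mem_Icc]
        omega
      · have h2 : ∑ i ∈ Finset.Ico (s + 1) M, T (((s : ℤ) - (i : ℤ)).natAbs)
            = ∑ h ∈ (Finset.Ico (s + 1) M).image (fun i => i - s), T h := by
          rw [Finset.sum_image]
          · refine Finset.sum_congr rfl fun i hi => ?_
            rw [Finset.mem_Ico] at hi
            congr 1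
            omega
          · intro a ha b hb hab
            simp only [Finset.coe_Ico, Set.mem_Ico] at ha hb hab
            omega
        rw [h2]
        refine Finset.sum_le_sum_of_subset_of_nonneg ?_ fun h _ _ => hT h
        intro h hh
        rw [Finset.mem_image] at hh
        obtain ⟨i, hi, rfl⟩ := hh
        rw [Finset.mem_Ico] at hi
        rw [Finset.mem_Icc]
        omega
    · rw [Finset.disjoint_left]
      intro i hi hi'
      rw [Finset.mem_range] at hi
      rw [Finset.mem_Ico] at hi'
      omega
  have hsplit : ∑ s ∈ Finset.range M, ∑ s' ∈ (Finset.range M).erase s,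
      |c s * c s'| * T (((s : ℤ) - (s' : ℤ)).natAbs)
      ≤ ∑ s ∈ Finset.range M, ∑ s' ∈ (Finset.range M).erase s,
        (c s ^ 2 / 2 * T (((s : ℤ) - (s' : ℤ)).natAbs)
          + c s' ^ 2 / 2 * T (((s' : ℤ) - (s : ℤ)).natAbs)) := by
    refine Finset.sum_le_sum fun s _ => Finset.sum_le_sum fun s' _ => ?_
    have h3 : ((s' : ℤ) - (s : ℤ)).natAbs = ((s : ℤ) - (s' : ℤ)).natAbs := by omega
    rw [h3, ← add_mul]
    refine mul_le_mul_of_nonneg_right ?_ (hT _)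
    rw [abs_mul]
    nlinarith [sq_nonneg (|c s| - |c s'|), sq_abs (c s), sq_abs (c s')]
  have hswap : ∑ s ∈ Finset.range M, ∑ s' ∈ (Finset.range M).erase s,
      c s' ^ 2 / 2 * T (((s' : ℤ) - (s : ℤ)).natAbs)
      = ∑ s ∈ Finset.range M, ∑ s' ∈ (Finset.range M).erase s,
        c s ^ 2 / 2 * T (((s : ℤ) - (s' : ℤ)).natAbs) := by
    rw [Finset.sum_comm']
    intro a b
    simp only [Finset.mem_erase, Finset.mem_range]
    tauto
  refine hsplit.trans ?_
  simp only [Finset.sum_add_distrib]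
  rw [hswap, ← two_mul, Finset.mul_sum]
  simp only [← Finset.mul_sum]
  calc 2 * ∑ s ∈ Finset.range M, c s ^ 2 / 2 *
        ∑ s' ∈ (Finset.range M).erase s, T (((s : ℤ) - (s' : ℤ)).natAbs)
      ≤ 2 * ∑ s ∈ Finset.range M, c s ^ 2 / 2 * (2 * ∑ h ∈ Finset.Icc 1 M, T h) := by
        refine mul_le_mul_of_nonneg_left ?_ (by norm_num)
        exact Finset.sum_le_sum fun s hs => mul_le_mul_of_nonneg_left (h0 s hs) (by positivity)
    _ = 2 * (∑ s ∈ Finset.range M, c s ^ 2) * ∑ h ∈ Finset.Icc 1 M, T h := by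
        rw [← Finset.sum_mul, ← Finset.sum_div]
        ring

/-- A lower bound for the weighted mean square of a trigonometric polynomial along a sequence,
in terms of the exponential sums attached to this sequence. -/
lemma diagonal_le {ι : Type*} (X : Finset ι) (w φ : ι → ℝ) (M : ℕ) (c : ℕ → ℝ) :
    (∑ s ∈ Finset.range M, c s ^ 2) * ∑ n ∈ X, w n
      ≤ ∑ n ∈ X, w n * ‖∑ s ∈ Finset.range M, (c s : ℂ) * e (s * φ n)‖ ^ 2
        + 2 * (∑ s ∈ Finset.range M, c s ^ 2) *
          ∑ h ∈ Finset.Icc 1 M, ‖∑ n ∈ X, (w n : ℂ) * e (h * φ n)‖ := by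
  set S : ℤ → ℂ := fun h => ∑ n ∈ X, (w n : ℂ) * e (h * φ n) with hS
  have hSabs : ∀ h : ℤ, ‖S h‖ = ‖S (h.natAbs : ℤ)‖ := by
    intro h
    rcases Int.natAbs_eq h with h1 | h1
    · rw [← h1]
    · conv_lhs => rw [h1]
      exact norm_sum_e_neg X w φ _
  have h1 : ((∑ n ∈ X, w n * ‖∑ s ∈ Finset.range M, (c s : ℂ) * e (s * φ n)‖ ^ 2 : ℝ) : ℂ)
      = ∑ s ∈ Finset.range M, ∑ s' ∈ Finset.range M,
        ((c s * c s' : ℝ) : ℂ) * S ((s : ℤ) - (s' : ℤ)) := by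
    rw [Complex.ofReal_sum]
    simp only [Complex.ofReal_mul, norm_sq_trigonometric, Finset.mul_sum, hS]
    rw [Finset.sum_comm]
    refine Finset.sum_congr rfl fun s _ => ?_
    rw [Finset.sum_comm]
    refine Finset.sum_congr rfl fun s' _ => Finset.sum_congr rfl fun n _ => ?_
    ring
  have h2 : ∑ s ∈ Finset.range M, ∑ s' ∈ Finset.range M,
        ((c s * c s' : ℝ) : ℂ) * S ((s : ℤ) - (s' : ℤ))
      = (((∑ s ∈ Finset.range M, c s ^ 2) * ∑ n ∈ X, w n : ℝ) : ℂ)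
        + ∑ s ∈ Finset.range M, ∑ s' ∈ (Finset.range M).erase s,
          ((c s * c s' : ℝ) : ℂ) * S ((s : ℤ) - (s' : ℤ)) := by
    have h3 : S 0 = ((∑ n ∈ X, w n : ℝ) : ℂ) := by
      simp [hS, e_zero]
    rw [Complex.ofReal_mul, ← h3, Complex.ofReal_sum, Finset.sum_mul, ← Finset.sum_add_distrib]
    refine Finset.sum_congr rfl fun s hs => ?_
    rw [← Finset.add_sum_erase _ _ hs, sub_self, sq]
  have h4 : (∑ s ∈ Finset.range M, c s ^ 2) * ∑ n ∈ X, w n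
      = ∑ n ∈ X, w n * ‖∑ s ∈ Finset.range M, (c s : ℂ) * e (s * φ n)‖ ^ 2
        - (∑ s ∈ Finset.range M, ∑ s' ∈ (Finset.range M).erase s,
          ((c s * c s' : ℝ) : ℂ) * S ((s : ℤ) - (s' : ℤ))).re := by
    have h5 := congrArg Complex.re (h1.trans h2)
    rw [Complex.add_re, Complex.ofReal_re, Complex.ofReal_re] at h5
    linarith
  rw [h4]
  have h6 : ‖∑ s ∈ Finset.range M, ∑ s' ∈ (Finset.range M).erase s,
          ((c s * c s' : ℝ) : ℂ) * S ((s : ℤ) - (s' : ℤ))‖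
      ≤ 2 * (∑ s ∈ Finset.range M, c s ^ 2) *
          ∑ h ∈ Finset.Icc 1 M, ‖∑ n ∈ X, (w n : ℂ) * e (h * φ n)‖ := by
    have h7 := sum_offdiag_le M c (fun h => ‖S (h : ℤ)‖) (fun _ => norm_nonneg _)
    refine le_trans ?_ (h7.trans (le_of_eq ?_))
    · refine (norm_sum_le _ _).trans (Finset.sum_le_sum fun s _ => (norm_sum_le _ _).trans
        (Finset.sum_le_sum fun s' _ => ?_))
      rw [norm_mul, Complex.norm_real, hSabs, Real.norm_eq_abs]
    · simp [hS]
  have h8 := (abs_le.mp (Complex.abs_re_le_norm (∑ s ∈ Finset.range M,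
    ∑ s' ∈ (Finset.range M).erase s, ((c s * c s' : ℝ) : ℂ) * S ((s : ℤ) - (s' : ℤ))))).1
  linarith

/-- The coefficients of `(1 + X + ⋯ + X ^ (D - 1)) ^ r`. -/
noncomputable def kernelCoeff (D r s : ℕ) : ℝ :=
  ((∑ i ∈ Finset.range D, (X : ℝ[X]) ^ i) ^ r).coeff s

lemma natDegree_kernel_lt {D r : ℕ} (hD : 1 ≤ D) (hr : 1 ≤ r) :
    ((∑ i ∈ Finset.range D, (X : ℝ[X]) ^ i) ^ r).natDegree < r * D := by
  have h1 : (∑ i ∈ Finset.range D, (X : ℝ[X]) ^ i).natDegree ≤ D - 1 := by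
    refine natDegree_sum_le_of_forall_le _ _ fun i hi => ?_
    rw [Finset.mem_range] at hi
    rw [natDegree_X_pow]
    omega
  calc ((∑ i ∈ Finset.range D, (X : ℝ[X]) ^ i) ^ r).natDegree ≤ r * (D - 1) :=
        natDegree_pow_le_of_le r h1
    _ < r * D := by
        refine Nat.mul_lt_mul_of_pos_left ?_ ?_ <;> omega

lemma sum_kernelCoeff_mul_e {D r : ℕ} (hD : 1 ≤ D) (hr : 1 ≤ r) (t : ℝ) :
    ∑ s ∈ Finset.range (r * D), (kernelCoeff D r s : ℂ) * e (s * t)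
      = (∑ i ∈ Finset.range D, e (i * t)) ^ r := by
  have h1 := aeval_eq_sum_range' (natDegree_kernel_lt hD hr) (e t)
  rw [map_pow, map_sum] at h1
  simp only [map_pow, aeval_X] at h1
  simp only [e_nat_mul]
  rw [h1]
  refine Finset.sum_congr rfl fun s _ => ?_
  rw [kernelCoeff, Complex.real_smul]

lemma sum_kernelCoeff {D r : ℕ} (hD : 1 ≤ D) (hr : 1 ≤ r) :
    ∑ s ∈ Finset.range (r * D), kernelCoeff D r s = (D : ℝ) ^ r := by
  have h1 := eval_eq_sum_range' (natDegree_kernel_lt hD hr) 1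
  simp only [eval_pow, eval_finsetSum, eval_X, one_pow, mul_one, Finset.sum_const,
    Finset.card_range, nsmul_eq_mul] at h1
  exact h1.symm

/-- Cauchy–Schwarz: the coefficients sum to D^r, the value of the kernel at 1, and there are rD of
them. -/
lemma pow_le_sum_kernelCoeff_sq {D r : ℕ} (hD : 1 ≤ D) (hr : 1 ≤ r) :
    (D : ℝ) ^ (2 * r) ≤ r * D * ∑ s ∈ Finset.range (r * D), kernelCoeff D r s ^ 2 := by
  have h1 := sq_sum_le_card_mul_sum_sq (s := Finset.range (r * D)) (f := kernelCoeff D r)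
  rw [sum_kernelCoeff hD hr, Finset.card_range] at h1
  push_cast at h1
  rw [mul_comm 2 r, pow_mul]
  exact h1

lemma norm_sum_range_e_mul_nd_le (D : ℕ) (t : ℝ) :
    ‖∑ i ∈ Finset.range D, e (i * t)‖ * (2 * nd t) ≤ 1 := by
  have h1 : (∑ i ∈ Finset.range D, e (i * t)) * (e t - 1) = e t ^ D - 1 := by
    simp only [e_nat_mul]
    exact geom_sum_mul (e t) D
  have h2 : ‖∑ i ∈ Finset.range D, e (i * t)‖ * ‖e t - 1‖ ≤ 2 := by
    rw [← norm_mul, h1]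
    refine (norm_sub_le _ _).trans ?_
    rw [norm_pow, norm_e, norm_one, one_pow]
    norm_num
  have h3 := mul_le_mul_of_nonneg_left (four_mul_nd_le_norm_e_sub_one t)
    (norm_nonneg (∑ i ∈ Finset.range D, e (i * t)))
  linarith

lemma norm_sum_range_e_le (D : ℕ) (t : ℝ) : ‖∑ i ∈ Finset.range D, e (i * t)‖ ≤ D := by
  refine (norm_sum_le _ _).trans ?_
  simp [norm_e]

/-- If the exponential sums attached to a weighted sequence are small, then the sequence has a
large part near the integers. -/
lemma weight_le_of_far {ι : Type*} [DecidableEq ι] (X Y : Finset ι) (hY : Y ⊆ X) (w φ : ι → ℝ)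
    (hw : ∀ n, 0 ≤ w n) {D r : ℕ} {α : ℝ} (hα : 1 ≤ α) (hD : 1 ≤ D) (hr : 1 ≤ r)
    (hDα : 4 * r * D * α ^ (2 * r) ≤ (D : ℝ) ^ (2 * r))
    (hfar : ∀ n ∈ X \ Y, 1 / (2 * α) ≤ nd (φ n)) :
    3 / 4 * ∑ n ∈ X, w n ≤ r * D * ∑ n ∈ Y, w n
      + 2 * ∑ h ∈ Finset.Icc 1 (r * D), ‖∑ n ∈ X, (w n : ℂ) * e (h * φ n)‖ := by
  have h1 := diagonal_le X w φ (r * D) (kernelCoeff D r)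
  have h2 := pow_le_sum_kernelCoeff_sq hD hr
  set A := ∑ s ∈ Finset.range (r * D), kernelCoeff D r s ^ 2 with hA
  set E := ∑ h ∈ Finset.Icc 1 (r * D), ‖∑ n ∈ X, (w n : ℂ) * e (h * φ n)‖
  have hr0 : (1 : ℝ) ≤ r := by exact_mod_cast hr
  have hD0 : (1 : ℝ) ≤ D := by exact_mod_cast hD
  have hAα : 4 * α ^ (2 * r) ≤ A := by
    have h3 : (r * D : ℝ) * (4 * α ^ (2 * r)) ≤ r * D * A := by
      refine le_trans (le_of_eq ?_) (hDα.trans h2)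
      ring
    exact le_of_mul_le_mul_left h3 (by positivity)
  have hA0 : 0 < A := lt_of_lt_of_le (by positivity) hAα
  have hW0 : 0 ≤ ∑ n ∈ X, w n := Finset.sum_nonneg fun n _ => hw n
  have hWY : 0 ≤ ∑ n ∈ Y, w n := Finset.sum_nonneg fun n _ => hw n
  -- Away from the integers the geometric sum is at most α, so the kernel is at most α^(2r) ≤ A/4;
  -- on Y its peak value D^(2r) is at most rDA.
  have h4 : ∑ n ∈ X, w n * ‖∑ s ∈ Finset.range (r * D), (kernelCoeff D r s : ℂ) * e (s * φ n)‖ ^ 2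
      ≤ A / 4 * ∑ n ∈ X, w n + r * D * A * ∑ n ∈ Y, w n := by
    simp only [sum_kernelCoeff_mul_e hD hr, norm_pow, ← pow_mul, mul_comm r 2]
    rw [← Finset.sum_sdiff hY]
    refine add_le_add ?_ ?_
    · calc ∑ n ∈ X \ Y, w n * ‖∑ i ∈ Finset.range D, e (i * φ n)‖ ^ (2 * r)
          ≤ ∑ n ∈ X \ Y, w n * (A / 4) := by
            refine Finset.sum_le_sum fun n hn => mul_le_mul_of_nonneg_left ?_ (hw n)
            have h5 := norm_sum_range_e_mul_nd_le D (φ n)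
            have h6 := hfar n hn
            have h7 : ‖∑ i ∈ Finset.range D, e (i * φ n)‖ ≤ α := by
              have h8 : ‖∑ i ∈ Finset.range D, e (i * φ n)‖ * (2 * (1 / (2 * α))) ≤ 1 :=
                le_trans (by gcongr) h5
              have h9 : 2 * (1 / (2 * α)) = 1 / α := by
                field_simp
              rw [h9, mul_one_div, div_le_one (by linarith)] at h8
              exact h8
            calc ‖∑ i ∈ Finset.range D, e (i * φ n)‖ ^ (2 * r) ≤ α ^ (2 * r) := by gcongr
              _ ≤ A / 4 := by linarith
        _ = A / 4 * ∑ n ∈ X \ Y, w n := by rw [← Finset.sum_mul, mul_comm]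
        _ ≤ A / 4 * ∑ n ∈ X, w n := by
            refine mul_le_mul_of_nonneg_left ?_ (by positivity)
            exact Finset.sum_le_sum_of_subset_of_nonneg Finset.sdiff_subset fun n _ _ => hw n
    · rw [Finset.mul_sum]
      refine Finset.sum_le_sum fun n _ => ?_
      rw [mul_comm]
      refine mul_le_mul_of_nonneg_right (le_trans ?_ h2) (hw n)
      have := norm_sum_range_e_le D (φ n)
      gcongr
  have h5 : A * (3 / 4 * ∑ n ∈ X, w n) ≤ A * (r * D * ∑ n ∈ Y, w n + 2 * E) := by
    nlinarith
  exact le_of_mul_le_mul_left h5 hA0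

open Chebyshev in
-- Chebyshev's lower bound has the constant log 2 > 1/2, and the surplus absorbs the logarithmic
-- error.
lemma half_le_psi {x : ℕ} (hx : 1 ≤ x) (h : 64 * (1 + Real.log x) ≤ x) :
    (x : ℝ) / 2 ≤ psi x := by
  have h1 := psi_ge x
  have hx0 : (1 : ℝ) ≤ x := by exact_mod_cast hx
  have h2 : Real.log (x + 1) ≤ 1 + Real.log x := by
    calc Real.log (x + 1) ≤ Real.log (2 * x) := by
          gcongr
          linarith
      _ = Real.log 2 + Real.log x := Real.log_mul (by norm_num) (by positivity)
      _ ≤ 1 + Real.log x := by linarith [Real.log_two_lt_d9]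
  nlinarith [Real.log_two_gt_d9]

open ArithmeticFunction Chebyshev in
-- Proper prime powers contribute ψ(x) - θ(x), and small primes contribute θ(√x). Removing primes up
-- to √x is harmless here and later guarantees that the prime found is large.
lemma sum_exceptional_le {x : ℕ} (hx : 1 ≤ x) :
    ∑ n ∈ (Finset.Icc 1 x).filter (fun n => ¬ (n.Prime ∧ x < n ^ 2)), vonMangoldt n
      ≤ 2 * (Real.sqrt x * (1 + Real.log x)) := by
  classical
  have hx0 : (1 : ℝ) ≤ x := by exact_mod_cast hx
  have h1 : (Finset.Icc 1 x).filter (fun n => ¬ (n.Prime ∧ x < n ^ 2))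
      ⊆ (Finset.Ioc 0 ⌊(x : ℝ)⌋₊).filter (fun n => ¬ n.Prime)
        ∪ (Finset.Ioc 0 ⌊Real.sqrt x⌋₊).filter Nat.Prime := by
    intro n hn
    rw [Finset.mem_filter, Finset.mem_Icc] at hn
    rw [Finset.mem_union, Finset.mem_filter, Finset.mem_filter, Finset.mem_Ioc, Finset.mem_Ioc,
      Nat.floor_natCast]
    by_cases hp : n.Prime
    · right
      refine ⟨⟨by omega, Nat.le_floor ?_⟩, hp⟩
      have h2 : n ^ 2 ≤ x := by
        by_contra h3
        exact hn.2 ⟨hp, by omega⟩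
      refine Real.le_sqrt_of_sq_le ?_
      exact_mod_cast h2
    · left
      exact ⟨⟨by omega, hn.1.2⟩, hp⟩
  have h2 : ∑ n ∈ (Finset.Ioc 0 ⌊Real.sqrt x⌋₊).filter Nat.Prime, vonMangoldt n
      = theta (Real.sqrt x) := by
    rw [theta]
    refine Finset.sum_congr rfl fun n hn => ?_
    rw [Finset.mem_filter] at hn
    exact vonMangoldt_apply_prime hn.2
  refine (Finset.sum_le_sum_of_subset_of_nonneg h1 fun n _ _ => vonMangoldt_nonneg).trans ?_
  refine (Finset.sum_union_inter (f := fun n => vonMangoldt n) ▸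
    le_add_of_nonneg_right (Finset.sum_nonneg fun n _ => vonMangoldt_nonneg)).trans ?_
  rw [← psi_sub_theta_eq_sum_not_prime, h2]
  have h3 := psi_sub_theta_le hx0
  have h4 := theta_le_log4_mul_x (Real.sqrt_nonneg (x : ℝ))
  have h5 : Real.log 4 ≤ 2 := by
    have : Real.log 4 = 2 * Real.log 2 := by
      rw [show (4 : ℝ) = 2 ^ 2 by norm_num, Real.log_pow]
      norm_num
    linarith [Real.log_two_lt_d9]
  nlinarith [Real.sqrt_nonneg (x : ℝ)]

open ArithmeticFunction in
/-- If the exponential sums over primes attached to `φ` are small, then `φ p` is close to an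
integer for some prime `p`. -/
theorem exists_prime_nd_lt {x D r : ℕ} {α : ℝ} (φ : ℕ → ℝ) (hx : 1 ≤ x) (hα : 1 ≤ α)
    (hD : 1 ≤ D) (hr : 1 ≤ r) (hDα : 4 * r * D * α ^ (2 * r) ≤ (D : ℝ) ^ (2 * r))
    (hxD : 64 * (r * D) * (Real.sqrt x * (1 + Real.log x)) ≤ x)
    (hE : 32 * ∑ h ∈ Finset.Icc 1 (r * D),
      ‖∑ n ∈ Finset.Icc 1 x, (vonMangoldt n : ℂ) * e (h * φ n)‖ ≤ x) :
    ∃ p : ℕ, p.Prime ∧ p ≤ x ∧ x < p ^ 2 ∧ nd (φ p) < 1 / (2 * α) := by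
  by_contra hno
  push Not at hno
  have hx0 : (1 : ℝ) ≤ x := by exact_mod_cast hx
  have hr0 : (1 : ℝ) ≤ r := by exact_mod_cast hr
  have hD0 : (1 : ℝ) ≤ D := by exact_mod_cast hD
  have hlog : 0 ≤ Real.log x := Real.log_nonneg hx0
  have hs1 : 1 ≤ Real.sqrt x := Real.one_le_sqrt.mpr hx0
  have hrD : (1 : ℝ) ≤ r * D := one_le_mul_of_one_le_of_one_le hr0 hD0
  have h1 := weight_le_of_far (Finset.Icc 1 x)
    ((Finset.Icc 1 x).filter (fun n => ¬ (n.Prime ∧ x < n ^ 2))) (Finset.filter_subset _ _)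
    (fun n => vonMangoldt n) φ (fun n => vonMangoldt_nonneg) hα hD hr hDα (fun n hn => by
      rw [Finset.mem_sdiff, Finset.mem_filter] at hn
      have h2 : n.Prime ∧ x < n ^ 2 := by
        by_contra h3
        exact hn.2 ⟨hn.1, h3⟩
      rw [Finset.mem_Icc] at hn
      exact hno n h2.1 hn.1.2 h2.2)
  have h2 := sum_exceptional_le hx
  have h3 : 64 * (1 + Real.log x) ≤ x := by
    refine le_trans ?_ hxD
    have : 1 ≤ (r * D : ℝ) * Real.sqrt x := one_le_mul_of_one_le_of_one_le hrD hs1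
    nlinarith
  have h4 := half_le_psi hx h3
  have h5 : Chebyshev.psi x = ∑ n ∈ Finset.Icc 1 x, vonMangoldt n := by
    rw [Chebyshev.psi, Nat.floor_natCast]
    rfl
  rw [h5] at h4
  -- If every prime in (√x, x] were far, then 3/4 · x/2 ≤ x/32 + 2 · x/32, which is absurd.
  have h6 := mul_le_mul_of_nonneg_left h2 (by linarith : (0 : ℝ) ≤ r * D)
  nlinarith

/-! ### Divisor bounds and the choice of parameters. -/

lemma succ_pow_le (a : ℕ) {s : ℕ} (hs : 1 ≤ s) : (a + 1) ^ s ≤ 2 * s ^ s * 2 ^ a := by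
  have h1 : a + 1 ≤ s * 2 ^ ((a + 1) / s) := by
    have h2 := Nat.lt_mul_div_succ (a + 1) hs
    have h3 : (a + 1) / s + 1 ≤ 2 ^ ((a + 1) / s) := Nat.lt_two_pow_self
    exact h2.le.trans (Nat.mul_le_mul_left s h3)
  calc (a + 1) ^ s ≤ (s * 2 ^ ((a + 1) / s)) ^ s := Nat.pow_le_pow_left h1 s
    _ = s ^ s * 2 ^ ((a + 1) / s * s) := by rw [mul_pow, ← pow_mul]
    _ ≤ s ^ s * 2 ^ (a + 1) := by
        gcongr
        · norm_num
        · exact Nat.div_mul_le_self _ _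
    _ = 2 * s ^ s * 2 ^ a := by ring

/-- A bound for the powers of the divisor function. -/
lemma card_divisors_pow_le {v s : ℕ} (hv : v ≠ 0) (hs : 1 ≤ s) :
    v.divisors.card ^ s ≤ (2 * s ^ s) ^ 2 ^ s * v := by
  have hC : 1 ≤ 2 * s ^ s := by
    have : 0 < s ^ s := Nat.pow_pos hs
    omega
  rw [Nat.card_divisors hv, ← Finset.prod_pow]
  -- Primes p ≥ 2^s need no constant, since (a + 1)^s ≤ 2^(as) ≤ p^a; each of the fewer than 2^s
  -- smaller primes costs 2s^s.
  have h1 : ∀ p ∈ v.primeFactors, (v.factorization p + 1) ^ s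
      ≤ (if p < 2 ^ s then 2 * s ^ s else 1) * p ^ v.factorization p := by
    intro p hp
    have hp2 : 2 ≤ p := (Nat.prime_of_mem_primeFactors hp).two_le
    split_ifs with h
    · refine (succ_pow_le _ hs).trans ?_
      gcongr
    · rw [one_mul]
      calc (v.factorization p + 1) ^ s ≤ (2 ^ v.factorization p) ^ s := by
            gcongr
            exact Nat.lt_two_pow_self
        _ = (2 ^ s) ^ v.factorization p := by rw [← pow_mul, ← pow_mul, mul_comm]
        _ ≤ p ^ v.factorization p := by
            gcongr
            omega
  refine (Finset.prod_le_prod' h1).trans ?_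
  rw [Finset.prod_mul_distrib]
  refine Nat.mul_le_mul ?_ (le_of_eq (Nat.prod_factorization_pow_eq_self hv))
  rw [← Finset.prod_filter, Finset.prod_const]
  refine Nat.pow_le_pow_right hC ?_
  calc (v.primeFactors.filter fun p => p < 2 ^ s).card ≤ (Finset.range (2 ^ s)).card :=
        Finset.card_le_card fun p hp => by
          rw [Finset.mem_filter] at hp
          exact Finset.mem_range.mpr hp.2
    _ = 2 ^ s := Finset.card_range _

/-- The constant in the bound for the divisor function used in `exists_prime_of_approx`. -/
def divConst (j t : ℕ) : ℕ :=
  2 ^ ((2 * j + 2) * t) * (2 * ((2 * j + 2) * t) ^ ((2 * j + 2) * t)) ^ 2 ^ ((2 * j + 2) * t) *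
    ((j + 1).factorial ^ 2 * (j + 2) * 2 ^ (j + 2))

lemma one_le_divConst (j : ℕ) {t : ℕ} (ht : 1 ≤ t) : 1 ≤ divConst j t := by
  have h1 : 0 < (2 * j + 2) * t := by positivity
  have h2 : 0 < ((2 * j + 2) * t) ^ ((2 * j + 2) * t) := Nat.pow_pos h1
  have h3 := Nat.factorial_pos (j + 1)
  have h4 : 0 < divConst j t := by
    unfold divConst
    positivity
  exact h4

/-- The divisor bound is used for the t-th power of the desired quantity, so R only has to be about
x^((j+2)/t), an arbitrarily small power of x. -/
lemma two_mul_card_divisors_pow_le {j t x R : ℕ} (ht : 1 ≤ t)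
    (hR : divConst j t * x ^ (j + 2) ≤ R ^ t) :
    ∀ v ∈ Finset.Icc 1 (divisorRange j x), (2 * v.divisors.card) ^ (2 * j + 2) ≤ R := by
  intro v hv
  rw [Finset.mem_Icc] at hv
  have h1 : 1 ≤ (2 * j + 2) * t := Nat.mul_pos (by omega) ht
  have h2 := card_divisors_pow_le (v := v) (by omega) h1
  refine (Nat.pow_le_pow_iff_left (n := t) (by omega)).mp ?_
  rw [← pow_mul, mul_pow]
  refine le_trans ?_ hR
  calc 2 ^ ((2 * j + 2) * t) * v.divisors.card ^ ((2 * j + 2) * t)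
      ≤ 2 ^ ((2 * j + 2) * t) *
        ((2 * ((2 * j + 2) * t) ^ ((2 * j + 2) * t)) ^ 2 ^ ((2 * j + 2) * t) *
          divisorRange j x) := by
        gcongr
        exact h2.trans (Nat.mul_le_mul_left _ hv.2)
    _ = divConst j t * x ^ (j + 2) := by
        rw [divConst, divisorRange]
        ring

/-- The parameter in the bound for the divisor function. -/
def divExp (j w : ℕ) : ℕ := 32 * w * (2 ^ j * 2 ^ j) * (j + 2)

/-- The lower bound for the size parameter in `exists_prime_of_approx`. -/
def sizeConst (j w : ℕ) : ℕ :=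
  640 * expConst j * divConst j (divExp j w) * (1 + 32 * w * (2 ^ j * 2 ^ j)) ^ 3 *
    (2 * w + 1) ^ 2

lemma one_le_expConst (j : ℕ) : 1 ≤ expConst j := by
  unfold expConst
  omega

/-- A prime `p` with `f(p)` close to an integer exists as soon as the denominator of a rational
approximation to the leading coefficient of `f` and the length of the interval are large. -/
theorem exists_prime_of_approx {j w : ℕ} (hj : 1 ≤ j) (hw : 1 ≤ w) {f : ℝ[X]}
    (hf : f.natDegree ≤ j + 1) {a : ℤ} {q x : ℕ} {α δ T : ℝ} (hq : 1 ≤ q)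
    (hco : IsCoprime a (q : ℤ)) (happ : |f.coeff (j + 1) - a / q| ≤ 1 / (q : ℝ) ^ 2)
    (hα : 1 ≤ α) (hαq : α ≤ q) (hT : sizeConst j w ≤ T) (hqT : (q : ℝ) = T ^ (8 * w))
    (hx : 1 ≤ x) (hxT : (x : ℝ) ≤ T ^ (32 * w * (2 ^ j * 2 ^ j))) (hδ : 0 < δ) (hδ1 : δ ≤ 1)
    (hαδ : α * δ * T ^ 8 ≤ 2) (hqδ : 1 ≤ q * δ ^ (2 ^ j * 2 ^ j))
    (hxδ : 1 ≤ x * (δ ^ (2 ^ j * 2 ^ j)) ^ 2) (hqx : q ≤ x ^ (j + 1) * δ ^ (2 ^ j * 2 ^ j)) :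
    ∃ p : ℕ, p.Prime ∧ p ≤ x ∧ x < p ^ 2 ∧ nd (f.eval (p : ℝ)) < 1 / (2 * α) := by
  obtain ⟨G, hG⟩ : ∃ G, G = 2 ^ j * 2 ^ j := ⟨_, rfl⟩
  rw [← hG] at hxT hqδ hxδ hqx
  have hG1 : 1 ≤ G := hG ▸ Nat.mul_pos (by positivity) (by positivity)
  obtain ⟨t, ht⟩ : ∃ t, t = divExp j w := ⟨_, rfl⟩
  have ht1 : 1 ≤ t := by
    rw [ht, divExp]
    exact Nat.mul_pos (Nat.mul_pos (by omega) (by positivity)) (by omega)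
  have hV1 := one_le_divConst j ht1
  have hE1 := one_le_expConst j
  obtain ⟨V, hV⟩ : ∃ V, V = divConst j t := ⟨_, rfl⟩
  obtain ⟨c, hc⟩ : ∃ c, c = 1 + 32 * w * G := ⟨_, rfl⟩
  obtain ⟨r, hr⟩ : ∃ r, r = 2 * w + 1 := ⟨_, rfl⟩
  obtain ⟨Ce, hCe⟩ : ∃ Ce, Ce = expConst j := ⟨_, rfl⟩
  rw [← hV] at hV1
  rw [← hCe] at hE1
  have hsize : (sizeConst j w : ℝ) = 640 * Ce * V * c ^ 3 * r ^ 2 := by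
    rw [hCe, hV, hc, hr, ht, sizeConst, hG]
    push_cast
    ring
  rw [hsize] at hT
  have hV0 : (1 : ℝ) ≤ V := by exact_mod_cast hV1
  have hCe0 : (1 : ℝ) ≤ Ce := by exact_mod_cast hE1
  have hc0 : (1 : ℝ) ≤ c := by
    exact_mod_cast (by omega : 1 ≤ c)
  have hr0 : (1 : ℝ) ≤ r := by exact_mod_cast (by omega : 1 ≤ r)
  have hx0 : (1 : ℝ) ≤ x := by exact_mod_cast hx
  have hT640 : 640 * c * r ^ 2 ≤ T := by
    refine le_trans ?_ hT
    have h1 : 1 ≤ (Ce * V : ℝ) := one_le_mul_of_one_le_of_one_le hCe0 hV0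
    calc (640 * c * r ^ 2 : ℝ) = 640 * 1 * c ^ 1 * r ^ 2 := by ring
      _ ≤ 640 * (Ce * V) * c ^ 3 * r ^ 2 := by
          gcongr
          norm_num
      _ = _ := by ring
  have hT1 : 1 ≤ T := by
    refine le_trans ?_ hT640
    have h1 : (1 : ℝ) ≤ c * r ^ 2 := one_le_mul_of_one_le_of_one_le hc0 (one_le_pow₀ hr0)
    linarith
  have hT0 : 0 < T := by linarith
  -- choice of the parameters
  obtain ⟨D, hD⟩ : ∃ D, D = ⌈4 * r * α * T ^ 2⌉₊ := ⟨_, rfl⟩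
  have hDlow : 4 * r * α * T ^ 2 ≤ D := hD ▸ Nat.le_ceil _
  have hrαT : 1 ≤ r * α * T ^ 2 :=
    one_le_mul_of_one_le_of_one_le (one_le_mul_of_one_le_of_one_le hr0 hα) (one_le_pow₀ hT1)
  have hDup : (D : ℝ) ≤ 5 * r * α * T ^ 2 := by
    have h1 := (Nat.ceil_lt_add_one (by positivity : 0 ≤ 4 * r * α * T ^ 2)).le
    rw [← hD] at h1
    linarith
  have hD1 : 1 ≤ D := by
    have h1 : (1 : ℝ) ≤ D := by linarith
    exact_mod_cast h1
  obtain ⟨H, hH⟩ : ∃ H, H = r * D := ⟨_, rfl⟩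
  have hH1 : 1 ≤ H := hH ▸ Nat.mul_pos (by omega) hD1
  have hHc : (H : ℝ) = r * D := by
    rw [hH]
    push_cast
    ring
  have hHup : (H : ℝ) ≤ 5 * r ^ 2 * α * T ^ 2 := by
    rw [hHc]
    calc (r * D : ℝ) ≤ r * (5 * r * α * T ^ 2) := by gcongr
      _ = _ := by ring
  obtain ⟨L, hL⟩ : ∃ L, L = c * T := ⟨_, rfl⟩
  have hlogT : Real.log T ≤ T := by linarith [Real.log_le_sub_one_of_pos hT0]
  have hcc : (c : ℝ) = 1 + 32 * w * G := by
    rw [hc]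
    push_cast
    ring
  have hlogx : 1 + Real.log x ≤ L := by
    have h1 : Real.log x ≤ (32 * w * G : ℕ) * Real.log T := by
      rw [← Real.log_pow]
      gcongr
    push_cast at h1
    have h2 : (32 * w * G : ℝ) * Real.log T ≤ 32 * w * G * T := by gcongr
    rw [hL, hcc]
    linarith
  have hw0 : (1 : ℝ) ≤ w := by exact_mod_cast hw
  have hG0 : (1 : ℝ) ≤ G := by exact_mod_cast hG1
  have hlogq : 1 + Real.log q ≤ L := by
    have h1 : Real.log q = (8 * w : ℕ) * Real.log T := by
      rw [hqT, ← Real.log_pow]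
    push_cast at h1
    have h2 : (8 * w : ℝ) * Real.log T ≤ 8 * w * T := by gcongr
    have h3 : (8 * w : ℝ) * T ≤ 32 * w * G * T := by
      refine mul_le_mul_of_nonneg_right ?_ hT0.le
      nlinarith
    rw [hL, hcc, h1]
    linarith
  -- As x ≤ T^(32wG) and t = 32wG(j + 2), one has x^(j+2) ≤ T^t; hence the divisor functions cost a
  -- single factor T.
  obtain ⟨R, hR⟩ : ∃ R, R = ⌈V * T⌉₊ := ⟨_, rfl⟩
  have hVT : 1 ≤ V * T := one_le_mul_of_one_le_of_one_le hV0 hT1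
  have hRlow : V * T ≤ R := hR ▸ Nat.le_ceil _
  have hRup : (R : ℝ) ≤ 2 * V * T := by
    have h1 := (Nat.ceil_lt_add_one (by positivity : 0 ≤ V * T)).le
    rw [← hR] at h1
    linarith
  have hR1 : 1 ≤ R := by
    have h1 : (1 : ℝ) ≤ R := hVT.trans hRlow
    exact_mod_cast h1
  have hRt : divConst j t * x ^ (j + 2) ≤ R ^ t := by
    have h1 : (V * x ^ (j + 2) : ℝ) ≤ R ^ t := by
      calc (V * x ^ (j + 2) : ℝ) ≤ V ^ t * (T ^ (32 * w * G)) ^ (j + 2) := by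
            gcongr
            calc (V : ℝ) = V ^ 1 := (pow_one _).symm
              _ ≤ V ^ t := pow_le_pow_right₀ hV0 ht1
        _ = (V * T) ^ t := by
            rw [mul_pow, ← pow_mul, ht, divExp, ← hG]
        _ ≤ R ^ t := by gcongr
    rw [← hV]
    exact_mod_cast h1
  have hT8 : (α * δ) * T ^ 8 ≤ 2 := hαδ
  have hsx : 1 ≤ Real.sqrt x * δ := by
    have h1 : (1 : ℝ) ≤ x * δ ^ 2 := by
      refine hxδ.trans ?_
      have : δ ^ G ≤ δ := by
        calc δ ^ G ≤ δ ^ 1 := pow_le_pow_of_le_one hδ.le hδ1 hG1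
          _ = δ := pow_one _
      gcongr
    rw [← Real.sqrt_sq hδ.le, ← Real.sqrt_mul (Nat.cast_nonneg _)]
    exact Real.one_le_sqrt.mpr h1
  have hL0 : 0 < L := by rw [hL]; positivity
  have hkey : 64 * H * L * δ ≤ 1 := by
    have h1 : 64 * H * L * δ * T ^ 8 ≤ 1 * T ^ 8 := by
      calc 64 * H * L * δ * T ^ 8 ≤ 64 * (5 * r ^ 2 * α * T ^ 2) * (c * T) * δ * T ^ 8 := by
            rw [← hL]
            gcongr
        _ = 320 * c * r ^ 2 * T ^ 3 * (α * δ * T ^ 8) := by ring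
        _ ≤ 320 * c * r ^ 2 * T ^ 3 * 2 := by gcongr
        _ = (640 * c * r ^ 2) * T ^ 3 := by ring
        _ ≤ T * T ^ 3 := by gcongr
        _ = T ^ 4 := by ring
        _ ≤ T ^ 8 := pow_le_pow_right₀ hT1 (by norm_num)
        _ = 1 * T ^ 8 := (one_mul _).symm
    exact le_of_mul_le_mul_right h1 (by positivity)
  have hs0 : 0 ≤ Real.sqrt x := Real.sqrt_nonneg _
  have hss : Real.sqrt x * Real.sqrt x = x := Real.mul_self_sqrt (Nat.cast_nonneg _)
  have hxD : 64 * (r * D) * (Real.sqrt x * (1 + Real.log x)) ≤ x := by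
    rw [← hHc]
    calc 64 * H * (Real.sqrt x * (1 + Real.log x)) ≤ 64 * H * (Real.sqrt x * L) := by gcongr
      _ = 64 * H * L * Real.sqrt x * 1 := by ring
      _ ≤ 64 * H * L * Real.sqrt x * (Real.sqrt x * δ) := by gcongr
      _ = (64 * H * L * δ) * (Real.sqrt x * Real.sqrt x) := by ring
      _ ≤ 1 * (Real.sqrt x * Real.sqrt x) := by gcongr
      _ = x := by rw [hss, one_mul]
  have hHx : H ≤ x := by
    have h1 : (H : ℝ) ≤ x := by
      refine le_trans ?_ hxD
      rw [← hHc]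
      have h2 : 1 ≤ Real.sqrt x * (1 + Real.log x) :=
        one_le_mul_of_one_le_of_one_le (Real.one_le_sqrt.mpr hx0)
          (by linarith [Real.log_nonneg hx0])
      calc (H : ℝ) = 1 * H * 1 := by ring
        _ ≤ 64 * H * (Real.sqrt x * (1 + Real.log x)) := by
          gcongr
          norm_num
    exact_mod_cast h1
  have hadm : IsAdmissible j f a q x H R δ L :=
    { one_le_j := hj
      natDegree_le := hf
      one_le_q := hq
      coprime := hco
      approx := happ
      one_le_x := hx
      one_le_H := hH1
      H_le_x := hHx
      δ_pos := hδ
      δ_le_one := hδ1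
      one_le_q_mul := by rw [← hG]; exact hqδ
      one_le_x_mul := by rw [← hG]; exact hxδ
      q_le := by rw [← hG]; exact hqx
      log_x_le := hlogx
      log_q_le := hlogq
      one_le_R := hR1
      divisors_le := two_mul_card_divisors_pow_le ht1 hRt }
  refine exists_prime_nd_lt (fun n => f.eval (n : ℝ)) hx hα hD1 (by omega : 1 ≤ r) ?_ hxD ?_
  · have h1 : (r * 2 : ℕ) = 4 * w + 1 + 1 := by omega
    rw [mul_comm 2 r, h1, pow_succ α, pow_succ (D : ℝ)]
    have h2 : 4 * r * (α ^ (4 * w + 1) * α) ≤ (D : ℝ) ^ (4 * w + 1) := by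
      calc 4 * r * (α ^ (4 * w + 1) * α) ≤ (4 * r) * (α ^ (4 * w + 1) * q) := by gcongr
        _ = (4 * r) ^ 1 * α ^ (4 * w + 1) * (T ^ (8 * w)) := by rw [hqT]; ring
        _ ≤ (4 * r) ^ (4 * w + 1) * α ^ (4 * w + 1) * (T ^ (2 * (4 * w + 1))) := by
            refine mul_le_mul (mul_le_mul_of_nonneg_right
              (pow_le_pow_right₀ (by linarith) (by omega)) (by positivity))
              (pow_le_pow_right₀ hT1 (by omega)) (by positivity) (by positivity)
        _ = (4 * r * α * T ^ 2) ^ (4 * w + 1) := by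
            rw [pow_mul, ← mul_pow, ← mul_pow]
        _ ≤ (D : ℝ) ^ (4 * w + 1) := by gcongr
    calc 4 * r * D * (α ^ (4 * w + 1) * α) = 4 * r * (α ^ (4 * w + 1) * α) * D := by ring
      _ ≤ (D : ℝ) ^ (4 * w + 1) * D := by gcongr
  · rw [← hH]
    refine (mul_le_mul_of_nonneg_left (sum_norm_vonMangoldt_le hadm) (by norm_num)).trans ?_
    rw [← hCe]
    -- The losses are T from divisors, T³ from logarithms and αT² from H. Against αδT⁸ ≤ 2 a factor
    -- T² remains, half of which, namely T, absorbs the constants.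
    have h1 : 32 * (Ce * R * L ^ 3 * (H * δ)) * T ^ 8 ≤ 1 * T ^ 8 := by
      calc 32 * (Ce * R * L ^ 3 * (H * δ)) * T ^ 8
          ≤ 32 * (Ce * (2 * V * T) * (c * T) ^ 3 * ((5 * r ^ 2 * α * T ^ 2) * δ)) * T ^ 8 := by
            rw [← hL]
            gcongr
        _ = 320 * Ce * V * c ^ 3 * r ^ 2 * T ^ 6 * (α * δ * T ^ 8) := by ring
        _ ≤ 320 * Ce * V * c ^ 3 * r ^ 2 * T ^ 6 * 2 := by gcongr
        _ = (640 * Ce * V * c ^ 3 * r ^ 2) * T ^ 6 := by ring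
        _ ≤ T * T ^ 6 := by gcongr
        _ = T ^ 7 := by ring
        _ ≤ T ^ 8 := pow_le_pow_right₀ hT1 (by norm_num)
        _ = 1 * T ^ 8 := (one_mul _).symm
    have h2 := le_of_mul_le_mul_right h1 (by positivity)
    calc (32 : ℝ) * (Ce * R * L ^ 3 * (H * x * δ)) = 32 * (Ce * R * L ^ 3 * (H * δ)) * (x : ℝ) := by ring
      _ ≤ 1 * (x : ℝ) := by gcongr
      _ = (x : ℝ) := one_mul _

/-! ### Numerators of convergents as denominators for the inverse. -/

/-- The numerators and denominators of the convergents of the continued fraction of a positive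
irrational number. -/
theorem exists_convergents {v : ℝ} (hv : 0 < v) (hirr : Irrational v) :
    ∃ P Q b : ℕ → ℕ, (∀ n, cfNum v n = P n) ∧ (∀ n, 1 ≤ b n) ∧ (P 0 : ℝ) ≤ v ∧
      P 1 = b 0 * P 0 + 1 ∧ (∀ n, P (n + 2) = b (n + 1) * P (n + 1) + P n) ∧
      (∀ n, 1 ≤ Q n) ∧ (∀ n, IsCoprime (Q n : ℤ) (P n : ℤ)) ∧
      ∀ n, |v * Q n - P n| ≤ 1 / Q (n + 1) := by
  have hterm : ∀ n, ¬ (GenContFract.of v).TerminatedAt n := by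
    intro n hn
    obtain ⟨q, hq⟩ := (GenContFract.terminates_iff_rat v).mp ⟨n, hn⟩
    exact hirr ⟨q, hq.symm⟩
  have hs : ∀ n, ∃ b : ℕ, 1 ≤ b ∧ (GenContFract.of v).s.get? n = some ⟨1, (b : ℝ)⟩ := by
    intro n
    obtain ⟨gp, hgp⟩ := Option.ne_none_iff_exists'.mp
      (fun h => hterm n (GenContFract.terminatedAt_iff_s_none.mpr h))
    obtain ⟨h1, z, hz⟩ := GenContFract.of_partNum_eq_one_and_exists_int_partDen_eq hgp
    have h2 := GenContFract.of_one_le_get?_partDen (GenContFract.partDen_eq_s_b hgp)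
    rw [hz] at h2
    have h3 : 1 ≤ z := by exact_mod_cast h2
    refine ⟨z.toNat, by omega, ?_⟩
    rw [hgp]
    congr 1
    rcases gp with ⟨a, c⟩
    simp only at h1 hz
    have h4 : ((z.toNat : ℕ) : ℝ) = z := by
      rw [← Int.cast_natCast, Int.toNat_of_nonneg (by omega)]
    rw [h1, hz, h4]
  choose b hb1 hb using hs
  have hfloor : 0 ≤ ⌊v⌋ := Int.floor_nonneg.mpr hv.le
  have hfl : ((⌊v⌋.toNat : ℕ) : ℝ) = ⌊v⌋ := by
    rw [← Int.cast_natCast, Int.toNat_of_nonneg hfloor]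
  have hP : ∀ n, ∃ p q p' q' : ℕ, 1 ≤ q ∧ 1 ≤ q' ∧ (GenContFract.of v).nums n = p ∧
      (GenContFract.of v).dens n = q ∧ (GenContFract.of v).nums (n + 1) = p' ∧
      (GenContFract.of v).dens (n + 1) = q' := by
    intro n
    induction n with
    | zero =>
      refine ⟨⌊v⌋.toNat, 1, b 0 * ⌊v⌋.toNat + 1, b 0, le_rfl, hb1 0, ?_, ?_, ?_, ?_⟩
      · rw [GenContFract.zeroth_num_eq_h, GenContFract.of_h_eq_floor, hfl]
      · rw [GenContFract.zeroth_den_eq_one, Nat.cast_one]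
      · rw [GenContFract.first_num_eq (hb 0), GenContFract.of_h_eq_floor]
        push_cast
        rw [hfl]
      · rw [GenContFract.first_den_eq (hb 0)]
    | succ n ih =>
      obtain ⟨p, q, p', q', h1, h2, h3, h4, h5, h6⟩ := ih
      refine ⟨p', q', b (n + 1) * p' + p, b (n + 1) * q' + q, h2, by omega, h5, h6, ?_, ?_⟩
      · rw [GenContFract.nums_recurrence (hb (n + 1)) h3 h5]
        push_cast
        ring
      · rw [GenContFract.dens_recurrence (hb (n + 1)) h4 h6]
        push_cast
        ring
  choose P Q P' Q' hQ hQ' hPn hQn hPn' hQn' using hP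
  -- The determinant identity for consecutive convergents is a Bézout relation between numerator and
  -- denominator.
  have hco : ∀ n, IsCoprime (Q n : ℤ) (P n : ℤ) := by
    intro n
    have h1 : (GenContFract.of v).nums n * (GenContFract.of v).dens (n + 1)
        - (GenContFract.of v).dens n * (GenContFract.of v).nums (n + 1) = (-1) ^ (n + 1) :=
      SimpContFract.determinant (s := SimpContFract.of v) (hterm n)
    simp only [hPn, hQn] at h1
    have h2 : (P n : ℤ) * Q (n + 1) - Q n * P (n + 1) = (-1) ^ (n + 1) := by exact_mod_cast h1
    have h3 : ((-1 : ℤ) ^ (n + 1)) * (-1) ^ (n + 1) = 1 := by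
      rw [← mul_pow]
      simp
    refine ⟨-(-1) ^ (n + 1) * P (n + 1), (-1) ^ (n + 1) * Q (n + 1), ?_⟩
    linear_combination (-1) ^ (n + 1) * h2 + h3
  refine ⟨P, Q, b, hPn, hb1, ?_, ?_, ?_, hQ, hco, ?_⟩
  · rw [← hPn 0, GenContFract.zeroth_num_eq_h, GenContFract.of_h_eq_floor]
    exact Int.floor_le v
  · have h1 : ((P 1 : ℕ) : ℝ) = ((b 0 * P 0 + 1 : ℕ) : ℝ) := by
      push_cast
      rw [← hPn 1, ← hPn 0, GenContFract.first_num_eq (hb 0), GenContFract.zeroth_num_eq_h]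
    exact_mod_cast h1
  · intro n
    have h1 : ((P (n + 2) : ℕ) : ℝ) = ((b (n + 1) * P (n + 1) + P n : ℕ) : ℝ) := by
      push_cast
      rw [← hPn (n + 2), GenContFract.nums_recurrence (hb (n + 1)) (hPn n) (hPn (n + 1))]
      ring
    exact_mod_cast h1
  · intro n
    have h1 := GenContFract.abs_sub_convs_le (hterm n)
    rw [GenContFract.conv_eq_num_div_den, hPn, hQn, hQn (n + 1)] at h1
    have hq : (0 : ℝ) < Q n := by exact_mod_cast hQ n
    have h2 : v * Q n - P n = (v - P n / Q n) * Q n := by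
      field_simp
    rw [h2, abs_mul, abs_of_pos hq]
    calc |v - P n / Q n| * Q n ≤ 1 / (Q n * Q (n + 1)) * Q n := by gcongr
      _ = 1 / Q (n + 1) := by field_simp

/-- The properties of the numerators of the convergents of the continued fraction of a positive
irrational number which are used below. -/
theorem exists_numerators {v : ℝ} (hv : 0 < v) (hirr : Irrational v) :
    ∃ P : ℕ → ℕ, (∀ n, cfNum v n = P n) ∧ (P 0 : ℝ) ≤ v ∧ Monotone P ∧
      (∀ n i, 2 ^ i * P n ≤ P (n + 2 * i)) ∧ 1 ≤ P 1 ∧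
      ∀ n, 2 ≤ n → ∃ a : ℤ, IsCoprime a (P n : ℤ) ∧ |v⁻¹ - a / P n| ≤ 1 / (P n : ℝ) ^ 2 := by
  obtain ⟨P, Q, b, hP, hb, hP0, hP1, hPrec, hQ, hco, happ⟩ := exists_convergents hv hirr
  have hstep : ∀ n, P (n + 1) + P n ≤ P (n + 2) := by
    intro n
    rw [hPrec]
    have := Nat.mul_le_mul_right (P (n + 1)) (hb (n + 1))
    omega
  have hmono : Monotone P := by
    refine monotone_nat_of_le_succ fun n => ?_
    rcases n with _ | n
    · rw [hP1]
      have := Nat.mul_le_mul_right (P 0) (hb 0)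
      omega
    · exact (Nat.le_add_right _ _).trans (hstep n)
  have h1 : 1 ≤ P 1 := by omega
  refine ⟨P, hP, hP0, hmono, fun n i => ?_, h1, fun n hn => ⟨Q n, hco n, ?_⟩⟩
  · induction i with
    | zero => simp
    | succ i ih =>
      have h2 := hstep (n + 2 * i)
      have h3 := hmono (by omega : n + 2 * i ≤ n + 2 * i + 1)
      have h4 : n + 2 * (i + 1) = n + 2 * i + 2 := by ring
      rw [h4, pow_succ, mul_right_comm]
      omega
  · have hPn : 1 ≤ P n := h1.trans (hmono (by omega))
    have hPn0 : (0 : ℝ) < P n := by exact_mod_cast hPn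
    have hQn : (1 : ℝ) ≤ Q (n + 1) := by exact_mod_cast hQ (n + 1)
    have hQn2 : (1 : ℝ) ≤ Q (n + 2) := by exact_mod_cast hQ (n + 2)
    -- The error |1/v - Q/P| is at most 1/(vP Q(n+1)), so this inequality is what is needed. It
    -- follows from P(n) + 1 ≤ P(n+1) ≤ v Q(n+1) + 1; the first of these may fail for n = 1, because
    -- P(0) = 0 when v < 1.
    have h2 : (P n : ℝ) ≤ v * Q (n + 1) := by
      have h3 := happ (n + 1)
      have h4 : (1 : ℝ) / Q (n + 1 + 1) ≤ 1 := by
        rw [div_le_one (by linarith)]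
        exact hQn2
      have h5 := (abs_le.mp (h3.trans h4)).1
      have h6 : P n + 1 ≤ P (n + 1) := by
        obtain ⟨i, rfl⟩ : ∃ i, n = i + 2 := ⟨n - 2, by omega⟩
        have := hstep (i + 1)
        have h7 : 1 ≤ P (i + 1) := h1.trans (hmono (by omega))
        have h8 : i + 2 + 1 = i + 1 + 2 := by ring
        rw [h8]
        have h9 : i + 1 + 1 = i + 2 := by ring
        rw [h9] at this
        omega
      have h7 : (P n : ℝ) + 1 ≤ P (n + 1) := by exact_mod_cast h6
      linarith
    have h3 : v⁻¹ - ((Q n : ℤ) : ℝ) / P n = -((v * Q n - P n) / (v * P n)) := by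
      push_cast
      field_simp
      ring
    rw [h3, abs_neg, abs_div, abs_of_pos (by positivity : 0 < v * P n),
      div_le_div_iff₀ (by positivity) (by positivity)]
    calc |v * Q n - P n| * (P n : ℝ) ^ 2 ≤ 1 / Q (n + 1) * (P n * (v * Q (n + 1))) := by
          rw [sq]
          gcongr
          exact happ n
      _ = 1 * (v * P n) := by
          field_simp

/-! ### Membership in the Beatty sequence as a condition on a polynomial phase. -/

/-- z = ⌊nα + β⌋ means (z - β)/α ≤ n < (z + 1 - β)/α, an interval of length 1/α whose midpoint is
the argument of `nd`. The condition β ≤ z forces n ≥ 1. -/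
lemma mem_beattySet_of_nd_lt {α β : ℝ} {z : ℤ} (hα : 0 < α) (hz : β ≤ z)
    (h : nd ((z + 1 - β) / α - 1 / (2 * α)) < 1 / (2 * α)) : z ∈ BeattySet α β := by
  rw [nd] at h
  set n := round ((z + 1 - β) / α - 1 / (2 * α)) with hn
  obtain ⟨h1, h2⟩ := abs_lt.mp h
  have h3 : (z + 1 - β) / α = ((z + 1 - β) / α - 1 / (2 * α)) + 1 / (2 * α) := by ring
  have h4 : (n : ℝ) < (z + 1 - β) / α := by linarith
  have h5 : (z - β) / α < n := by
    have h6 : (z - β) / α = (z + 1 - β) / α - 2 * (1 / (2 * α)) := by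
      field_simp
      ring
    rw [h6]
    linarith
  rw [lt_div_iff₀ hα] at h4
  have h7 : (0 : ℝ) < n := lt_of_le_of_lt (div_nonneg (by linarith) hα.le) h5
  rw [div_lt_iff₀ hα] at h5
  have h8 : 0 < n := by exact_mod_cast h7
  refine ⟨n.toNat, by omega, ?_⟩
  have h9 : ((n.toNat : ℕ) : ℝ) = n := by
    rw [← Int.cast_natCast, Int.toNat_of_nonneg h8.le]
  rw [h9, eq_comm, Int.floor_eq_iff]
  constructor <;> linarith

/-- The lower terms total at most A p^(k-1) ≤ p^k/2, while the leading term is at least p^k. -/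
lemma pow_le_two_mul_eval {k A p : ℕ} {g : ℤ[X]} (hk : 1 ≤ k) (hg : g.natDegree = k)
    (hlc : 1 ≤ g.leadingCoeff) (hA : ∑ i ∈ Finset.range k, (g.coeff i).natAbs ≤ A)
    (hp1 : 1 ≤ p) (hp : 2 * A ≤ p) : (p : ℤ) ^ k ≤ 2 * g.eval (p : ℤ) := by
  have hp0 : (0 : ℤ) ≤ p := by positivity
  have hp1' : (1 : ℤ) ≤ p := by exact_mod_cast hp1
  have h1 : g.eval (p : ℤ) = ∑ i ∈ Finset.range k, g.coeff i * (p : ℤ) ^ i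
      + g.leadingCoeff * (p : ℤ) ^ k := by
    rw [eval_eq_sum_range, hg, Finset.sum_range_succ, leadingCoeff, hg]
  have h2 : |∑ i ∈ Finset.range k, g.coeff i * (p : ℤ) ^ i| ≤ A * (p : ℤ) ^ (k - 1) := by
    calc |∑ i ∈ Finset.range k, g.coeff i * (p : ℤ) ^ i|
        ≤ ∑ i ∈ Finset.range k, |g.coeff i * (p : ℤ) ^ i| := Finset.abs_sum_le_sum_abs _ _
      _ ≤ ∑ i ∈ Finset.range k, |g.coeff i| * (p : ℤ) ^ (k - 1) := by
          refine Finset.sum_le_sum fun i hi => ?_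
          rw [Finset.mem_range] at hi
          rw [abs_mul, abs_of_nonneg (pow_nonneg hp0 i)]
          exact mul_le_mul_of_nonneg_left (pow_le_pow_right₀ hp1' (by omega)) (abs_nonneg _)
      _ = (∑ i ∈ Finset.range k, |g.coeff i|) * (p : ℤ) ^ (k - 1) := by rw [Finset.sum_mul]
      _ ≤ A * (p : ℤ) ^ (k - 1) := by
          gcongr
          have h3 : ((∑ i ∈ Finset.range k, (g.coeff i).natAbs : ℕ) : ℤ) ≤ A := by
            exact_mod_cast hA
          push_cast at h3
          exact h3
  have h3 : 2 * (A * (p : ℤ) ^ (k - 1)) ≤ (p : ℤ) ^ k := by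
    have h4 : (2 * A : ℤ) ≤ p := by exact_mod_cast hp
    calc 2 * (A * (p : ℤ) ^ (k - 1)) = (2 * A) * (p : ℤ) ^ (k - 1) := by ring
      _ ≤ p * (p : ℤ) ^ (k - 1) := by gcongr
      _ = (p : ℤ) ^ k := by rw [← pow_succ', Nat.sub_add_cancel hk]
  have h4 : (p : ℤ) ^ k ≤ g.leadingCoeff * (p : ℤ) ^ k :=
    le_mul_of_one_le_left (by positivity) hlc
  have h5 := (abs_le.mp h2).1
  rw [h1]
  linarith

/-- The polynomial whose values are close to integers at the arguments where `g` takes values in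
the Beatty sequence. -/
noncomputable def phase (g : ℤ[X]) (α β : ℝ) : ℝ[X] :=
  C α⁻¹ * g.map (Int.castRingHom ℝ) + C ((1 - β) / α - 1 / (2 * α))

lemma natDegree_phase_le (g : ℤ[X]) (α β : ℝ) : (phase g α β).natDegree ≤ g.natDegree := by
  refine (natDegree_add_le _ _).trans (max_le ?_ ?_)
  · exact (natDegree_C_mul_le _ _).trans (natDegree_map_le)
  · rw [natDegree_C]
    exact Nat.zero_le _

lemma coeff_phase {g : ℤ[X]} {n : ℕ} (hn : 1 ≤ n) (α β : ℝ) :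
    (phase g α β).coeff n = α⁻¹ * g.coeff n := by
  rw [phase, coeff_add, coeff_C_mul, coeff_map, coeff_C, if_neg (by omega), add_zero]
  rfl

lemma eval_phase (g : ℤ[X]) (α β : ℝ) (p : ℕ) : (phase g α β).eval (p : ℝ)
    = ((g.eval (p : ℤ) : ℤ) + 1 - β) / α - 1 / (2 * α) := by
  have h1 : (g.map (Int.castRingHom ℝ)).eval (p : ℝ) = ((g.eval (p : ℤ) : ℤ) : ℝ) := by
    simp
  rw [phase, eval_add, eval_mul, eval_C, eval_C, h1]
  ring

/-! ### Length of the sum and size of the saving. -/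

/-- The exponent relating the parameters of the sieve to the denominator of the rational
approximation. -/
def scaleExp (j N : ℕ) : ℕ :=
  2 * (j + 1) * N * ((2 ^ j * 2 ^ j) * (2 ^ j * 2 ^ j + 1))

lemma succ_le_two_pow_mul (j : ℕ) : j + 1 ≤ 2 ^ j * 2 ^ j :=
  (Nat.lt_two_pow_self : j < 2 ^ j).trans_le (Nat.le_mul_of_pos_left _ (by positivity))

section Saving

variable {j N G : ℕ} {α B u ζ X P : ℝ}

/-- Treats the term 1/P of the saving. Since α^G ≤ P^(G/(G+1)), a power P^(1/(G+1)) is left over,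
and u is so small a root of P that u^(2G(j+1)) fits into it. -/
lemma pow_mul_pow_le_of_scale (hN : 1 ≤ N) (hα : 1 ≤ α) (hB : 1 ≤ B)
    (hu : 1 ≤ u) (huP : u ^ (2 * (j + 1) * N * (G * (G + 1))) = P) (hP : α ^ (G + 1) * B ≤ P) :
    α ^ G * u ^ (2 * G * (j + 1)) ≤ P := by
  have hP1 : 1 ≤ P := huP ▸ one_le_pow₀ hu
  refine le_of_pow_le_pow_left₀ (n := G + 1) (by omega) (by linarith) ?_
  have h1 : α ^ (G + 1) ≤ P := le_trans (le_mul_of_one_le_right (by positivity) hB) hP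
  calc (α ^ G * u ^ (2 * G * (j + 1))) ^ (G + 1)
      = (α ^ (G + 1)) ^ G * u ^ (2 * (j + 1) * 1 * (G * (G + 1))) := by ring
    _ ≤ P ^ G * u ^ (2 * (j + 1) * N * (G * (G + 1))) := by
        refine mul_le_mul (pow_le_pow_left₀ (by positivity) h1 G)
          (pow_le_pow_right₀ hu ?_) (by positivity) (by positivity)
        gcongr
    _ = P ^ (G + 1) := by rw [huP, pow_succ]

/-- Treats the term x^(-1/2). The exponent (2j+1)G of α in X^(j+1) is exactly what, with one more
α^G taken from P, gives α^(2G(j+1)). -/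
lemma pow_mul_pow_le_length (hN : 1 ≤ N) (hα : 1 ≤ α) (hB : 1 ≤ B)
    (hu : 1 ≤ u) (huP : u ^ (2 * (j + 1) * N * (G * (G + 1))) = P) (hP : α ^ (G + 1) * B ≤ P)
    (hζ : 1 ≤ ζ) (hX : 0 ≤ X)
    (hXP : X ^ (j + 1) = α ^ ((2 * j + 1) * G) * B ^ j * P * ζ ^ (j + 1)) :
    (α ^ G * u ^ G) ^ 2 ≤ X := by
  have hP1 : 1 ≤ P := huP ▸ one_le_pow₀ hu
  refine le_of_pow_le_pow_left₀ (n := j + 1) (by omega) hX ?_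
  rw [hXP]
  calc ((α ^ G * u ^ G) ^ 2) ^ (j + 1)
      = α ^ ((2 * j + 1) * G) * 1 * (α ^ G * u ^ (2 * G * (j + 1))) * 1 := by ring
    _ ≤ α ^ ((2 * j + 1) * G) * B ^ j * P * ζ ^ (j + 1) := by
        have h1 := pow_mul_pow_le_of_scale hN hα hB hu huP hP
        have h2 : 1 ≤ B ^ j := one_le_pow₀ hB
        have h3 : 1 ≤ ζ ^ (j + 1) := one_le_pow₀ hζ
        refine mul_le_mul (mul_le_mul (mul_le_mul_of_nonneg_left h2 (by positivity)) h1
          (by positivity) (by positivity)) h3 zero_le_one (by positivity)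

/-- Treats the term P/x^(j+1). After cancelling P one needs u^G to be small against powers of α, B
and ζ. By the definition of ζ a product of such powers equals P^G, and u is a high root of P; this
is where ε is used. -/
lemma pow_mul_pow_mul_le_length_pow (hj : 1 ≤ j) (hN : 1 ≤ N) (hG : 1 ≤ G) (hα : 1 ≤ α)
    (hB : 1 ≤ B) (hu : 1 ≤ u) (huP : u ^ (2 * (j + 1) * N * (G * (G + 1))) = P)
    (hζ : 1 ≤ ζ) (hζP : P ^ G = α ^ (G + 1) * B ^ G * ζ ^ N)
    (hXP : X ^ (j + 1) = α ^ ((2 * j + 1) * G) * B ^ j * P * ζ ^ (j + 1)) :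
    α ^ G * u ^ G * P ≤ X ^ (j + 1) := by
  have hP1 : 1 ≤ P := huP ▸ one_le_pow₀ hu
  have h1 : u ^ G ≤ α ^ (2 * j * G) * B ^ j * ζ ^ (j + 1) := by
    obtain ⟨M, hM⟩ : ∃ M, M = 2 * (j + 1) * N * (G + 1) := ⟨_, rfl⟩
    have hM1 : G + 1 ≤ M := by
      rw [hM]
      exact Nat.le_mul_of_pos_left _ (Nat.mul_pos (by omega) hN)
    have hMN : N ≤ M := by
      rw [hM]
      calc N = 1 * N * 1 := by ring
        _ ≤ 2 * (j + 1) * N * (G + 1) := by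
            gcongr <;> omega
    refine le_of_pow_le_pow_left₀ (n := M) (by omega) (by positivity) ?_
    calc (u ^ G) ^ M = P := by
          rw [← huP, hM]
          ring
      _ ≤ P ^ G := by
          calc P = P ^ 1 := (pow_one _).symm
            _ ≤ P ^ G := pow_le_pow_right₀ hP1 hG
      _ = α ^ (G + 1) * B ^ G * ζ ^ N := hζP
      _ ≤ α ^ (2 * j * G * M) * B ^ (j * M) * ζ ^ ((j + 1) * M) := by
          have e1 : G + 1 ≤ 2 * j * G * M :=
            hM1.trans (Nat.le_mul_of_pos_left _ (Nat.mul_pos (by omega) hG))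
          have e2 : G ≤ j * M := (by omega : G ≤ M).trans (Nat.le_mul_of_pos_left _ hj)
          have e3 : N ≤ (j + 1) * M := hMN.trans (Nat.le_mul_of_pos_left _ (by omega))
          exact mul_le_mul (mul_le_mul (pow_le_pow_right₀ hα e1) (pow_le_pow_right₀ hB e2)
            (by positivity) (by positivity)) (pow_le_pow_right₀ hζ e3) (by positivity)
            (by positivity)
      _ = (α ^ (2 * j * G) * B ^ j * ζ ^ (j + 1)) ^ M := by
          rw [mul_pow, mul_pow, ← pow_mul, ← pow_mul, ← pow_mul]
  rw [hXP]
  calc α ^ G * u ^ G * P ≤ α ^ G * (α ^ (2 * j * G) * B ^ j * ζ ^ (j + 1)) * P := by gcongr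
    _ = _ := by ring

/-- Crude: only some fixed power of P is needed, to control logarithms and divisor functions by
powers of T. -/
lemma length_le_pow (hN : 1 ≤ N) (hG : 1 ≤ G) (hα : 1 ≤ α)
    (hB : 1 ≤ B) (hP : α ^ (G + 1) * B ≤ P)
    (hζ : 1 ≤ ζ) (hζP : P ^ G = α ^ (G + 1) * B ^ G * ζ ^ N)
    (hXP : X ^ (j + 1) = α ^ ((2 * j + 1) * G) * B ^ j * P * ζ ^ (j + 1)) :
    X ≤ P ^ (4 * G) := by
  have hαB : 1 ≤ α ^ (G + 1) * B := one_le_mul_of_one_le_of_one_le (one_le_pow₀ hα) hB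
  have hP1 : 1 ≤ P := hαB.trans hP
  refine le_of_pow_le_pow_left₀ (n := j + 1) (by omega) (by positivity) ?_
  rw [hXP]
  have h1 : ζ ≤ P ^ G := by
    rw [hζP]
    calc ζ = 1 * ζ ^ 1 := by ring
      _ ≤ (α ^ (G + 1) * B ^ G) * ζ ^ N := by
          have : 1 ≤ α ^ (G + 1) * B ^ G :=
            one_le_mul_of_one_le_of_one_le (one_le_pow₀ hα) (one_le_pow₀ hB)
          exact mul_le_mul this (pow_le_pow_right₀ hζ hN) (by positivity) (by positivity)
  have h2 : α ^ ((2 * j + 1) * G) * B ^ j ≤ P ^ (2 * j + 1) := by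
    calc α ^ ((2 * j + 1) * G) * B ^ j ≤ α ^ ((G + 1) * (2 * j + 1)) * B ^ (2 * j + 1) := by
          refine mul_le_mul (pow_le_pow_right₀ hα ?_) (pow_le_pow_right₀ hB (by omega))
            (by positivity) (by positivity)
          nlinarith
      _ = (α ^ (G + 1) * B) ^ (2 * j + 1) := by rw [mul_pow, ← pow_mul]
      _ ≤ P ^ (2 * j + 1) := by gcongr
  calc α ^ ((2 * j + 1) * G) * B ^ j * P * ζ ^ (j + 1)
      ≤ P ^ (2 * j + 1) * P * (P ^ G) ^ (j + 1) := by gcongr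
    _ = P ^ ((2 + G) * (j + 1)) := by ring
    _ ≤ P ^ (4 * G * (j + 1)) := by
        refine pow_le_pow_right₀ hP1 ?_
        gcongr
        omega
    _ = (P ^ (4 * G)) ^ (j + 1) := by rw [← pow_mul]

/-- The existence of the saving in the estimates for exponential sums. -/
lemma exists_saving {x : ℕ} (hj : 1 ≤ j) (hN : 1 ≤ N) (hjG : j + 1 ≤ G) (hα : 1 ≤ α)
    (hB : 1 ≤ B) (hu : 2 ≤ u) (huP : u ^ (2 * (j + 1) * N * (G * (G + 1))) = P)
    (hP : α ^ (G + 1) * B ≤ P)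
    (hζ : 1 ≤ ζ) (hζP : P ^ G = α ^ (G + 1) * B ^ G * ζ ^ N) (hX : 0 ≤ X)
    (hXP : X ^ (j + 1) = α ^ ((2 * j + 1) * G) * B ^ j * P * ζ ^ (j + 1)) (hx : 1 ≤ x)
    (hXx : X ≤ 2 * x) :
    ∃ δ : ℝ, 0 < δ ∧ δ ≤ 1 ∧ α * δ * u ≤ 2 ∧ 1 ≤ P * δ ^ G ∧ 1 ≤ x * (δ ^ G) ^ 2 ∧
      P ≤ x ^ (j + 1) * δ ^ G := by
  have hu1 : 1 ≤ u := by linarith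
  have hG : 1 ≤ G := by omega
  have hP1 : 1 ≤ P := huP ▸ one_le_pow₀ hu1
  have hx0 : (1 : ℝ) ≤ x := by exact_mod_cast hx
  have h1 := pow_mul_pow_le_of_scale hN hα hB hu1 huP hP
  have h2 := pow_mul_pow_le_length hN hα hB hu1 huP hP hζ hX hXP
  have h3 := pow_mul_pow_mul_le_length_pow hj hN hG hα hB hu1 huP hζ hζP hXP
  have h2G : (1 : ℝ) ≤ 2 ^ G := one_le_pow₀ (by norm_num)
  have hX2 : X ^ (j + 1) ≤ 2 ^ G * (x : ℝ) ^ (j + 1) := by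
    calc X ^ (j + 1) ≤ (2 * x) ^ (j + 1) := by gcongr
      _ = 2 ^ (j + 1) * (x : ℝ) ^ (j + 1) := mul_pow _ _ _
      _ ≤ 2 ^ G * (x : ℝ) ^ (j + 1) := by
          gcongr
          norm_num
  -- M is the least value that the three admissibility conditions allow for δ^G. The preceding
  -- lemmas give (αu)^G M ≤ 2^G, where 2^G covers the rounding X ≤ 2x.
  set M := max (1 / P) (max (1 / Real.sqrt x) (P / (x : ℝ) ^ (j + 1))) with hM
  have hM1 : 1 / P ≤ M := le_max_left _ _
  have hM2 : 1 / Real.sqrt x ≤ M := (le_max_left _ _).trans (le_max_right _ _)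
  have hM3 : P / (x : ℝ) ^ (j + 1) ≤ M := (le_max_right _ _).trans (le_max_right _ _)
  have hs1 : 1 ≤ Real.sqrt x := Real.one_le_sqrt.mpr hx0
  have hsx : Real.sqrt x ^ 2 = x := Real.sq_sqrt (Nat.cast_nonneg _)
  have hM0 : 0 < M := lt_of_lt_of_le (by positivity) hM1
  have hαu : 2 ^ G ≤ α ^ G * u ^ G := by
    calc (2 : ℝ) ^ G = 1 * 2 ^ G := (one_mul _).symm
      _ ≤ α ^ G * u ^ G := by
        refine mul_le_mul (one_le_pow₀ hα) ?_ (by positivity) (by positivity)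
        gcongr
  have hMle : α ^ G * u ^ G * M ≤ 2 ^ G := by
    have hpos : 0 < α ^ G * u ^ G := by positivity
    rw [← le_div_iff₀' hpos, hM]
    refine max_le ?_ (max_le ?_ ?_)
    · rw [div_le_div_iff₀ (by positivity) hpos, one_mul]
      calc α ^ G * u ^ G ≤ α ^ G * u ^ (2 * G * (j + 1)) := by
            refine mul_le_mul_of_nonneg_left (pow_le_pow_right₀ hu1 ?_) (by positivity)
            nlinarith
        _ ≤ P := h1
        _ ≤ 2 ^ G * P := le_mul_of_one_le_left (by positivity) h2G
    · rw [div_le_div_iff₀ (by positivity) hpos, one_mul]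
      refine le_of_pow_le_pow_left₀ (n := 2) (by norm_num) (by positivity) ?_
      calc (α ^ G * u ^ G) ^ 2 ≤ 2 * x := h2.trans hXx
        _ ≤ (2 ^ G) ^ 2 * x := by
            gcongr
            calc (2 : ℝ) = 2 ^ 1 := (pow_one _).symm
              _ ≤ 2 ^ (G * 2) := pow_le_pow_right₀ (by norm_num) (by omega)
              _ = (2 ^ G) ^ 2 := pow_mul _ _ _
        _ = (2 ^ G * Real.sqrt x) ^ 2 := by rw [mul_pow, hsx]
    · rw [div_le_div_iff₀ (by positivity) hpos]
      calc P * (α ^ G * u ^ G) = α ^ G * u ^ G * P := mul_comm _ _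
        _ ≤ 2 ^ G * (x : ℝ) ^ (j + 1) := h3.trans hX2
  set δ := M ^ ((G : ℝ)⁻¹) with hδ
  have hδG : δ ^ G = M := Real.rpow_inv_natCast_pow hM0.le (by omega)
  have hδ0 : 0 < δ := Real.rpow_pos_of_pos hM0 _
  refine ⟨δ, hδ0, ?_, ?_, ?_, ?_, ?_⟩
  · refine le_of_pow_le_pow_left₀ (n := G) (by omega) zero_le_one ?_
    rw [hδG, one_pow]
    have h4 : 2 ^ G * M ≤ 2 ^ G * 1 := by
      calc 2 ^ G * M ≤ α ^ G * u ^ G * M := by gcongr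
        _ ≤ 2 ^ G * 1 := by rwa [mul_one]
    exact le_of_mul_le_mul_left h4 (by positivity)
  · refine le_of_pow_le_pow_left₀ (n := G) (by omega) (by norm_num) ?_
    rw [mul_pow, mul_pow, hδG]
    linarith
  · rw [hδG, ← div_le_iff₀' (by positivity)]
    exact hM1
  · rw [hδG]
    calc (1 : ℝ) = x * (1 / Real.sqrt x) ^ 2 := by
          rw [div_pow, hsx]
          field_simp
      _ ≤ x * M ^ 2 := by gcongr
  · rw [hδG, ← div_le_iff₀' (by positivity)]
    exact hM3

end Saving

/-- The factor by which the numerator of the convergent has to exceed `α ^ (G + 1) * B`. -/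
def threshold (j N A : ℕ) : ℕ :=
  sizeConst j (scaleExp j N) ^ (8 * scaleExp j N) + (4 + 8 * A ^ 2) ^ (j + 1)

lemma two_le_sizeConst (j : ℕ) {w : ℕ} (hw : 1 ≤ w) : 2 ≤ sizeConst j w := by
  have h1 := one_le_expConst j
  have h2 : 1 ≤ divConst j (divExp j w) := one_le_divConst j
    (Nat.mul_pos (Nat.mul_pos (by omega) (by positivity)) (by omega))
  have h3 : 0 < (1 + 32 * w * (2 ^ j * 2 ^ j)) ^ 3 := by positivity
  have h4 : 0 < (2 * w + 1) ^ 2 := by positivity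
  unfold sizeConst
  calc 2 ≤ 640 * 1 * 1 * 1 * 1 := by norm_num
    _ ≤ _ := by
      gcongr <;> omega

/-- The existence of a prime `p` with `g(p)` in the Beatty sequence, in terms of a rational
approximation to the quotient of the leading coefficient and `α`. -/
theorem exists_prime_mem_beattySet {j N A : ℕ} (hj : 1 ≤ j) (hN : 1 ≤ N) {g : ℤ[X]}
    (hg : g.natDegree = j + 1) (hlc : 1 ≤ g.leadingCoeff)
    (hA : ∑ i ∈ Finset.range (j + 1), (g.coeff i).natAbs ≤ A) {α β B ζ X : ℝ} {P : ℕ} {a : ℤ}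
    (hα : 1 ≤ α) (hB : 1 ≤ B) (hβ : β ≤ B) (hco : IsCoprime a (P : ℤ))
    (happ : |(α / g.leadingCoeff)⁻¹ - a / P| ≤ 1 / (P : ℝ) ^ 2)
    (hP : threshold j N A * (α ^ (2 ^ j * 2 ^ j + 1) * B) ≤ P) (hζ : 1 ≤ ζ)
    (hζP : (P : ℝ) ^ (2 ^ j * 2 ^ j) = α ^ (2 ^ j * 2 ^ j + 1) * B ^ (2 ^ j * 2 ^ j) * ζ ^ N)
    (hX : 0 ≤ X)
    (hXP : X ^ (j + 1) = α ^ ((2 * j + 1) * (2 ^ j * 2 ^ j)) * B ^ j * P * ζ ^ (j + 1)) :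
    ∃ p : ℕ, p.Prime ∧ g.eval (p : ℤ) ∈ BeattySet α β ∧ (p : ℝ) ≤ X := by
  obtain ⟨G, hG⟩ : ∃ G, G = 2 ^ j * 2 ^ j := ⟨_, rfl⟩
  have hjG : j + 1 ≤ G := hG ▸ succ_le_two_pow_mul j
  obtain ⟨w, hw⟩ : ∃ w, w = scaleExp j N := ⟨_, rfl⟩
  have hw' : w = 2 * (j + 1) * N * (G * (G + 1)) := by rw [hw, scaleExp, hG]
  have hw1 : 1 ≤ w := by
    rw [hw']
    exact Nat.mul_pos (Nat.mul_pos (by omega) hN) (Nat.mul_pos (by omega) (by omega))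
  have hS := two_le_sizeConst j hw1
  obtain ⟨S, hSS⟩ : ∃ S, S = sizeConst j w := ⟨_, rfl⟩
  rw [← hSS] at hS
  have hth : (threshold j N A : ℝ) = (S : ℝ) ^ (8 * w) + (4 + 8 * (A : ℝ) ^ 2) ^ (j + 1) := by
    rw [threshold, hSS, hw]
    push_cast
    rfl
  rw [← hG] at hP hζP hXP
  rw [hth] at hP
  have hαB : 1 ≤ α ^ (G + 1) * B := one_le_mul_of_one_le_of_one_le (one_le_pow₀ hα) hB
  have hS0 : (2 : ℝ) ≤ S := by exact_mod_cast hS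
  have hS8 : (1 : ℝ) ≤ (S : ℝ) ^ (8 * w) := one_le_pow₀ (by linarith)
  have hA4 : (0 : ℝ) ≤ (4 + 8 * (A : ℝ) ^ 2) ^ (j + 1) := by positivity
  have hPαB : α ^ (G + 1) * B ≤ P :=
    le_trans (le_mul_of_one_le_left (by positivity) (by linarith)) hP
  have hP1' : (1 : ℝ) ≤ P := hαB.trans hPαB
  have hP1 : 1 ≤ P := by exact_mod_cast hP1'
  have hPS : (S : ℝ) ^ (8 * w) ≤ P := by
    refine le_trans ?_ hP
    calc (S : ℝ) ^ (8 * w) ≤ (S : ℝ) ^ (8 * w) + (4 + 8 * (A : ℝ) ^ 2) ^ (j + 1) := by linarith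
      _ ≤ _ := le_mul_of_one_le_right (by positivity) hαB
  -- T⁸ = P^(1/w) is the parameter u of the saving; the first summand of `threshold` makes T at
  -- least `sizeConst`.
  set T := (P : ℝ) ^ (((8 * w : ℕ) : ℝ)⁻¹) with hT
  have hTP : T ^ (8 * w) = P := Real.rpow_inv_natCast_pow (by linarith) (by omega)
  have hT0 : 0 ≤ T := Real.rpow_nonneg (by linarith) _
  have hTS : (S : ℝ) ≤ T :=
    le_of_pow_le_pow_left₀ (n := 8 * w) (by omega) hT0 (by rwa [hTP])
  have hT2 : 2 ≤ T := hS0.trans hTS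
  have hu : 2 ≤ T ^ 8 := by
    calc (2 : ℝ) ≤ T := hT2
      _ = T ^ 1 := (pow_one _).symm
      _ ≤ T ^ 8 := pow_le_pow_right₀ (by linarith) (by norm_num)
  have huP : (T ^ 8) ^ (2 * (j + 1) * N * (G * (G + 1))) = P := by
    rw [← hw', ← pow_mul, hTP]
  -- The second summand of `threshold` makes X large enough that p² > x yields both p ≥ 2A and p² ≥
  -- 2B, hence g(p) ≥ p^(j+1)/2 ≥ B ≥ β.
  have hXlow : (4 + 8 * (A : ℝ) ^ 2) * B ≤ X := by
    refine le_of_pow_le_pow_left₀ (n := j + 1) (by omega) hX ?_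
    rw [hXP]
    calc ((4 + 8 * (A : ℝ) ^ 2) * B) ^ (j + 1)
        = 1 * B ^ j * ((4 + 8 * (A : ℝ) ^ 2) ^ (j + 1) * (1 * B)) * 1 := by
          rw [mul_pow, pow_succ B]
          ring
      _ ≤ α ^ ((2 * j + 1) * G) * B ^ j * P * ζ ^ (j + 1) := by
          have e1 : 1 ≤ α ^ ((2 * j + 1) * G) := one_le_pow₀ hα
          have e2 : 1 ≤ ζ ^ (j + 1) := one_le_pow₀ hζ
          have e3 : 1 ≤ α ^ (G + 1) := one_le_pow₀ hα
          have e4 : (4 + 8 * (A : ℝ) ^ 2) ^ (j + 1) * (1 * B) ≤ P := by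
            refine le_trans ?_ hP
            gcongr
            linarith
          gcongr
  have hB0 : 0 ≤ B := by linarith
  have hX4 : 4 ≤ X := by
    refine le_trans ?_ hXlow
    nlinarith [mul_nonneg (sq_nonneg (A : ℝ)) hB0]
  obtain ⟨x, hx⟩ : ∃ x, x = ⌊X⌋₊ := ⟨_, rfl⟩
  have hxX : (x : ℝ) ≤ X := hx ▸ Nat.floor_le hX
  have hXx1 : X < x + 1 := hx ▸ Nat.lt_floor_add_one X
  have hx1 : 1 ≤ x := by
    have : (1 : ℝ) ≤ x := by linarith
    exact_mod_cast this
  have hXx : X ≤ 2 * x := by linarith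
  obtain ⟨δ, hδ0, hδ1, hδ2, hδ3, hδ4, hδ5⟩ :=
    exists_saving hj hN hjG hα hB hu huP hPαB hζ hζP hX hXP hx1 hXx
  have hxT : (x : ℝ) ≤ T ^ (32 * w * (2 ^ j * 2 ^ j)) := by
    have h1 := length_le_pow hN (by omega) hα hB hPαB hζ hζP hXP
    rw [← hG]
    calc (x : ℝ) ≤ P ^ (4 * G) := hxX.trans h1
      _ = T ^ (32 * w * G) := by
        rw [← hTP, ← pow_mul]
        congr 1
        ring
  have hcoeff : (phase g α β).coeff (j + 1) = (α / g.leadingCoeff)⁻¹ := by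
    rw [coeff_phase (by omega), leadingCoeff, hg, inv_div]
    ring
  have hαP : α ≤ P := by
    refine le_trans ?_ hPαB
    calc α = α ^ 1 * 1 := by ring
      _ ≤ α ^ (G + 1) * B := by
        have := pow_le_pow_right₀ hα (by omega : 1 ≤ G + 1)
        gcongr
  obtain ⟨p, hp, hpx, hxp, hnd⟩ := exists_prime_of_approx (f := phase g α β) hj hw1
    ((natDegree_phase_le g α β).trans hg.le) hP1 hco (by rw [hcoeff]; exact happ) hα hαP
    (hSS ▸ hTS) hTP.symm hx1 hxT hδ0 hδ1 hδ2 (by rw [← hG]; exact hδ3) (by rw [← hG]; exact hδ4)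
    (by rw [← hG]; exact hδ5)
  have hpX : (p : ℝ) ≤ X := le_trans (by exact_mod_cast hpx) hxX
  refine ⟨p, hp, ?_, hpX⟩
  have hxp' : (x : ℝ) < (p : ℝ) ^ 2 := by exact_mod_cast hxp
  have hxlow : (2 + 4 * (A : ℝ) ^ 2) * B ≤ x := by linarith
  have hpA : 2 * A ≤ p := by
    have h1 : (2 * (A : ℝ)) ^ 2 ≤ (p : ℝ) ^ 2 := by
      have : (2 + 4 * (A : ℝ) ^ 2) * 1 ≤ (2 + 4 * (A : ℝ) ^ 2) * B := by gcongr
      nlinarith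
    have h2 : 2 * (A : ℝ) ≤ p := le_of_pow_le_pow_left₀ (n := 2) (by norm_num) (by positivity) h1
    exact_mod_cast h2
  have hgp := pow_le_two_mul_eval (by omega) hg hlc hA hp.one_lt.le hpA
  have hgp' : (p : ℝ) ^ (j + 1) ≤ 2 * ((g.eval (p : ℤ) : ℤ) : ℝ) := by exact_mod_cast hgp
  refine mem_beattySet_of_nd_lt (by linarith) ?_ ?_
  · have hp1 : (1 : ℝ) ≤ p := by exact_mod_cast hp.one_lt.le
    have h1 : (p : ℝ) ^ 2 ≤ (p : ℝ) ^ (j + 1) := pow_le_pow_right₀ hp1 (by omega)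
    have h2 : 2 * B ≤ (2 + 4 * (A : ℝ) ^ 2) * B :=
      mul_le_mul_of_nonneg_right (by linarith [sq_nonneg (A : ℝ)]) hB0
    linarith
  · rw [← eval_phase]
    exact hnd

/-! ### Computability of the shift. -/

section Computability

variable {σ : Type*} [Primcodable σ] {f g h : σ → ℕ}

lemma primrec_add (hf : Primrec f) (hg : Primrec g) : Primrec fun a => f a + g a :=
  Primrec.nat_add.comp hf hg

lemma primrec_mul (hf : Primrec f) (hg : Primrec g) : Primrec fun a => f a * g a :=
  Primrec.nat_mul.comp hf hg

lemma primrec_pow (hf : Primrec f) (hg : Primrec g) : Primrec fun a => f a ^ g a := by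
  have h1 : Primrec₂ fun (n : ℕ) (p : ℕ × ℕ) => p.2 * n :=
    Primrec.nat_mul.comp (Primrec.snd.comp Primrec.snd) Primrec.fst
  have h2 := Primrec.nat_rec (f := fun _ : ℕ => 1) (g := fun n p => p.2 * n) (Primrec.const 1) h1
  have h3 : Primrec₂ fun n m : ℕ => n ^ m := by
    refine h2.of_eq fun n m => ?_
    induction m with
    | zero => simp
    | succ m ih =>
      simp only at ih ⊢
      rw [ih, pow_succ]
  exact h3.comp hf hg

lemma primrec_factorial (hf : Primrec f) : Primrec fun a => (f a).factorial := by
  have h1 : Primrec₂ fun (n : ℕ) (p : ℕ) => (n + 1) * p :=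
    Primrec.nat_mul.comp (Primrec.succ.comp Primrec.fst) Primrec.snd
  have h2 : Primrec fun n : ℕ => n.factorial := by
    refine (Primrec.nat_rec₁ 1 h1).of_eq fun n => ?_
    induction n with
    | zero => rfl
    | succ n ih =>
      rw [Nat.factorial_succ, ← ih]
  exact h2.comp hf

lemma primrec_bilinearConst (hf : Primrec f) : Primrec fun a => bilinearConst (f a) := by
  have c (n : ℕ) : Primrec fun _ : σ => n := Primrec.const n
  unfold bilinearConst
  exact primrec_mul (primrec_pow (c 2) (primrec_pow (c 2) hf)) (primrec_add (primrec_add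
    (primrec_mul hf (primrec_pow (c 2) hf)) (primrec_mul (c 16) (primrec_mul (primrec_pow
    (primrec_factorial (primrec_add hf (c 1))) (c 2)) (primrec_add hf (c 2))))) (c 8))

lemma primrec_linearConst (hf : Primrec f) : Primrec fun a => linearConst (f a) := by
  have c (n : ℕ) : Primrec fun _ : σ => n := Primrec.const n
  unfold linearConst
  exact primrec_mul (primrec_mul (primrec_pow (c 2) (primrec_pow (c 2) hf))
    (primrec_add (primrec_add (primrec_mul hf (primrec_pow (c 2) hf)) (primrec_mul (c 16)
    (primrec_mul (primrec_factorial (primrec_add hf (c 1)))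
    (primrec_pow (c 2) (primrec_add hf (c 1)))))) (c 8))) (primrec_pow (c 2) (primrec_add hf (c 3)))

lemma primrec_expConst (hf : Primrec f) : Primrec fun a => expConst (f a) := by
  have c (n : ℕ) : Primrec fun _ : σ => n := Primrec.const n
  unfold expConst
  exact primrec_add (primrec_add (c 2) (primrec_mul (c 4) (primrec_linearConst hf)))
    (primrec_mul (c 16) (primrec_add (primrec_add hf (c 1))
    (primrec_mul (c 4) (primrec_bilinearConst hf))))

lemma primrec_divConst (hf : Primrec f) (hg : Primrec g) :
    Primrec fun a => divConst (f a) (g a) := by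
  have c (n : ℕ) : Primrec fun _ : σ => n := Primrec.const n
  have h1 : Primrec fun a => (2 * f a + 2) * g a :=
    primrec_mul (primrec_add (primrec_mul (c 2) hf) (c 2)) hg
  unfold divConst
  exact primrec_mul (primrec_mul (primrec_pow (c 2) h1) (primrec_pow (primrec_mul (c 2)
    (primrec_pow h1 h1)) (primrec_pow (c 2) h1))) (primrec_mul (primrec_mul (primrec_pow
    (primrec_factorial (primrec_add hf (c 1))) (c 2)) (primrec_add hf (c 2)))
    (primrec_pow (c 2) (primrec_add hf (c 2))))

lemma primrec_four_pow (hf : Primrec f) : Primrec fun a => 2 ^ f a * 2 ^ f a :=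
  primrec_mul (primrec_pow (Primrec.const 2) hf) (primrec_pow (Primrec.const 2) hf)

lemma primrec_sizeConst (hf : Primrec f) (hg : Primrec g) :
    Primrec fun a => sizeConst (f a) (g a) := by
  have c (n : ℕ) : Primrec fun _ : σ => n := Primrec.const n
  have h1 : Primrec fun a => 32 * g a * (2 ^ f a * 2 ^ f a) :=
    primrec_mul (primrec_mul (c 32) hg) (primrec_four_pow hf)
  have h2 : Primrec fun a => divExp (f a) (g a) := by
    unfold divExp
    exact primrec_mul h1 (primrec_add hf (c 2))
  unfold sizeConst
  exact primrec_mul (primrec_mul (primrec_mul (primrec_mul (c 640) (primrec_expConst hf))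
    (primrec_divConst hf h2)) (primrec_pow (primrec_add (c 1) h1) (c 3)))
    (primrec_pow (primrec_add (primrec_mul (c 2) hg) (c 1)) (c 2))

lemma primrec_threshold (hf : Primrec f) (hg : Primrec g) (hh : Primrec h) :
    Primrec fun a => threshold (f a) (g a) (h a) := by
  have c (n : ℕ) : Primrec fun _ : σ => n := Primrec.const n
  have h1 : Primrec fun a => scaleExp (f a) (g a) := by
    unfold scaleExp
    exact primrec_mul (primrec_mul (primrec_mul (c 2) (primrec_add hf (c 1))) hg)
      (primrec_mul (primrec_four_pow hf) (primrec_add (primrec_four_pow hf) (c 1)))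
  unfold threshold
  exact primrec_add (primrec_pow (primrec_sizeConst hf h1) (primrec_mul (c 8) h1))
    (primrec_pow (primrec_add (c 4) (primrec_mul (c 8) (primrec_pow hh (c 2))))
    (primrec_add hf (c 1)))

end Computability

/-- The code of a list of integers; it bounds the absolute values of the members. -/
def listCode (cs : List ℤ) : ℕ := @Encodable.encode (List ℤ) Primcodable.toEncodable cs

lemma natAbs_le_encode (z : ℤ) :
    z.natAbs ≤ @Encodable.encode ℤ (Primcodable.toEncodable) z := by
  have h1 : @Encodable.encode ℤ (Primcodable.toEncodable) z = Equiv.intEquivNat z := rfl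
  rw [h1]
  rcases z with n | n
  · have h2 : Equiv.intEquivNat (Int.ofNat n) = 2 * n := rfl
    rw [h2]
    simp only [Int.ofNat_eq_natCast, Int.natAbs_natCast]
    omega
  · have h2 : Equiv.intEquivNat (Int.negSucc n) = 2 * n + 1 := rfl
    rw [h2, Int.natAbs_negSucc]
    omega

/-- A list is encoded by iterated pairing, and a pair dominates both components. The code is thus a
computable bound for all coefficients at once. -/
lemma natAbs_le_listCode {cs : List ℤ} {z : ℤ} (hz : z ∈ cs) : z.natAbs ≤ listCode cs := by
  induction cs with
  | nil => simp at hz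
  | cons y cs ih =>
    have h1 : listCode (y :: cs)
        = Nat.succ (Nat.pair (@Encodable.encode ℤ (Primcodable.toEncodable) y) (listCode cs)) :=
      rfl
    rw [h1]
    rcases List.mem_cons.mp hz with rfl | h2
    · have h3 := natAbs_le_encode z
      have h4 := Nat.left_le_pair (@Encodable.encode ℤ (Primcodable.toEncodable) z) (listCode cs)
      omega
    · have h3 := ih h2
      have h4 := Nat.right_le_pair (@Encodable.encode ℤ (Primcodable.toEncodable) y) (listCode cs)
      omega

/-- The shift of the index of the convergents. -/
def shift (cs : List ℤ) (N : ℕ) : ℕ :=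
  3 + 2 * threshold (cs.length - 2) N (cs.length * listCode cs)

lemma one_le_shift (cs : List ℤ) (N : ℕ) : 1 ≤ shift cs N := by
  unfold shift
  omega

/-- One step passes from p_m to p_(m+1), which exceeds the bound defining m; then t + 1 double steps
multiply the numerator by at least 2^(t+1) > t. -/
lemma exists_shift_eq {cs : List ℤ} {j : ℕ} (h : cs.length = j + 2) (N : ℕ) :
    ∃ t, t = threshold j N (cs.length * listCode cs) ∧
      ∀ m, m + shift cs N = m + 1 + 2 * (t + 1) := by
  refine ⟨_, rfl, fun m => ?_⟩
  have h1 : cs.length - 2 = j := by omega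
  rw [shift, h1]
  ring

lemma computable_shift : Computable₂ shift := by
  have h1 : Primrec fun p : List ℤ × ℕ => p.1.length := Primrec.list_length.comp Primrec.fst
  have h2 : Primrec fun p : List ℤ × ℕ => listCode p.1 := Primrec.encode.comp Primrec.fst
  have h3 : Primrec fun p : List ℤ × ℕ => shift p.1 p.2 := by
    unfold shift
    exact primrec_add (Primrec.const 3) (primrec_mul (Primrec.const 2) (primrec_threshold
      (Primrec.nat_sub.comp h1 (Primrec.const 2)) Primrec.snd (primrec_mul h1 h2)))
  exact h3.to_comp

lemma sum_natAbs_coeff_le {g : ℤ[X]} {k : ℕ} (hk : 1 ≤ k) (hg : g.natDegree = k) :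
    g.coeffList.length = k + 1 ∧ ∑ i ∈ Finset.range k, (g.coeff i).natAbs
      ≤ g.coeffList.length * listCode g.coeffList := by
  have hg0 : g ≠ 0 := by
    rintro rfl
    rw [natDegree_zero] at hg
    omega
  have hlen : g.coeffList.length = k + 1 := by
    rw [length_coeffList_eq_ite, if_neg hg0, hg]
  refine ⟨hlen, ?_⟩
  rw [hlen]
  have h1 : ∀ i ∈ Finset.range k, (g.coeff i).natAbs ≤ listCode g.coeffList := by
    intro i hi
    rw [Finset.mem_range] at hi
    refine natAbs_le_listCode ?_
    rw [coeffList, List.mem_map]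
    refine ⟨i, ?_, rfl⟩
    rw [List.mem_reverse, List.mem_range, withBotSucc_degree_eq_natDegree_add_one hg0, hg]
    omega
  calc ∑ i ∈ Finset.range k, (g.coeff i).natAbs
      ≤ ∑ _i ∈ Finset.range k, listCode g.coeffList := Finset.sum_le_sum h1
    _ = k * listCode g.coeffList := by simp
    _ ≤ (k + 1) * listCode g.coeffList := Nat.mul_le_mul_right _ (by omega)

/-! ### The index m, the exponents, and the conclusion. -/

lemma exists_unique_index {P : ℕ → ℕ} (hmono : Monotone P)
    (hgrow : ∀ n i, 2 ^ i * P n ≤ P (n + 2 * i)) (hP1 : 1 ≤ P 1) {V : ℝ} (hV : (P 0 : ℝ) ≤ V) :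
    ∃ m : ℕ, ((P m : ℝ) ≤ V ∧ V < P (m + 1)) ∧
      ∀ i : ℕ, ((P i : ℝ) ≤ V ∧ V < P (i + 1)) → i = m := by
  classical
  have hex : ∃ n, V < P (n + 1) := by
    obtain ⟨i, hi⟩ := exists_nat_gt V
    refine ⟨2 * i, hi.trans_le ?_⟩
    have h1 := hgrow 1 i
    have h2 : i ≤ P (2 * i + 1) := by
      calc i ≤ 2 ^ i * 1 := by
            rw [mul_one]
            exact Nat.lt_two_pow_self.le
        _ ≤ 2 ^ i * P 1 := Nat.mul_le_mul_left _ hP1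
        _ ≤ P (1 + 2 * i) := h1
        _ = P (2 * i + 1) := by rw [add_comm]
    exact_mod_cast h2
  have huniq : ∀ a b : ℕ, (P a : ℝ) ≤ V → V < P (b + 1) → a ≤ b := by
    intro a b ha hb
    by_contra hab
    have h1 : P (b + 1) ≤ P a := hmono (by omega)
    have h2 : (P (b + 1) : ℝ) ≤ P a := by exact_mod_cast h1
    linarith
  have hm : (P (Nat.find hex) : ℝ) ≤ V := by
    rcases Nat.eq_zero_or_pos (Nat.find hex) with h | h
    · rw [h]
      exact hV
    · have h1 := Nat.find_min hex (m := Nat.find hex - 1) (by omega)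
      rw [Nat.sub_add_cancel h] at h1
      exact not_lt.mp h1
  refine ⟨Nat.find hex, ⟨hm, Nat.find_spec hex⟩, fun i hi => ?_⟩
  exact le_antisymm (huniq _ _ hi.1 (Nat.find_spec hex)) (huniq _ _ hm hi.2)

/-- Passes from integral powers of α, B, P to the exponents of the final bound, with G = 1/γ. -/
lemma rpow_bound_eq {j : ℕ} {G α B P ε : ℝ} (hα : 0 < α) (hB : 0 < B) (hP : 0 < P) {M : ℕ}
    (hG : G = M) (hM : 1 ≤ M) :
    (α ^ ((2 * j + 1) * M) * B ^ j * P) ^ (((j + 1 : ℕ) : ℝ)⁻¹)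
      * (P ^ M / (α ^ (M + 1) * B ^ M)) ^ ε
    = α ^ ((2 * ((j + 1 : ℕ) : ℝ) - 1) / (((j + 1 : ℕ) : ℝ) * G⁻¹) - (G⁻¹ + 1) * ε / G⁻¹) *
      B ^ ((((j + 1 : ℕ) : ℝ) - 1) / ((j + 1 : ℕ) : ℝ) - ε / G⁻¹) *
      P ^ (1 / ((j + 1 : ℕ) : ℝ) + ε / G⁻¹) := by
  have hG0 : (0 : ℝ) < M := by exact_mod_cast hM
  have hj0 : (0 : ℝ) < ((j + 1 : ℕ) : ℝ) := by positivity
  rw [Real.div_rpow (by positivity) (by positivity), Real.mul_rpow (by positivity) (by positivity),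
    Real.mul_rpow (by positivity) (by positivity), Real.mul_rpow (by positivity) (by positivity),
    ← Real.rpow_natCast, ← Real.rpow_natCast, ← Real.rpow_natCast, ← Real.rpow_natCast,
    ← Real.rpow_natCast, ← Real.rpow_mul hα.le, ← Real.rpow_mul hB.le, ← Real.rpow_mul hP.le,
    ← Real.rpow_mul hα.le, ← Real.rpow_mul hB.le, Real.rpow_sub hα, Real.rpow_sub hB,
    Real.rpow_add hP, hG]
  have e1 : (2 * ((j + 1 : ℕ) : ℝ) - 1) / (((j + 1 : ℕ) : ℝ) * (M : ℝ)⁻¹)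
      = (((2 * j + 1) * M : ℕ) : ℝ) * ((j + 1 : ℕ) : ℝ)⁻¹ := by
    push_cast
    field_simp
    ring
  have e2 : ((M : ℝ)⁻¹ + 1) * ε / (M : ℝ)⁻¹ = ((M + 1 : ℕ) : ℝ) * ε := by
    push_cast
    field_simp
    ring
  have e3 : (((j + 1 : ℕ) : ℝ) - 1) / ((j + 1 : ℕ) : ℝ) = (j : ℝ) * ((j + 1 : ℕ) : ℝ)⁻¹ := by
    push_cast
    field_simp
    ring
  have e4 : ε / (M : ℝ)⁻¹ = (M : ℝ) * ε := by
    field_simp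
  rw [e1, e2, e3, e4, one_div]
  have h1 : α ^ (((M + 1 : ℕ) : ℝ) * ε) ≠ 0 := (Real.rpow_pos_of_pos hα _).ne'
  have h2 : B ^ ((M : ℝ) * ε) ≠ 0 := (Real.rpow_pos_of_pos hB _).ne'
  field_simp

lemma gam_eq (j : ℕ) : gam (j + 1) = (((2 ^ j * 2 ^ j : ℕ) : ℝ))⁻¹ := by
  have h1 : (1 : ℝ) - ((j + 1 : ℕ) : ℝ) = -(j : ℝ) := by
    push_cast
    ring
  rw [gam, h1, Real.rpow_neg (by norm_num), Real.rpow_natCast, ← mul_pow]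
  norm_num

/-- The bound for the least prime, for one convergent. -/
lemma exists_prime_le_rpow {j N A : ℕ} (hj : 1 ≤ j) (hN : 1 ≤ N) {g : ℤ[X]}
    (hg : g.natDegree = j + 1) (hlc : 1 ≤ g.leadingCoeff)
    (hA : ∑ i ∈ Finset.range (j + 1), (g.coeff i).natAbs ≤ A) {α β B ε : ℝ} {P : ℕ} {a : ℤ}
    (hα : 1 ≤ α) (hB : 1 ≤ B) (hβ : β ≤ B) (hε : 1 / (N : ℝ) ≤ ε) (hco : IsCoprime a (P : ℤ))
    (happ : |(α / g.leadingCoeff)⁻¹ - a / P| ≤ 1 / (P : ℝ) ^ 2)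
    (hP : threshold j N A * (α ^ (2 ^ j * 2 ^ j + 1) * B) ≤ P)
    (hP' : α ^ (2 ^ j * 2 ^ j + 1) * B ≤ P) :
    ∃ p : ℕ, p.Prime ∧ g.eval (p : ℤ) ∈ BeattySet α β ∧ (p : ℝ) ≤
      α ^ ((2 * ((j + 1 : ℕ) : ℝ) - 1) / (((j + 1 : ℕ) : ℝ) * gam (j + 1))
        - (gam (j + 1) + 1) * ε / gam (j + 1)) *
      B ^ ((((j + 1 : ℕ) : ℝ) - 1) / ((j + 1 : ℕ) : ℝ) - ε / gam (j + 1)) *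
      (P : ℝ) ^ (1 / ((j + 1 : ℕ) : ℝ) + ε / gam (j + 1)) := by
  obtain ⟨G, hG⟩ : ∃ G, G = 2 ^ j * 2 ^ j := ⟨_, rfl⟩
  have hjG : j + 1 ≤ G := hG ▸ succ_le_two_pow_mul j
  have hαB : 1 ≤ α ^ (G + 1) * B := one_le_mul_of_one_le_of_one_le (one_le_pow₀ hα) hB
  rw [← hG] at hP'
  have hP1 : (1 : ℝ) ≤ P := hαB.trans hP'
  obtain ⟨Z, hZ⟩ : ∃ Z : ℝ, Z = (P : ℝ) ^ G / (α ^ (G + 1) * B ^ G) := ⟨_, rfl⟩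
  have hZ1 : 1 ≤ Z := by
    rw [hZ, one_le_div (by positivity)]
    calc α ^ (G + 1) * B ^ G = (α ^ (G + 1)) ^ 1 * B ^ G := by rw [pow_one]
      _ ≤ (α ^ (G + 1)) ^ G * B ^ G := by
          refine mul_le_mul_of_nonneg_right ?_ (by positivity)
          exact pow_le_pow_right₀ (one_le_pow₀ hα) (by omega)
      _ = (α ^ (G + 1) * B) ^ G := (mul_pow _ _ _).symm
      _ ≤ (P : ℝ) ^ G := by gcongr
  obtain ⟨F, hF⟩ : ∃ F : ℝ, F = α ^ ((2 * j + 1) * G) * B ^ j * P := ⟨_, rfl⟩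
  have hF0 : 0 < F := by
    rw [hF]
    positivity
  -- The proof works with the exponent 1/N; since Z ≥ 1 and 1/N ≤ ε, the bound only grows when 1/N
  -- is replaced by ε.
  set ζ := Z ^ ((N : ℝ)⁻¹) with hζ
  have hζ1 : 1 ≤ ζ := Real.one_le_rpow hZ1 (by positivity)
  have hζN : ζ ^ N = Z := Real.rpow_inv_natCast_pow (by linarith) (by omega)
  have hFj : (F ^ (((j + 1 : ℕ) : ℝ)⁻¹)) ^ (j + 1) = F :=
    Real.rpow_inv_natCast_pow hF0.le (by omega)
  obtain ⟨p, hp, hpB, hpX⟩ := exists_prime_mem_beattySet (X := F ^ (((j + 1 : ℕ) : ℝ)⁻¹) * ζ)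
    hj hN hg hlc hA hα hB hβ hco happ hP hζ1
    (by
      rw [← hG, hζN, hZ]
      field_simp)
    (by positivity) (by rw [mul_pow, hFj, hF, hG])
  refine ⟨p, hp, hpB, hpX.trans ?_⟩
  rw [gam_eq, ← hG, ← rpow_bound_eq (by linarith) (by linarith) (by linarith) rfl (by omega),
    ← hF, ← hZ]
  refine mul_le_mul_of_nonneg_left ?_ (by positivity)
  rw [hζ]
  exact Real.rpow_le_rpow_of_exponent_le hZ1 (by rwa [← one_div])

end BeattyPrime

theorem theorem2 :
    ∃ l : List ℤ → ℕ → ℕ, Computable₂ l ∧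
      ∀ g : ℤ[X], 2 ≤ g.natDegree → 1 ≤ g.leadingCoeff →
      ∀ (k : ℕ) (γ : ℝ), k = g.natDegree → γ = gam k →
      ∀ ε : ℝ, 0 < ε → ∀ N : ℕ, 1 ≤ N → 1 / (N : ℝ) ≤ ε →
        1 ≤ l g.coeffList N ∧
        ∀ α : ℝ, Irrational α → 1 < α → ∀ β B : ℝ, B = max 1 β →
          ∃ m : ℕ,
            (∀ j : ℕ,
              (cfNum (α / (g.leadingCoeff : ℝ)) j ≤ α ^ ((1 + γ) / γ) * B ∧
                α ^ ((1 + γ) / γ) * B < cfNum (α / (g.leadingCoeff : ℝ)) (j + 1)) ↔ j = m) ∧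
            ∃ p : ℕ,
              IsLeast {r : ℕ | r.Prime ∧ g.eval (r : ℤ) ∈ BeattySet α β} p ∧
              (p : ℝ) ≤
                α ^ ((2 * (k : ℝ) - 1) / ((k : ℝ) * γ) - (γ + 1) * ε / γ) *
                B ^ (((k : ℝ) - 1) / (k : ℝ) - ε / γ) *
                cfNum (α / (g.leadingCoeff : ℝ)) (m + l g.coeffList N) ^
                  (1 / (k : ℝ) + ε / γ) := by
  classical
  refine ⟨BeattyPrime.shift, BeattyPrime.computable_shift, ?_⟩
  intro g hg2 hlc k γ hk hγ ε _ N hN hε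
  obtain ⟨j, rfl⟩ : ∃ j, k = j + 1 := ⟨k - 1, by omega⟩
  have hj : 1 ≤ j := by omega
  obtain ⟨hlen, hA⟩ := BeattyPrime.sum_natAbs_coeff_le (by omega) hk.symm
  refine ⟨BeattyPrime.one_le_shift _ _, ?_⟩
  intro α hirr hα β B hB
  have hB1 : 1 ≤ B := hB ▸ le_max_left _ _
  have hβB : β ≤ B := hB ▸ le_max_right _ _
  have hlc0 : (1 : ℝ) ≤ (g.leadingCoeff : ℝ) := by exact_mod_cast hlc
  have hv : 0 < α / (g.leadingCoeff : ℝ) := by positivity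
  have hvirr : Irrational (α / (g.leadingCoeff : ℝ)) := hirr.div_intCast (by omega)
  obtain ⟨P, hP, hP0, hmono, hgrow, hP1, happ⟩ := BeattyPrime.exists_numerators hv hvirr
  have hG1 : 1 ≤ 2 ^ j * 2 ^ j := Nat.mul_pos (by positivity) (by positivity)
  have hG0 : (0 : ℝ) < ((2 ^ j * 2 ^ j : ℕ) : ℝ) := by exact_mod_cast hG1
  have hexp : α ^ ((1 + γ) / γ) = α ^ (2 ^ j * 2 ^ j + 1) := by
    have h1 : (1 + γ) / γ = ((2 ^ j * 2 ^ j + 1 : ℕ) : ℝ) := by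
      rw [hγ, BeattyPrime.gam_eq, Nat.cast_add, Nat.cast_one]
      field_simp
    rw [h1, Real.rpow_natCast]
  rw [hexp]
  simp only [hP]
  -- p_0 ≤ α/a_k ≤ α, so the bound is not below the first numerator and the index m exists.
  have hV0 : (P 0 : ℝ) ≤ α ^ (2 ^ j * 2 ^ j + 1) * B := by
    calc (P 0 : ℝ) ≤ α / (g.leadingCoeff : ℝ) := hP0
      _ ≤ α := div_le_self (by linarith) hlc0
      _ = α ^ 1 * 1 := by ring
      _ ≤ α ^ (2 ^ j * 2 ^ j + 1) * B := by
          refine mul_le_mul (pow_le_pow_right₀ hα.le (by omega)) hB1 zero_le_one (by positivity)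
  obtain ⟨m, ⟨hm1, hm2⟩, hm⟩ := BeattyPrime.exists_unique_index hmono hgrow hP1 hV0
  refine ⟨m, fun i => ⟨hm i, ?_⟩, ?_⟩
  · rintro rfl
    exact ⟨hm1, hm2⟩
  obtain ⟨t, ht, hshift⟩ := BeattyPrime.exists_shift_eq (j := j) hlen N
  rw [hshift]
  obtain ⟨a, hco, ha⟩ := happ (m + 1 + 2 * (t + 1)) (by omega)
  -- The factor t + 1, rather than t, gives both P ≥ t·V and P ≥ V for V = α^(G+1) B.
  have hlarge : ((t + 1 : ℕ) : ℝ) * (α ^ (2 ^ j * 2 ^ j + 1) * B)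
      ≤ P (m + 1 + 2 * (t + 1)) := by
    have h1 : (t + 1) * P (m + 1) ≤ P (m + 1 + 2 * (t + 1)) :=
      (Nat.mul_le_mul_right _ Nat.lt_two_pow_self.le).trans (hgrow (m + 1) (t + 1))
    have h2 : ((t + 1 : ℕ) : ℝ) * P (m + 1) ≤ P (m + 1 + 2 * (t + 1)) := by exact_mod_cast h1
    refine le_trans ?_ h2
    gcongr
  have hV1 : 0 < α ^ (2 ^ j * 2 ^ j + 1) * B := by positivity
  have ht0 : (0 : ℝ) ≤ t := Nat.cast_nonneg _
  rw [Nat.cast_add, Nat.cast_one] at hlarge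
  obtain ⟨p, hp, hpB, hple⟩ := BeattyPrime.exists_prime_le_rpow hj hN hk.symm hlc hA hα.le hB1
    hβB hε hco ha (by rw [← ht]; nlinarith) (by nlinarith)
  have hex : ∃ r : ℕ, r.Prime ∧ g.eval (r : ℤ) ∈ BeattySet α β := ⟨p, hp, hpB⟩
  refine ⟨Nat.find hex, ⟨Nat.find_spec hex, fun r hr => Nat.find_min' hex hr⟩, ?_⟩
  rw [hγ]
  refine le_trans ?_ hple
  exact_mod_cast Nat.find_min' hex ⟨hp, hpB⟩
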